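/- **Setting.** Let $n,m,d\in\mathbb N$, let $A\in\mathbb R^{n\times n}$, $B\in\mathbb R^{n\times m}$ with $(A,B)$ controllable, and let $Q\in\mathbb R^{n\times n}$, $R\in\mathbb R^{m\times m}$ be (symmetric) positive definite. Let $\rho_0$ be a probability measure on $\mathbb R^n$ with full support and finite second moment. For a policy $\pi:\mathbb R^n\to\mathbb R^m$ and $\gamma\in[0,1]$ put $$C_\gamma(\pi)=\mathbb E_{x_0\sim\rho_0}\sum_{t\ge0}\gamma^t\big(x_t^\top Qx_t+u_t^\top Ru_t\big)\in[0,\infty],\qquad u_t=\pi(x_t),\quad x_{t+1}=Ax_t+Bu_t .$$ Let $P_\gamma$ be the positive definite solution of $P=\gamma A^\top PA-\gamma^2A^\top PB(R+\gamma B^\top PB)^{-1}B^\top PA+Q$ and let $K_\gamma^*=-\gamma(R+\gamma B^\top P_\gamma B)^{-1}B^\top P_\gamma A$ be the $\gamma$-optimal gain. Let $f_1,\dots,f_d:\mathbb R^n\to\mathbb R^m$ be globally Lipschitz, $\pi_\theta=\sum_k\theta_kf_k$ for $\theta\in\mathbb R^d$, and $C_\gamma(\theta)=C_\gamma(\pi_\theta)$.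 Assume that 1. the functions $f_k$ are linearly independent; 2. for every $\gamma\in[0,1]$, the map $x\mapsto K^*_\gamma x$ lies in $\mathrm{Span}\{f_k\}$. **Algorithm.** A policy gradient flow for $C_\gamma$ is an absolutely continuous curve $\theta:[0,\infty)\to\mathbb R^d$ such that $C_\gamma$ is finite and Lipschitz near every $\theta(s)$ and $\theta'(s)\in-\partial C_\gamma(\theta(s))$ for almost every $s$, where $\partial$ is Clarke's generalized gradient (the convex hull of the limits of gradients at nearby points; so $\theta'=-\nabla C_\gamma(\theta)$ where $C_\gamma$ is $C^1$). We write $\mathrm{PG}(\theta_0,\gamma)=\theta_1$ if at least one such flow starts at $\theta_0$ and every such flow starting at $\theta_0$ converges to $\theta_1$ as $s\to\infty$. Given initial parameters $\theta(0)$ and increasing discount factors $\gamma_1<\gamma_2<\cdots$ in $[0,1]$, the homotopy algorithm sets $\hat\theta_0=\theta(0)$ and $\hat\theta_j=\mathrm{PG}(\hat\theta_{j-1},\gamma_j)$. **Claim.** There is $\theta^*\in\mathbb R^d$ that is globally optimal for the undiscounted LQR, that is, $\pi_{\theta^*}(x)=K_1^*x$ for all $x$ and $C_1(\theta^*)<\infty$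 and $C_1(\theta^*)\le C_1(\pi)$ for all policies $\pi:\mathbb R^n\to\mathbb R^m$, such that: * there is a strictly increasing sequence $(\gamma_j)_{j\ge1}$ in $[0,1]$ with $\gamma_j\to1$ such that, for every $\theta(0)\in\mathbb R^d$, all iterates $\hat\theta_j$ of the homotopy algorithm are defined and $\hat\theta_j\to\theta^*$; * if moreover $f_k(0)=0$ for all $k$, there is also a finite sequence $\gamma_1<\dots<\gamma_N=1$ in $[0,1]$ such that, for every $\theta(0)\in\mathbb R^d$, the iterates $\hat\theta_1,\dots,\hat\theta_N$ are defined and $\hat\theta_N=\theta^*$. -/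

import Mathlib

open Set Filter Topology MeasureTheory
open scoped ENNReal NNReal Matrix

/-- The data of a linear-quadratic regulator with states in `ℝⁿ` and actions in `ℝᵐ`. -/
structure LQR (n m : ℕ) where
  /-- state transition matrix -/
  A : Matrix (Fin n) (Fin n) ℝ
  /-- control matrix -/
  B : Matrix (Fin n) (Fin m) ℝ
  /-- state cost matrix -/
  Q : Matrix (Fin n) (Fin n) ℝ
  /-- action cost matrix -/
  R : Matrix (Fin m) (Fin m) ℝ

namespace LQR

variable {n m : ℕ}

/-- Kalman's condition: the columns of `B, AB, …, Aⁿ⁻¹B` span the state space. -/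
def Controllable (S : LQR n m) : Prop :=
  Submodule.span ℝ {x : Fin n → ℝ | ∃ k < n, ∃ u : Fin m → ℝ, x = (S.A ^ k * S.B) *ᵥ u} = ⊤

/-- The trajectory `x_{t+1} = A x_t + B π(x_t)` started at `x₀`. -/
def traj (S : LQR n m) (π : (Fin n → ℝ) → (Fin m → ℝ)) (x₀ : Fin n → ℝ) : ℕ → (Fin n → ℝ)
  | 0 => x₀
  | t + 1 => S.A *ᵥ traj S π x₀ t + S.B *ᵥ π (traj S π x₀ t)

/-- The running cost `xᵀ Q x + uᵀ R u`. -/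
def stageCost (S : LQR n m) (x : Fin n → ℝ) (u : Fin m → ℝ) : ℝ :=
  x ⬝ᵥ S.Q *ᵥ x + u ⬝ᵥ S.R *ᵥ u

/-- The expected discounted cost of the policy `π`, possibly infinite. -/
noncomputable def cost (S : LQR n m) (ρ₀ : Measure (Fin n → ℝ)) (γ : ℝ)
    (π : (Fin n → ℝ) → (Fin m → ℝ)) : ℝ≥0∞ :=
  ∫⁻ x₀, ∑' t : ℕ,
    ENNReal.ofReal (γ ^ t * S.stageCost (S.traj π x₀ t) (π (S.traj π x₀ t))) ∂ρ₀

/-- `P` is a positive definite solution of the discounted discrete algebraic Riccati equation. -/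
def IsRiccatiSolution (S : LQR n m) (γ : ℝ) (P : Matrix (Fin n) (Fin n) ℝ) : Prop :=
  P.PosDef ∧
    P = γ • (S.Aᵀ * P * S.A)
      - γ ^ 2 • (S.Aᵀ * P * S.B * (S.R + γ • (S.Bᵀ * P * S.B))⁻¹ * (S.Bᵀ * P * S.A)) + S.Q

/-- `K` is the `γ`-optimal gain `K = -γ (R + γ Bᵀ P B)⁻¹ Bᵀ P A`. -/
def IsOptimalGain (S : LQR n m) (γ : ℝ) (K : Matrix (Fin m) (Fin n) ℝ) : Prop :=
  ∃ P, S.IsRiccatiSolution γ P ∧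
    K = -(γ • ((S.R + γ • (S.Bᵀ * P * S.B))⁻¹ * (S.Bᵀ * P * S.A)))

end LQR

/-- The linearly parametrized policy `π_θ = ∑ₖ θₖ fₖ`. -/
def linPolicy {n m d : ℕ} (f : Fin d → (Fin n → ℝ) → (Fin m → ℝ))
    (θ : EuclideanSpace ℝ (Fin d)) : (Fin n → ℝ) → (Fin m → ℝ) :=
  fun x => ∑ k, θ k • f k x

/-- Clarke's generalized gradient of a function that is Lipschitz near `x`: the convex hull of all
limits of gradients of `F` at points tending to `x`. It is `{∇F(x)}` if `F` is `C¹` near `x`. -/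
def clarkeGradient {d : ℕ} (F : EuclideanSpace ℝ (Fin d) → ℝ) (x : EuclideanSpace ℝ (Fin d)) :
    Set (EuclideanSpace ℝ (Fin d)) :=
  convexHull ℝ {g | ∃ y G : ℕ → EuclideanSpace ℝ (Fin d),
    (∀ i, HasGradientAt F (G i) (y i)) ∧ Tendsto y atTop (𝓝 x) ∧ Tendsto G atTop (𝓝 g)}

/-- `θ : [0,∞) → ℝᵈ` is a gradient flow `θ' ∈ -∂C(θ)` of the extended-valued function `C`:
an absolutely continuous curve (the integral of its velocity `v`), along which `C` is finite and
Lipschitz near every point, and whose velocity is almost everywhere the negative of a generalized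
gradient. Values at negative times are irrelevant. Where `C` is `C¹` this says `θ' = -∇C(θ)`. -/
structure IsGradientFlow {d : ℕ} (C : EuclideanSpace ℝ (Fin d) → ℝ≥0∞)
    (θ : ℝ → EuclideanSpace ℝ (Fin d)) : Prop where
  lipschitz_near : ∀ s, 0 ≤ s → ∃ V ∈ 𝓝 (θ s), (∀ y ∈ V, C y ≠ ∞) ∧
    ∃ L : ℝ≥0, LipschitzOnWith L (fun y => (C y).toReal) V
  velocity : ∃ v : ℝ → EuclideanSpace ℝ (Fin d),
    (∀ t, 0 ≤ t → IntervalIntegrable v volume 0 t) ∧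
    (∀ t, 0 ≤ t → θ t = θ 0 + ∫ s in (0 : ℝ)..t, v s) ∧
    ∀ᵐ s : ℝ, 0 ≤ s → -v s ∈ clarkeGradient (fun y => (C y).toReal) (θ s)

/-- `θ₁ = PG(θ₀)`: the policy gradient algorithm for the cost `C` can be run forever from `θ₀`,
and, however it runs, it converges to `θ₁`. -/
def IsPolicyGradientLimit {d : ℕ} (C : EuclideanSpace ℝ (Fin d) → ℝ≥0∞)
    (θ₀ θ₁ : EuclideanSpace ℝ (Fin d)) : Prop :=
  (∃ θ, IsGradientFlow C θ ∧ θ 0 = θ₀) ∧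
    ∀ θ, IsGradientFlow C θ → θ 0 = θ₀ → Tendsto θ atTop (𝓝 θ₁)

/-- The iterates `η 0, η 1, …` of the homotopy algorithm with the `N` (possibly infinitely many)
discount factors `γ 0, γ 1, …`: `η 0` is the initial parameter and `η (j+1) = PG(η j, γ j)`. -/
def IsHomotopyRun {n m d : ℕ} (S : LQR n m) (ρ₀ : Measure (Fin n → ℝ))
    (f : Fin d → (Fin n → ℝ) → (Fin m → ℝ)) (γ : ℕ → ℝ) (N : ℕ∞)
    (η : ℕ → EuclideanSpace ℝ (Fin d)) : Prop :=
  ∀ j : ℕ, (j : ℕ∞) < N →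
    IsPolicyGradientLimit (fun θ => S.cost ρ₀ (γ j) (linPolicy f θ)) (η j) (η (j + 1))

/-- `π_θ` is the optimal linear control of the undiscounted problem, its undiscounted cost is
finite, and no policy whatsoever has a smaller undiscounted cost. -/
def IsUndiscountedOptimum {n m d : ℕ} (S : LQR n m) (ρ₀ : Measure (Fin n → ℝ))
    (f : Fin d → (Fin n → ℝ) → (Fin m → ℝ)) (θ : EuclideanSpace ℝ (Fin d)) : Prop :=
  (∃ K, S.IsOptimalGain 1 K ∧ ∀ x, linPolicy f θ x = K *ᵥ x) ∧
    S.cost ρ₀ 1 (linPolicy f θ) ≠ ∞ ∧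
    ∀ π : (Fin n → ℝ) → (Fin m → ℝ), S.cost ρ₀ 1 (linPolicy f θ) ≤ S.cost ρ₀ 1 π

/-! Let `p γ` be the parameter whose policy is the `γ`-optimal gain. Summing the Bellman equation,
completed to a square (`bellman`), along a trajectory shows that near `p γ` the cost is E xᵀP_γx
plus the excess E ∑ γᵗ |π_δ(x_t)|², where δ = θ - p γ and the norm is that of the action weight R +
γBᵀP_γB. The outputs are linear in δ except that the trajectory depends on δ as well.

In the norm of P_γ, √γ times the optimal closed loop contracts by a factor that is uniform in γ ∈
[0,1] (`exists_uniformBounds`). For small δ the perturbed orbits therefore still decay, and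
shrinking δ to (1-σ)δ multiplies the excess by (1-σ)², up to σ·O(|δ|³) + O(σ²)
(`excessCost_ray_le`). Hence ⟨g, δ⟩ ≥ 2·excess - O(|δ|³) for every gradient g. Linear independence
and full support give excess ≥ h|δ|², so the squared distance to `p γ` is a Lyapunov function on a
ball (`isPolicyGradientLimit_of_ball`). The features are only Lipschitz, so this inequality is
carried over to Clarke gradients, and flows are constructed as limits of Euler schemes.

At γ = 0 later states carry no weight, the ball can be taken arbitrarily large, and the first run
reaches `p 0` from anywhere. Since `p` is Hölder continuous in γ (`exists_parameter_holder`), a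
short step in γ leaves the previous optimum inside the next ball (`exists_radius`). A feature with
f(0) ≠ 0 has a constant part that only the discount damps, so the radius is uniform merely on [0,c]
with c < 1. The step lengths then shrink towards γ = 1 (`exists_strictMono_seq_of_short_steps`). If
all features vanish at 0, the radius is uniform up to γ = 1 and finitely many equal steps suffice.
-/

/-! ### Compactness of convex hulls in finite dimension. -/

theorem Function.Embedding.sum_extend_zero {κ ι F : Type*} [Fintype κ] [Fintype ι]
    [AddCommMonoid F] (e : κ ↪ ι) (u : κ → F) :
    ∑ i, Function.extend e u (fun _ => (0 : F)) i = ∑ j, u j := by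
  classical
  rw [← Finset.sum_subset (Finset.subset_univ (Finset.univ.map e))]
  · simp [e.injective.extend_apply]
  · intro i _ hi
    exact Function.extend_apply' _ _ _ (by simpa using hi)

/-- By Carathéodory, dim + 1 points suffice, so the hull is the continuous image of a simplex times
a power of `K`. Shorter combinations are padded with weight zero at `z₀`. -/
theorem IsCompact.convexHull_of_finiteDimensional {E : Type*} [NormedAddCommGroup E]
    [NormedSpace ℝ E] [FiniteDimensional ℝ E] {K : Set E} (hK : IsCompact K) :
    IsCompact (convexHull ℝ K) := by
  rcases K.eq_empty_or_nonempty with rfl | ⟨z₀, hz₀⟩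
  · simp
  let ι := Fin (Module.finrank ℝ E + 1)
  have hc : IsCompact ((fun p : (ι → ℝ) × (ι → E) => ∑ i, p.1 i • p.2 i) ''
      (stdSimplex ℝ ι ×ˢ Set.univ.pi fun _ => K)) :=
    ((isCompact_stdSimplex ℝ ι).prod (isCompact_univ_pi fun _ => hK)).image (by fun_prop)
  convert hc using 1
  ext x
  constructor
  · intro hx
    obtain ⟨κ, _, z, w, hz, haff, hw, hsum, rfl⟩ := eq_pos_convex_span_of_mem_convexHull hx
    have hcard : Fintype.card κ ≤ Fintype.card ι := by
      simpa [ι] using haff.card_le_finrank_succ.trans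
        (Nat.add_le_add_right (Submodule.finrank_le _) 1)
    obtain ⟨e⟩ := Function.Embedding.nonempty_of_card_le hcard
    refine ⟨(Function.extend e w (fun _ => 0), Function.extend e z (fun _ => z₀)),
      ⟨⟨fun i => ?_, ?_⟩, fun i _ => ?_⟩, ?_⟩
    · by_cases hi : ∃ j, e j = i
      · obtain ⟨j, rfl⟩ := hi
        simpa [e.injective.extend_apply] using (hw j).le
      · simp [Function.extend_apply' _ _ _ hi]
    · rw [e.sum_extend_zero, hsum]
    · by_cases hi : ∃ j, e j = i
      · obtain ⟨j, rfl⟩ := hi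
        simpa [e.injective.extend_apply] using hz ⟨j, rfl⟩
      · simpa [Function.extend_apply' _ _ _ hi] using hz₀
    · rw [← e.sum_extend_zero fun j => w j • z j]
      refine Finset.sum_congr rfl fun i _ => ?_
      by_cases hi : ∃ j, e j = i
      · obtain ⟨j, rfl⟩ := hi
        simp [e.injective.extend_apply]
      · simp [Function.extend_apply' _ _ _ hi]
  · rintro ⟨p, ⟨⟨hp0, hp1⟩, hp⟩, rfl⟩
    exact (convex_convexHull ℝ K).sum_mem (fun i _ => hp0 i) hp1
      fun i _ => subset_convexHull ℝ K (hp i (mem_univ i))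

/-! ### Clarke's generalized gradient of a Lipschitz function. -/

section Clarke

variable {d : ℕ}

/-- The limits of gradients of `F` at points tending to `x`. -/
def limitingGradients (F : EuclideanSpace ℝ (Fin d) → ℝ) (x : EuclideanSpace ℝ (Fin d)) :
    Set (EuclideanSpace ℝ (Fin d)) :=
  {g | (x, g) ∈ closure {p : EuclideanSpace ℝ (Fin d) × EuclideanSpace ℝ (Fin d) |
    HasGradientAt F p.2 p.1}}

variable {F : EuclideanSpace ℝ (Fin d) → ℝ} {p x : EuclideanSpace ℝ (Fin d)} {r : ℝ} {L : ℝ≥0}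

theorem clarkeGradient_eq_convexHull :
    clarkeGradient F x = convexHull ℝ (limitingGradients F x) := by
  unfold clarkeGradient limitingGradients
  congr 1
  ext g
  simp only [mem_ofPred_eq, mem_closure_iff_seq_limit]
  constructor
  · rintro ⟨y, G, h, hy, hG⟩
    exact ⟨fun i => (y i, G i), h, hy.prodMk_nhds hG⟩
  · rintro ⟨q, h, hq⟩
    exact ⟨fun i => (q i).1, fun i => (q i).2, h, (continuous_fst.tendsto _).comp hq,
      (continuous_snd.tendsto _).comp hq⟩

theorem HasGradientAt.norm_le_of_lipschitzOnWith {g : EuclideanSpace ℝ (Fin d)}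
    (hg : HasGradientAt F g x) (hF : LipschitzOnWith L F (Metric.ball p r))
    (hx : x ∈ Metric.ball p r) : ‖g‖ ≤ L := by
  have := hg.hasFDerivAt.le_of_lipschitzOn (Metric.isOpen_ball.mem_nhds hx) hF
  simpa using this

/-- A closed condition on (point, gradient) that holds at all points of differentiability
passes to limiting gradients. -/
theorem limitingGradients_induction {P : Set (EuclideanSpace ℝ (Fin d) × EuclideanSpace ℝ (Fin d))}
    (hP : IsClosed P) (hx : x ∈ Metric.ball p r)
    (h : ∀ y ∈ Metric.ball p r, ∀ g, HasGradientAt F g y → (y, g) ∈ P)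
    {g : EuclideanSpace ℝ (Fin d)} (hg : g ∈ limitingGradients F x) : (x, g) ∈ P := by
  obtain ⟨q, hq, hlim⟩ := mem_closure_iff_seq_limit.1 hg
  have hev : ∀ᶠ i in atTop, (q i).1 ∈ Metric.ball p r :=
    ((continuous_fst.tendsto _).comp hlim).eventually (Metric.isOpen_ball.mem_nhds hx)
  exact hP.mem_of_tendsto hlim (hev.mono fun i hi => h _ hi _ (hq i))

theorem norm_le_of_mem_limitingGradients (hF : LipschitzOnWith L F (Metric.ball p r))
    (hx : x ∈ Metric.ball p r) {g : EuclideanSpace ℝ (Fin d)} (hg : g ∈ limitingGradients F x) :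
    ‖g‖ ≤ L :=
  limitingGradients_induction (P := {q | ‖q.2‖ ≤ L})
    (isClosed_le (by fun_prop) continuous_const) hx
    (fun _ hy _ hg => hg.norm_le_of_lipschitzOnWith hF hy) hg

theorem isClosed_limitingGradients : IsClosed (limitingGradients F x) :=
  isClosed_closure.preimage (f := fun g => (x, g)) (by fun_prop)

theorem isCompact_limitingGradients (hF : LipschitzOnWith L F (Metric.ball p r))
    (hx : x ∈ Metric.ball p r) : IsCompact (limitingGradients F x) :=
  (isCompact_closedBall (0 : EuclideanSpace ℝ (Fin d)) (L : ℝ)).of_isClosed_subset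
    isClosed_limitingGradients fun g hg => by
      simpa using norm_le_of_mem_limitingGradients hF hx hg

/-- By Rademacher's theorem points of differentiability are dense in the ball. The gradients there
are bounded by `L`, so a subsequence converges. -/
theorem limitingGradients_nonempty (hF : LipschitzOnWith L F (Metric.ball p r))
    (hx : x ∈ Metric.ball p r) : (limitingGradients F x).Nonempty := by
  have hae := hF.ae_differentiableWithinAt_of_mem (μ := volume)
  have hdense : Dense {y | y ∈ Metric.ball p r → DifferentiableWithinAt ℝ F (Metric.ball p r) y} :=
    Measure.dense_of_ae hae
  have hxcl : x ∈ closure (Metric.ball p r ∩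
      {y | y ∈ Metric.ball p r → DifferentiableWithinAt ℝ F (Metric.ball p r) y}) :=
    hdense.open_subset_closure_inter Metric.isOpen_ball hx
  obtain ⟨y, hy, hlim⟩ := mem_closure_iff_seq_limit.1 hxcl
  have hgrad : ∀ i, HasGradientAt F (gradient F (y i)) (y i) := fun i =>
    (((hy i).2 (hy i).1).differentiableAt (Metric.isOpen_ball.mem_nhds (hy i).1)).hasGradientAt
  have hb : ∀ i, gradient F (y i) ∈ Metric.closedBall (0 : EuclideanSpace ℝ (Fin d)) (L : ℝ) :=
    fun i => by simpa using (hgrad i).norm_le_of_lipschitzOnWith hF (hy i).1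
  obtain ⟨g, _, φ, hφ, hg⟩ := (isCompact_closedBall _ _).tendsto_subseq hb
  exact ⟨g, mem_closure_iff_seq_limit.2 ⟨fun i => (y (φ i), gradient F (y (φ i))),
    fun i => hgrad _, (hlim.comp hφ.tendsto_atTop).prodMk_nhds hg⟩⟩

/-- Upper semicontinuity: the graph is closed and locally bounded, so limiting gradients at `y i →
x` that stayed away from those at `x` would have a cluster point among them. -/
theorem limitingGradients_subset_thickening (hF : LipschitzOnWith L F (Metric.ball p r))
    (hx : x ∈ Metric.ball p r) {ε : ℝ} (hε : 0 < ε) :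
    ∀ᶠ y in 𝓝 x, limitingGradients F y ⊆ Metric.thickening ε (limitingGradients F x) := by
  by_contra hcon
  rw [not_eventually, frequently_iff_seq_forall] at hcon
  obtain ⟨y, hy, hn⟩ := hcon
  obtain ⟨N, hN⟩ := eventually_atTop.1 (hy.eventually (Metric.isOpen_ball.mem_nhds hx))
  simp only [not_subset] at hn
  choose g hg hgn using hn
  have hb : ∀ i, g (i + N) ∈ Metric.closedBall (0 : EuclideanSpace ℝ (Fin d)) (L : ℝ) := fun i => by
    simpa using norm_le_of_mem_limitingGradients hF (hN _ (Nat.le_add_left N i)) (hg (i + N))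
  obtain ⟨g₀, _, φ, hφ, hlim⟩ := (isCompact_closedBall _ _).tendsto_subseq hb
  have hφN : Tendsto (fun i => φ i + N) atTop atTop :=
    (tendsto_add_atTop_nat N).comp hφ.tendsto_atTop
  have hg₀ : g₀ ∈ limitingGradients F x :=
    isClosed_closure.mem_of_tendsto ((hy.comp hφN).prodMk_nhds hlim)
      (Eventually.of_forall fun i => hg (φ i + N))
  obtain ⟨i, hi⟩ := ((hlim.eventually (Metric.isOpen_thickening.mem_nhds
    (Metric.self_subset_thickening hε _ hg₀)))).exists
  exact hgn _ hi

theorem clarkeGradient_subset_cthickening (hF : LipschitzOnWith L F (Metric.ball p r))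
    (hx : x ∈ Metric.ball p r) {ε : ℝ} (hε : 0 < ε) :
    ∀ᶠ y in 𝓝 x, clarkeGradient F y ⊆ Metric.cthickening ε (clarkeGradient F x) := by
  filter_upwards [limitingGradients_subset_thickening hF hx hε] with y hy
  rw [clarkeGradient_eq_convexHull, clarkeGradient_eq_convexHull]
  refine convexHull_min ?_ ((convex_convexHull ℝ _).cthickening ε)
  exact hy.trans ((Metric.thickening_subset_of_subset ε (subset_convexHull ℝ _)).trans
    (Metric.thickening_subset_cthickening _ _))

theorem isCompact_clarkeGradient (hF : LipschitzOnWith L F (Metric.ball p r))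
    (hx : x ∈ Metric.ball p r) : IsCompact (clarkeGradient F x) := by
  rw [clarkeGradient_eq_convexHull]
  exact (isCompact_limitingGradients hF hx).convexHull_of_finiteDimensional

theorem clarkeGradient_nonempty (hF : LipschitzOnWith L F (Metric.ball p r))
    (hx : x ∈ Metric.ball p r) : (clarkeGradient F x).Nonempty := by
  rw [clarkeGradient_eq_convexHull]
  exact (limitingGradients_nonempty hF hx).convexHull

theorem norm_le_of_mem_clarkeGradient (hF : LipschitzOnWith L F (Metric.ball p r))
    (hx : x ∈ Metric.ball p r) {g : EuclideanSpace ℝ (Fin d)} (hg : g ∈ clarkeGradient F x) :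
    ‖g‖ ≤ L := by
  rw [clarkeGradient_eq_convexHull] at hg
  have := convexHull_min (t := Metric.closedBall (0 : EuclideanSpace ℝ (Fin d)) (L : ℝ))
    (fun g hg => by simpa using norm_le_of_mem_limitingGradients hF hx hg)
    (convex_closedBall _ _) hg
  simpa using this

/-- The inequality is closed in (point, gradient), and for a fixed point it cuts out a half-space of
gradients. It thus survives both limits and convex hulls. -/
theorem le_inner_of_mem_clarkeGradient {c : ℝ}
    (h : ∀ y ∈ Metric.ball p r, ∀ g, HasGradientAt F g y → c * ‖y - p‖ ^ 2 ≤ inner ℝ g (y - p))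
    (hx : x ∈ Metric.ball p r) {g : EuclideanSpace ℝ (Fin d)} (hg : g ∈ clarkeGradient F x) :
    c * ‖x - p‖ ^ 2 ≤ inner ℝ g (x - p) := by
  rw [clarkeGradient_eq_convexHull] at hg
  refine convexHull_min (t := {g | c * ‖x - p‖ ^ 2 ≤ inner ℝ g (x - p)}) (fun g hg => ?_) ?_ hg
  · exact limitingGradients_induction
      (P := {q | c * ‖q.1 - p‖ ^ 2 ≤ inner ℝ q.2 (q.1 - p)})
      (isClosed_le (by fun_prop) (by fun_prop)) hx (fun y hy g hg => h y hy g hg) hg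
  · intro a ha b hb s t hs ht hst
    simp only [mem_ofPred_eq, inner_add_left, real_inner_smul_left] at *
    calc c * ‖x - p‖ ^ 2 = s * (c * ‖x - p‖ ^ 2) + t * (c * ‖x - p‖ ^ 2) := by
          rw [← add_mul, hst, one_mul]
      _ ≤ _ := by gcongr

end Clarke

/-! ### Differential inclusions via the Euler scheme. -/

section EulerScheme

variable {E : Type*} [NormedAddCommGroup E] [NormedSpace ℝ E]

/-- The points of the Euler scheme with step `h` for the vector field `g`. -/
def eulerPoint (g : E → E) (h : ℝ) (x₀ : E) : ℕ → E
  | 0 => x₀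
  | k + 1 => eulerPoint g h x₀ k + h • g (eulerPoint g h x₀ k)

/-- The piecewise constant interpolation of the Euler scheme. -/
noncomputable def eulerCurve (g : E → E) (h : ℝ) (x₀ : E) (s : ℝ) : E :=
  eulerPoint g h x₀ ⌊s / h⌋₊

variable {g : E → E} {h : ℝ} {x₀ : E} {K : Set E} {L : ℝ}

theorem eulerPoint_mem (hx₀ : x₀ ∈ K) (hK : ∀ x ∈ K, x + h • g x ∈ K) (k : ℕ) :
    eulerPoint g h x₀ k ∈ K := by
  induction k with
  | zero => exact hx₀
  | succ k ih => exact hK _ ih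

theorem eulerPoint_add_sub (k N : ℕ) :
    eulerPoint g h x₀ (k + N) - eulerPoint g h x₀ k =
      h • ∑ i ∈ Finset.range N, g (eulerPoint g h x₀ (k + i)) := by
  induction N with
  | zero => simp
  | succ N ih =>
    rw [Finset.sum_range_succ, smul_add, ← ih, ← add_assoc]
    simp only [eulerPoint]
    abel

theorem floor_sub_floor_mul_le {h s t : ℝ} (hh : 0 < h) (hst : s ≤ t) :
    ((⌊t / h⌋₊ - ⌊s / h⌋₊ : ℕ) : ℝ) * h ≤ t - s + h := by
  have hmono : ⌊s / h⌋₊ ≤ ⌊t / h⌋₊ := Nat.floor_mono (by gcongr)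
  rcases lt_or_ge t 0 with ht | ht
  · have : ⌊t / h⌋₊ = 0 := Nat.floor_of_nonpos (div_nonpos_of_nonpos_of_nonneg ht.le hh.le)
    simp only [this, Nat.zero_sub, Nat.cast_zero, zero_mul]
    linarith
  · rw [Nat.cast_sub hmono, sub_mul]
    have h1 : (⌊t / h⌋₊ : ℝ) * h ≤ t := by
      calc (⌊t / h⌋₊ : ℝ) * h ≤ t / h * h := by gcongr; exact Nat.floor_le (by positivity)
        _ = t := by field_simp
    have h2 : s ≤ (⌊s / h⌋₊ + 1 : ℝ) * h := by
      calc s = s / h * h := by field_simp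
        _ ≤ _ := by gcongr; exact (Nat.lt_floor_add_one _).le
    linarith

theorem le_floor_sub_floor_mul {h s t : ℝ} (hh : 0 < h) (hs : 0 ≤ s) (hst : s ≤ t) :
    t - s - h ≤ ((⌊t / h⌋₊ - ⌊s / h⌋₊ : ℕ) : ℝ) * h := by
  have hmono : ⌊s / h⌋₊ ≤ ⌊t / h⌋₊ := Nat.floor_mono (by gcongr)
  rw [Nat.cast_sub hmono, sub_mul]
  have h1 : (⌊s / h⌋₊ : ℝ) * h ≤ s := by
    calc (⌊s / h⌋₊ : ℝ) * h ≤ s / h * h := by gcongr; exact Nat.floor_le (by positivity)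
      _ = s := by field_simp
  have h2 : t ≤ (⌊t / h⌋₊ + 1 : ℝ) * h := by
    calc t = t / h * h := by field_simp
      _ ≤ _ := by gcongr; exact (Nat.lt_floor_add_one _).le
  linarith

/-- The curve is piecewise constant and jumps by at most `L * h`. The error `h` counts the one extra
jump and vanishes in the limit. -/
theorem norm_eulerCurve_sub_le (hL : 0 ≤ L) (hh : 0 < h) (hx₀ : x₀ ∈ K)
    (hK : ∀ x ∈ K, x + h • g x ∈ K) (hg : ∀ x ∈ K, ‖g x‖ ≤ L) (s t : ℝ) :
    ‖eulerCurve g h x₀ t - eulerCurve g h x₀ s‖ ≤ L * (|t - s| + h) := by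
  wlog hst : s ≤ t generalizing s t
  · rw [norm_sub_rev, abs_sub_comm]
    exact this t s (le_of_not_ge hst)
  have hmono : ⌊s / h⌋₊ ≤ ⌊t / h⌋₊ := Nat.floor_mono (by gcongr)
  unfold eulerCurve
  obtain ⟨N, hN⟩ := Nat.exists_eq_add_of_le hmono
  have hle := floor_sub_floor_mul_le hh hst
  rw [hN, Nat.add_sub_cancel_left] at hle
  rw [hN, eulerPoint_add_sub, norm_smul, Real.norm_of_nonneg hh.le, abs_of_nonneg (by linarith)]
  calc h * ‖∑ i ∈ Finset.range N, g (eulerPoint g h x₀ (⌊s / h⌋₊ + i))‖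
      ≤ h * ∑ i ∈ Finset.range N, L := by
        gcongr
        exact norm_sum_le_of_le _ fun i _ => hg _ (eulerPoint_mem hx₀ hK _)
    _ = L * (N * h) := by simp; ring
    _ ≤ _ := by gcongr

/-- Average velocities of the Euler scheme lie in a convex set that contains the velocities
near the interval. -/
theorem eulerCurve_average_mem {D : Set E} (hD : Convex ℝ D) (hh : 0 < h) {s t : ℝ} (hs : 0 ≤ s)
    (hst : s + h < t)
    (hmem : ∀ τ, s - h ≤ τ → τ ≤ t → g (eulerCurve g h x₀ τ) ∈ D) :
    (((⌊t / h⌋₊ - ⌊s / h⌋₊ : ℕ) : ℝ) * h)⁻¹ • (eulerCurve g h x₀ t - eulerCurve g h x₀ s) ∈ D := by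
  have hmono : ⌊s / h⌋₊ ≤ ⌊t / h⌋₊ := Nat.floor_mono (by gcongr; linarith)
  have hpos := le_floor_sub_floor_mul hh hs (by linarith : s ≤ t)
  unfold eulerCurve at hmem ⊢
  obtain ⟨N, hN⟩ := Nat.exists_eq_add_of_le hmono
  rw [hN, Nat.add_sub_cancel_left] at hpos ⊢
  have hN0 : (0 : ℝ) < N := by
    by_contra hcon
    have : (N : ℝ) = 0 := le_antisymm (not_lt.1 hcon) N.cast_nonneg
    rw [this] at hpos
    linarith
  rw [eulerPoint_add_sub, smul_smul, mul_inv, mul_assoc, inv_mul_cancel₀ hh.ne', mul_one,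
    Finset.smul_sum]
  refine hD.sum_mem (fun i _ => by positivity) ?_ fun i hi => ?_
  · rw [Finset.sum_const, Finset.card_range, nsmul_eq_mul, mul_inv_cancel₀ hN0.ne']
  · have hi' : ⌊s / h⌋₊ + i + 1 ≤ ⌊t / h⌋₊ := by
      have := Finset.mem_range.1 hi
      omega
    have h1 : s ≤ (⌊s / h⌋₊ + 1 : ℝ) * h := by
      calc s = s / h * h := by field_simp
        _ ≤ _ := by gcongr; exact (Nat.lt_floor_add_one _).le
    have h2 : ((⌊s / h⌋₊ + i + 1 : ℕ) : ℝ) * h ≤ t := by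
      calc ((⌊s / h⌋₊ + i + 1 : ℕ) : ℝ) * h ≤ (⌊t / h⌋₊ : ℝ) * h := by gcongr
        _ ≤ t / h * h := by
          gcongr; exact Nat.floor_le (div_nonneg (by linarith) hh.le)
        _ = t := by field_simp
    have h3 : (0 : ℝ) ≤ i * h := by positivity
    push_cast at h2
    -- The `i`-th summand is the velocity at a grid time, which lies in `[s - h, t]`.
    have := hmem ((⌊s / h⌋₊ + i : ℕ) * h) (by push_cast; linarith) (by push_cast; linarith)
    rwa [mul_div_assoc, div_self hh.ne', mul_one, Nat.floor_natCast] at this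

/-- Existence of solutions of a differential inclusion with upper semicontinuous compact convex
right-hand side in a compact set that is invariant under the Euler scheme. -/
theorem exists_lipschitz_solution_of_invariant {Φ : E → Set E} (hKc : IsCompact K) (hL : 0 ≤ L)
    {h₀ : ℝ} (hh₀ : 0 < h₀) (hne : ∀ x ∈ K, (Φ x).Nonempty) (hconv : ∀ x ∈ K, Convex ℝ (Φ x))
    (hcl : ∀ x ∈ K, IsClosed (Φ x)) (hbd : ∀ x ∈ K, ∀ v ∈ Φ x, ‖v‖ ≤ L)
    (husc : ∀ x ∈ K, ∀ ε > 0, ∀ᶠ y in 𝓝 x, Φ y ⊆ Metric.cthickening ε (Φ x))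
    (hinv : ∀ h, 0 < h → h < h₀ → ∀ x ∈ K, ∀ v ∈ Φ x, x + h • v ∈ K) (hx₀ : x₀ ∈ K) :
    ∃ θ : ℝ → E, LipschitzWith L.toNNReal θ ∧ θ 0 = x₀ ∧ (∀ s, θ s ∈ K) ∧
      ∀ s, 0 ≤ s → ∀ v, HasDerivAt θ v s → v ∈ Φ (θ s) := by
  classical
  choose! g hg using hne
  -- The shift by 2 keeps every step strictly below `h₀`, including that at `i = 0`.
  let h : ℕ → ℝ := fun i => h₀ / (i + 2)
  have hpos : ∀ i, 0 < h i := fun i => by positivity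
  have hlt : ∀ i, h i < h₀ := fun i => by
    rw [div_lt_iff₀ (by positivity)]
    nlinarith [(Nat.cast_nonneg i : (0 : ℝ) ≤ i)]
  have hstep : ∀ i, ∀ x ∈ K, x + h i • g x ∈ K := fun i x hx =>
    hinv _ (hpos i) (hlt i) x hx _ (hg x hx)
  have hgL : ∀ x ∈ K, ‖g x‖ ≤ L := fun x hx => hbd x hx _ (hg x hx)
  have hmemK : ∀ i s, eulerCurve g (h i) x₀ s ∈ K := fun i s => eulerPoint_mem hx₀ (hstep i) _
  -- Along an ultrafilter the Euler curves converge at every time at once, by compactness of `K`;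
  -- this takes the place of the Arzelà–Ascoli theorem.
  let U : Ultrafilter ℕ := Filter.hyperfilter ℕ
  have hU : (U : Filter ℕ) ≤ atTop := Nat.hyperfilter_le_atTop
  have hh0 : Tendsto h U (𝓝 0) := by
    have : Tendsto (fun i : ℕ => h₀ / ((i : ℝ) + 2)) atTop (𝓝 0) :=
      tendsto_const_nhds.div_atTop (tendsto_atTop_add_const_right _ _ tendsto_natCast_atTop_atTop)
    exact this.mono_left hU
  have hlim : ∀ s, ∃ y ∈ K, Tendsto (fun i => eulerCurve g (h i) x₀ s) U (𝓝 y) := fun s => by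
    obtain ⟨y, hy, hle⟩ := hKc.ultrafilter_le_nhds' (U.map fun i => eulerCurve g (h i) x₀ s)
      (Filter.univ_mem' (f := (U : Filter ℕ)) fun i => hmemK i s)
    exact ⟨y, hy, hle⟩
  choose θ hθK hθ using hlim
  have hLip : ∀ s t, ‖θ t - θ s‖ ≤ L * |t - s| := fun s t => by
    have h1 : Tendsto (fun i => L * (|t - s| + h i)) U (𝓝 (L * (|t - s| + 0))) :=
      (tendsto_const_nhds.add hh0).const_mul L
    rw [add_zero] at h1
    exact le_of_tendsto_of_tendsto' ((hθ t).sub (hθ s)).norm h1 fun i =>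
      norm_eulerCurve_sub_le hL (hpos i) hx₀ (hstep i) hgL s t
  refine ⟨θ, LipschitzWith.of_dist_le_mul fun t s => ?_, ?_, hθK, fun s hs v hv => ?_⟩
  · rw [dist_eq_norm, Real.dist_eq, Real.coe_toNNReal L hL]
    exact hLip s t
  · refine tendsto_nhds_unique (hθ 0) ?_
    simp [eulerCurve, eulerPoint]
  · suffices hε : ∀ ε > 0, v ∈ Metric.cthickening ε (Φ (θ s)) by
      rw [← (hcl _ (hθK s)).closure_eq, Metric.closure_eq_iInter_cthickening]
      exact mem_iInter₂.2 hε
    intro ε hε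
    obtain ⟨η, hη, hball⟩ := Metric.eventually_nhds_iff.1 (husc _ (hθK s) ε hε)
    set D := Metric.cthickening ε (Φ (θ s)) with hDdef
    have hDcl : IsClosed D := Metric.isClosed_cthickening
    have hDconv : Convex ℝ D := (hconv _ (hθK s)).cthickening ε
    -- For `t` near `s` all Euler velocities used on `[s, t]` lie in the closed convex set `D`,
    -- hence so do their averages and the limits of these. Letting `t ↓ s` puts the derivative into
    -- `D`.
    have key : ∀ t, s < t → L * (t - s) < η / 2 → (t - s)⁻¹ • (θ t - θ s) ∈ D := by
      intro t hst htη
      have hN : Tendsto (fun i => ((⌊t / h i⌋₊ - ⌊s / h i⌋₊ : ℕ) : ℝ) * h i) U (𝓝 (t - s)) := by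
        refine tendsto_of_tendsto_of_tendsto_of_le_of_le (g := fun i => t - s - h i)
          (h := fun i => t - s + h i) ?_ ?_ (fun i => le_floor_sub_floor_mul (hpos i) hs hst.le)
          (fun i => floor_sub_floor_mul_le (hpos i) hst.le)
        · simpa using tendsto_const_nhds.sub hh0
        · simpa using tendsto_const_nhds.add hh0
      refine hDcl.mem_of_tendsto ((hN.inv₀ (sub_pos.2 hst).ne').smul ((hθ t).sub (hθ s))) ?_
      have hsmall : Tendsto (fun i => L * (t - s + h i + h i) + ‖eulerCurve g (h i) x₀ s - θ s‖) U
          (𝓝 (L * (t - s + 0 + 0) + ‖θ s - θ s‖)) :=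
        (((tendsto_const_nhds.add hh0).add hh0).const_mul L).add ((hθ s).sub_const _).norm
      have hlt : L * (t - s + 0 + 0) + ‖θ s - θ s‖ < η := by
        simp only [add_zero, sub_self, norm_zero]
        linarith
      have ev1 := hsmall.eventually (gt_mem_nhds hlt)
      have ev2 : ∀ᶠ i in (U : Filter ℕ), h i < t - s := hh0.eventually (gt_mem_nhds (sub_pos.2 hst))
      filter_upwards [ev1, ev2] with i hi1 hi2
      refine eulerCurve_average_mem hDconv (hpos i) hs (by linarith) fun τ hτ1 hτ2 => ?_
      refine hball ?_ (hg _ (hmemK i τ))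
      rw [dist_eq_norm]
      have habs : |τ - s| ≤ t - s + h i := by
        rw [abs_le]
        constructor <;> linarith [hpos i]
      calc ‖eulerCurve g (h i) x₀ τ - θ s‖
          ≤ ‖eulerCurve g (h i) x₀ τ - eulerCurve g (h i) x₀ s‖ +
            ‖eulerCurve g (h i) x₀ s - θ s‖ := norm_sub_le_norm_sub_add_norm_sub _ _ _
        _ ≤ L * (t - s + h i + h i) + ‖eulerCurve g (h i) x₀ s - θ s‖ := by
          gcongr
          exact (norm_eulerCurve_sub_le hL (hpos i) hx₀ (hstep i) hgL s τ).trans (by gcongr)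
        _ < η := hi1
    have hslope := (hasDerivAt_iff_tendsto_slope.1 hv).mono_left
      (nhdsWithin_mono s (fun t (ht : s < t) => ne_of_gt ht) : 𝓝[>] s ≤ 𝓝[≠] s)
    refine hDcl.mem_of_tendsto hslope ?_
    have hc : Tendsto (fun t => L * (t - s)) (𝓝[>] s) (𝓝 0) := by
      have : Continuous fun t => L * (t - s) := by fun_prop
      simpa using (this.tendsto s).mono_left nhdsWithin_le_nhds
    filter_upwards [hc.eventually (gt_mem_nhds (half_pos hη)), self_mem_nhdsWithin] with t h1 h2
    simpa [slope] using key t h2 h1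

end EulerScheme

/-! ### Gradient flows: existence and convergence in a ball. -/

section GradientFlow

variable {d : ℕ}

theorem LipschitzWith.integral_deriv_eq_sub_euclidean {θ : ℝ → EuclideanSpace ℝ (Fin d)} {L : ℝ≥0}
    (hθ : LipschitzWith L θ) (t : ℝ) :
    IntervalIntegrable (deriv θ) volume 0 t ∧ θ t = θ 0 + ∫ s in (0 : ℝ)..t, deriv θ s := by
  have hint : IntervalIntegrable (deriv θ) volume 0 t := by
    rw [intervalIntegrable_iff]
    refine Measure.integrableOn_of_bounded (M := L) (by simp)
      (measurable_deriv θ).aestronglyMeasurable ?_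
    exact Eventually.of_forall fun s => norm_deriv_le_of_lipschitz hθ
  refine ⟨hint, ?_⟩
  have hcoord : ∀ k, θ t k - θ 0 k = ∫ s in (0 : ℝ)..t, deriv θ s k := fun k => by
    have hk : LipschitzWith (1 * L) fun s => θ s k :=
      (LipschitzWith.of_dist_le_mul fun x y => by
        simpa [dist_eq_norm] using PiLp.norm_apply_le (x - y) k :
          LipschitzWith 1 fun x : EuclideanSpace ℝ (Fin d) => x k).comp hθ
    rw [← (hk.lipschitzOnWith (s := uIcc 0 t)).absolutelyContinuousOnInterval.integral_deriv_eq_sub]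
    refine intervalIntegral.integral_congr_ae ?_
    filter_upwards [hθ.ae_differentiableAt (μ := volume)] with s hs _
    exact ((EuclideanSpace.proj (𝕜 := ℝ) k).hasFDerivAt.comp_hasDerivAt s hs.hasDerivAt).deriv
  have hproj : ∀ k, (∫ s in (0 : ℝ)..t, deriv θ s) k = ∫ s in (0 : ℝ)..t, deriv θ s k := fun k =>
    ((EuclideanSpace.proj (𝕜 := ℝ) k).intervalIntegral_comp_comm hint).symm
  ext k
  rw [PiLp.add_apply, hproj, ← hcoord]
  ring

/-- Makes the squared distance to `p` available as a Lyapunov function: absolute continuity lets its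
pointwise derivative be integrated. -/
theorem sq_norm_sub_absolutelyContinuous {v : ℝ → EuclideanSpace ℝ (Fin d)}
    (a p : EuclideanSpace ℝ (Fin d)) {T : ℝ} (hv : IntervalIntegrable v volume 0 T) :
    AbsolutelyContinuousOnInterval (fun t => ‖a + (∫ s in (0 : ℝ)..t, v s) - p‖ ^ 2) 0 T ∧
    ∀ᵐ t, t ∈ uIcc 0 T → HasDerivAt (fun t => ‖a + (∫ s in (0 : ℝ)..t, v s) - p‖ ^ 2)
      (2 * inner ℝ (a + (∫ s in (0 : ℝ)..t, v s) - p) (v t)) t := by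
  constructor
  · have hvk : ∀ k, IntervalIntegrable (fun s => v s k) volume 0 T := fun k =>
      ⟨(EuclideanSpace.proj (𝕜 := ℝ) k).integrable_comp hv.1,
        (EuclideanSpace.proj (𝕜 := ℝ) k).integrable_comp hv.2⟩
    have hconst : ∀ c : ℝ, AbsolutelyContinuousOnInterval (fun _ : ℝ => c) 0 T := fun c =>
      ((LipschitzWith.const c).lipschitzOnWith (s := uIcc 0 T)).absolutelyContinuousOnInterval
    have hcoord : ∀ k, AbsolutelyContinuousOnInterval
        (fun t => a k - p k + ∫ s in (0 : ℝ)..t, v s k) 0 T := fun k =>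
      (hconst (a k - p k)).add ((hvk k).absolutelyContinuousOnInterval_intervalIntegral (by simp))
    have hsum : ∀ S : Finset (Fin d), AbsolutelyContinuousOnInterval
        (fun t => ∑ k ∈ S, (a k - p k + ∫ s in (0 : ℝ)..t, v s k) *
          (a k - p k + ∫ s in (0 : ℝ)..t, v s k)) 0 T := fun S => by
      classical
      induction S using Finset.induction_on with
      | empty => simpa using hconst 0
      | insert k S hk ih =>
        simp only [Finset.sum_insert hk]
        exact ((hcoord k).mul (hcoord k)).add ih
    have hLip := hsum Finset.univ
    have hmem : ∀ t ∈ uIcc 0 T, ‖a + (∫ s in (0 : ℝ)..t, v s) - p‖ ^ 2 =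
        ∑ k, (a k - p k + ∫ s in (0 : ℝ)..t, v s k) *
          (a k - p k + ∫ s in (0 : ℝ)..t, v s k) := fun t ht => by
      rw [EuclideanSpace.real_norm_sq_eq]
      refine Finset.sum_congr rfl fun k _ => ?_
      have : (∫ s in (0 : ℝ)..t, v s) k = ∫ s in (0 : ℝ)..t, v s k :=
        ((EuclideanSpace.proj (𝕜 := ℝ) k).intervalIntegral_comp_comm
          (hv.mono_set (uIcc_subset_uIcc_left ht))).symm
      rw [PiLp.sub_apply, PiLp.add_apply, this]
      ring
    rw [absolutelyContinuousOnInterval_iff] at hLip ⊢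
    intro ε hε
    obtain ⟨η, hη, h⟩ := hLip ε hε
    refine ⟨η, hη, fun I hI hlen => ?_⟩
    convert h I hI hlen using 1
    refine Finset.sum_congr rfl fun i hi => ?_
    rw [hmem _ (hI.1 i hi).1, hmem _ (hI.1 i hi).2]
  · filter_upwards [hv.ae_hasDerivAt_integral] with t ht hmem
    have := ((ht hmem 0 (by simp)).const_add a).sub_const p
    exact this.norm_sq

variable {C : EuclideanSpace ℝ (Fin d) → ℝ≥0∞} {p : EuclideanSpace ℝ (Fin d)} {r c : ℝ} {L : ℝ≥0}

/-- Since generalized gradients point away from `p`, small Euler steps do not leave a closed ball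
around `p`, which serves as the invariant compact set. -/
theorem exists_isGradientFlow (hfin : ∀ y ∈ Metric.ball p r, C y ≠ ∞)
    (hL : LipschitzOnWith L (fun y => (C y).toReal) (Metric.ball p r)) (hc : 0 < c)
    (hgrad : ∀ y ∈ Metric.ball p r, ∀ g, HasGradientAt (fun y => (C y).toReal) g y →
      c * ‖y - p‖ ^ 2 ≤ inner ℝ g (y - p))
    {θ₀ : EuclideanSpace ℝ (Fin d)} (hθ₀ : θ₀ ∈ Metric.ball p r) :
    ∃ θ, IsGradientFlow C θ ∧ θ 0 = θ₀ := by
  obtain ⟨r₀, hr₀, hr⟩ := exists_between (max_lt (Metric.mem_ball.1 hθ₀)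
    (dist_nonneg.trans_lt (Metric.mem_ball.1 hθ₀)))
  have hr₀pos : 0 < r₀ := (le_max_right _ _).trans_lt hr₀
  have hsub : Metric.closedBall p r₀ ⊆ Metric.ball p r := Metric.closedBall_subset_ball hr
  obtain ⟨θ, hLip, h0, hK, hder⟩ := exists_lipschitz_solution_of_invariant
    (Φ := fun x => (fun v => -v) ⁻¹' clarkeGradient (fun y => (C y).toReal) x)
    (K := Metric.closedBall p r₀) (L := L) (x₀ := θ₀)
    -- For such steps |x + hv - p|² ≤ (1 - 2ch)|x - p|² + h²L² ≤ r₀²: the first entry makes the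
    -- coefficient nonnegative, the second gives hL² ≤ 2cr₀².
    (h₀ := min (1 / (2 * c)) (2 * c * r₀ ^ 2 / (L ^ 2 + 1)))
    (isCompact_closedBall _ _) L.2 (by positivity)
    (fun x hx => by
      obtain ⟨v, hv⟩ := clarkeGradient_nonempty hL (hsub hx)
      exact ⟨-v, by simpa using hv⟩)
    (fun x _ => (convex_convexHull ℝ _).is_linear_preimage (IsLinearMap.isLinearMap_neg))
    (fun x hx => (isCompact_clarkeGradient hL (hsub hx)).isClosed.preimage continuous_neg)
    (fun x hx v hv => by simpa using norm_le_of_mem_clarkeGradient hL (hsub hx) hv)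
    (fun x hx ε hε => by
      filter_upwards [clarkeGradient_subset_cthickening hL (hsub hx) hε] with y hy v hv
      have h1 := hy hv
      rw [Metric.mem_cthickening_iff] at h1 ⊢
      refine le_trans (le_of_eq ?_) h1
      have h2 := Metric.infEDist_image (t := (fun v => -v) ⁻¹' clarkeGradient
        (fun y => (C y).toReal) x) (x := v) (LinearIsometryEquiv.neg ℝ).isometry
      rw [← h2]
      congr 1
      ext w
      simp)
    (fun h hh hhlt x hx v hv => by
      have h1 : h < 1 / (2 * c) := hhlt.trans_le (min_le_left _ _)
      have h2 : h < 2 * c * r₀ ^ 2 / (L ^ 2 + 1) := hhlt.trans_le (min_le_right _ _)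
      rw [lt_div_iff₀ (by positivity)] at h1 h2
      have hv1 : ‖v‖ ≤ L := by simpa using norm_le_of_mem_clarkeGradient hL (hsub hx) hv
      have hv2 := le_inner_of_mem_clarkeGradient hgrad (hsub hx) hv
      rw [inner_neg_left, real_inner_comm] at hv2
      rw [mem_closedBall_iff_norm] at hx ⊢
      have hx2 : ‖x - p‖ ^ 2 ≤ r₀ ^ 2 := by gcongr
      have hv3 : ‖v‖ ^ 2 ≤ L ^ 2 := by gcongr
      rw [show x + h • v - p = (x - p) + h • v by abel]
      refine le_of_sq_le_sq ?_ hr₀pos.le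
      rw [norm_add_sq_real, real_inner_smul_right, norm_smul, Real.norm_of_nonneg hh.le]
      have e1 : h * inner ℝ (x - p) v ≤ h * (-(c * ‖x - p‖ ^ 2)) := by
        gcongr; linarith
      have e2 : h * (h * ‖v‖ ^ 2) ≤ h * (2 * c * r₀ ^ 2) := by
        refine mul_le_mul_of_nonneg_left ?_ hh.le
        calc h * ‖v‖ ^ 2 ≤ h * (L ^ 2 + 1) := by gcongr; linarith
          _ ≤ _ := h2.le
      have e3 : (1 - h * (2 * c)) * ‖x - p‖ ^ 2 ≤ (1 - h * (2 * c)) * r₀ ^ 2 :=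
        mul_le_mul_of_nonneg_left hx2 (by linarith)
      nlinarith)
    ((Metric.mem_closedBall).2 ((le_max_left _ _).trans hr₀.le))
  refine ⟨θ, ⟨fun s _ => ⟨Metric.ball p r, Metric.isOpen_ball.mem_nhds (hsub (hK s)), hfin, L, hL⟩,
    deriv θ, fun t _ => (hLip.integral_deriv_eq_sub_euclidean t).1,
    fun t _ => (hLip.integral_deriv_eq_sub_euclidean t).2, ?_⟩, h0⟩
  filter_upwards [hLip.ae_differentiableAt (μ := volume)] with s hs hs0
  exact hder s hs0 _ hs.hasDerivAt

/-- The squared distance φ to `p` satisfies φ' ≤ -2cφ as long as the flow is in the ball, so the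
flow never leaves it. As φ decreases, integration gives 2cTφ(T) ≤ φ(0), a rate that suffices without
Grönwall's inequality. -/
theorem IsGradientFlow.tendsto (hc : 0 < c)
    (hgrad : ∀ y ∈ Metric.ball p r, ∀ g, HasGradientAt (fun y => (C y).toReal) g y →
      c * ‖y - p‖ ^ 2 ≤ inner ℝ g (y - p))
    {θ : ℝ → EuclideanSpace ℝ (Fin d)} (hθ : IsGradientFlow C θ) (h0 : θ 0 ∈ Metric.ball p r) :
    Tendsto θ atTop (𝓝 p) := by
  obtain ⟨v, hint, hint_eq, hvel⟩ := hθ.velocity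
  set φ : ℝ → ℝ := fun t => ‖θ 0 + (∫ s in (0 : ℝ)..t, v s) - p‖ ^ 2 with hφ
  have hφθ : ∀ t, 0 ≤ t → φ t = ‖θ t - p‖ ^ 2 := fun t ht => by rw [hφ, hint_eq t ht]
  have hφ0 : ∀ t, 0 ≤ φ t := fun t => by positivity
  have hrpos : 0 < r := dist_nonneg.trans_lt (Metric.mem_ball.1 h0)
  have hball : ∀ t, 0 ≤ t → φ t < r ^ 2 → θ t ∈ Metric.ball p r := fun t ht h => by
    rw [hφθ t ht] at h
    rw [mem_ball_iff_norm]
    exact lt_of_pow_lt_pow_left₀ 2 hrpos.le h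
  have hac : ∀ T, 0 ≤ T → AbsolutelyContinuousOnInterval φ 0 T := fun T hT =>
    (sq_norm_sub_absolutelyContinuous (θ 0) p (hint T hT)).1
  have hcont : ∀ T, 0 ≤ T → ContinuousOn φ (Icc 0 T) := fun T hT => by
    simpa [uIcc_of_le hT] using (hac T hT).continuousOn
  have hder : ∀ S T, 0 ≤ S → S ≤ T → (∀ t, S ≤ t → t < T → φ t < r ^ 2) →
      φ T - φ S ≤ ∫ t in S..T, -(2 * c) * φ t := by
    intro S T hS hST hlt
    have hacST := (hac T (hS.trans hST)).mono (c := S) (d := T) (by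
      rw [uIcc_of_le hST, uIcc_of_le (hS.trans hST)]
      exact Icc_subset_Icc_left hS)
    rw [← hacST.integral_deriv_eq_sub]
    refine intervalIntegral.integral_mono_ae_restrict hST hacST.intervalIntegrable_deriv
      (ContinuousOn.intervalIntegrable (by
        rw [uIcc_of_le hST]
        exact continuousOn_const.mul ((hcont T (hS.trans hST)).mono (Icc_subset_Icc_left hS)))) ?_
    rw [EventuallyLE, ae_restrict_iff' measurableSet_Icc]
    have hne : ∀ᵐ t : ℝ, t ≠ T := by simp [ae_iff, measure_singleton]
    filter_upwards [(sq_norm_sub_absolutelyContinuous (θ 0) p (hint T (hS.trans hST))).2, hvel, hne]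
      with t h1 h2 h3 ht
    have ht0 : 0 ≤ t := hS.trans ht.1
    have hb := hball t ht0 (hlt t ht.1 (lt_of_le_of_ne ht.2 h3))
    have := le_inner_of_mem_clarkeGradient hgrad hb (h2 ht0)
    rw [(h1 (by rw [uIcc_of_le (hS.trans hST)]; exact ⟨ht0, ht.2⟩)).deriv, hφθ t ht0,
      ← hint_eq t ht0]
    rw [inner_neg_left, real_inner_comm] at this
    linarith
  have hneg : ∀ S T, S ≤ T → (∫ t in S..T, -(2 * c) * φ t) ≤ 0 := fun S T hST => by
    have : 0 ≤ ∫ t in S..T, -(-(2 * c) * φ t) := intervalIntegral.integral_nonneg hST fun t _ => by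
      have := hφ0 t
      have : 0 ≤ 2 * c * φ t := by positivity
      linarith
    rw [intervalIntegral.integral_neg] at this
    linarith
  have hstart : φ 0 < r ^ 2 := by
    rw [hφθ 0 le_rfl]
    have := mem_ball_iff_norm.1 h0
    gcongr
  -- At the first exit time `τ`, φ would be at least `r ^ 2`, although it cannot have increased on
  -- `[0, τ]`.
  have hstay : ∀ t, 0 ≤ t → φ t < r ^ 2 := by
    by_contra! hcon
    obtain ⟨T, hT, hTr⟩ := hcon
    have hcl : IsClosed (Icc 0 T ∩ φ ⁻¹' Ici (r ^ 2)) :=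
      (hcont T hT).preimage_isClosed_of_isClosed isClosed_Icc isClosed_Ici
    have hbdd : BddBelow (Icc 0 T ∩ φ ⁻¹' Ici (r ^ 2)) := ⟨0, fun t ht => ht.1.1⟩
    obtain ⟨⟨hm0, hmT⟩, hmr⟩ := hcl.csInf_mem ⟨T, ⟨hT, le_rfl⟩, hTr⟩ hbdd
    set τ := sInf (Icc 0 T ∩ φ ⁻¹' Ici (r ^ 2))
    have h1 := hder 0 τ le_rfl hm0 fun t ht htτ => by
      by_contra! hge
      exact absurd (csInf_le hbdd ⟨⟨ht, htτ.le.trans hmT⟩, hge⟩) (not_le.2 htτ)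
    have h2 := hneg 0 τ hm0
    have h3 : r ^ 2 ≤ φ τ := hmr
    linarith
  have hanti : ∀ S T, 0 ≤ S → S ≤ T → φ T ≤ φ S := fun S T hS hST => by
    have h1 := hder S T hS hST fun t ht _ => hstay t (hS.trans ht)
    have h2 := hneg S T hST
    linarith
  have hrate : ∀ T, 0 < T → φ T ≤ φ 0 / (2 * c) / T := fun T hT => by
    have h1 := hder 0 T le_rfl hT.le fun t ht _ => hstay t ht
    have hle : ∫ t in (0 : ℝ)..T, -(2 * c) * φ t ≤ ∫ t in (0 : ℝ)..T, -(2 * c) * φ T := by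
      refine intervalIntegral.integral_mono_on hT.le (ContinuousOn.intervalIntegrable (by
        rw [uIcc_of_le hT.le]
        exact continuousOn_const.mul (hcont T hT.le))) (by simp) fun t ht => ?_
      have := hanti t T ht.1 ht.2
      nlinarith
    rw [intervalIntegral.integral_const, smul_eq_mul, sub_zero] at hle
    rw [le_div_iff₀ hT, le_div_iff₀ (by positivity)]
    nlinarith [hφ0 T]
  have hφlim : Tendsto φ atTop (𝓝 0) :=
    squeeze_zero' (Eventually.of_forall hφ0) ((eventually_gt_atTop 0).mono hrate)
      (tendsto_const_nhds.div_atTop tendsto_id)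
  rw [tendsto_iff_norm_sub_tendsto_zero]
  have hsqrt := hφlim.sqrt
  rw [Real.sqrt_zero] at hsqrt
  refine hsqrt.congr' ((eventually_ge_atTop 0).mono fun t ht => ?_)
  rw [hφθ t ht, Real.sqrt_sq (norm_nonneg _)]

/-- If the gradients of a locally Lipschitz function on a ball point away from its center
at least linearly, then policy gradient converges to the center from everywhere in the ball. -/
theorem isPolicyGradientLimit_of_ball (hfin : ∀ y ∈ Metric.ball p r, C y ≠ ∞)
    (hL : LipschitzOnWith L (fun y => (C y).toReal) (Metric.ball p r)) (hc : 0 < c)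
    (hgrad : ∀ y ∈ Metric.ball p r, ∀ g, HasGradientAt (fun y => (C y).toReal) g y →
      c * ‖y - p‖ ^ 2 ≤ inner ℝ g (y - p))
    {θ₀ : EuclideanSpace ℝ (Fin d)} (hθ₀ : θ₀ ∈ Metric.ball p r) :
    IsPolicyGradientLimit C θ₀ p :=
  ⟨exists_isGradientFlow hfin hL hc hgrad hθ₀, fun _ hθ h0 => hθ.tendsto hc hgrad (h0 ▸ hθ₀)⟩

/-- A gradient bound from a comparison of `F` with a quadratic along the ray to `p`. -/
theorem HasGradientAt.le_inner_of_ray {F : EuclideanSpace ℝ (Fin d) → ℝ}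
    {y g : EuclideanSpace ℝ (Fin d)} (hg : HasGradientAt F g y) {a b : ℝ}
    (hray : ∀ σ, 0 ≤ σ → σ ≤ 1 → F (y - σ • (y - p)) - F p ≤
      (1 - σ) ^ 2 * (F y - F p) + σ * a + σ ^ 2 * b) :
    2 * (F y - F p) - a ≤ inner ℝ g (y - p) := by
  have h1 : HasDerivAt (fun σ : ℝ => F (y - σ • (y - p))) (-(inner ℝ g (y - p))) 0 := by
    have hl : HasDerivAt (fun σ : ℝ => y - σ • (y - p)) (-(y - p)) 0 := by
      simpa using ((hasDerivAt_id (0 : ℝ)).smul_const (y - p)).const_sub y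
    have hF : HasFDerivAt F (InnerProductSpace.toDual ℝ _ g) (y - (0 : ℝ) • (y - p)) := by
      simpa using hg.hasFDerivAt
    have h := hF.comp_hasDerivAt (0 : ℝ) hl
    rw [InnerProductSpace.toDual_apply_apply, inner_neg_right] at h
    exact h
  have h2 : HasDerivAt (fun σ : ℝ => F p + (1 - σ) ^ 2 * (F y - F p) + σ * a + σ ^ 2 * b)
      (-2 * (F y - F p) + a) 0 := by
    have e1 : HasDerivAt (fun σ : ℝ => (1 - σ) ^ 2) (-2) 0 := by
      simpa using ((hasDerivAt_id' (0 : ℝ)).const_sub 1).fun_pow 2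
    have e2 : HasDerivAt (fun σ : ℝ => σ ^ 2) 0 0 := by
      simpa using (hasDerivAt_id' (0 : ℝ)).fun_pow 2
    have := (((e1.mul_const (F y - F p)).const_add (F p)).fun_add
      ((hasDerivAt_id' (0 : ℝ)).mul_const a)).fun_add (e2.mul_const b)
    simpa using this
  -- Both sides of the comparison agree at `σ = 0`, so their right derivatives there are ordered.
  have h3 := (h2.sub h1).tendsto_slope_zero_right
  have h4 := ge_of_tendsto h3 (b := 0) (by
    filter_upwards [Ioc_mem_nhdsGT (zero_lt_one (α := ℝ))] with σ hσ
    have := hray σ hσ.1.le hσ.2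
    simp only [zero_add, Pi.sub_apply, smul_eq_mul]
    refine mul_nonneg (inv_nonneg.2 hσ.1.le) ?_
    simp
    linarith)
  linarith

end GradientFlow

/-! ### Quadratic forms and their seminorms. -/

section QuadraticForms

variable {n m : ℕ}

theorem Matrix.exists_norm_mulVec_le (M : Matrix (Fin m) (Fin n) ℝ) :
    ∃ C, 0 ≤ C ∧ ∀ x : Fin n → ℝ, ‖M *ᵥ x‖ ≤ C * ‖x‖ :=
  ⟨_, norm_nonneg _, (LinearMap.toContinuousLinearMap M.mulVecLin).le_opNorm⟩

theorem Matrix.exists_dotProduct_mulVec_le (M : Matrix (Fin n) (Fin n) ℝ) :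
    ∃ C, 0 ≤ C ∧ ∀ x : Fin n → ℝ, x ⬝ᵥ M *ᵥ x ≤ C * ‖x‖ ^ 2 := by
  obtain ⟨C, hC, h⟩ := M.exists_norm_mulVec_le
  refine ⟨n * C, by positivity, fun x => ?_⟩
  calc x ⬝ᵥ M *ᵥ x ≤ ∑ _i : Fin n, ‖x‖ * (C * ‖x‖) := by
        refine Finset.sum_le_sum fun i _ => (le_abs_self _).trans ?_
        rw [abs_mul]
        exact mul_le_mul (norm_le_pi_norm x i) ((norm_le_pi_norm (M *ᵥ x) i).trans (h x))
          (abs_nonneg _) (norm_nonneg _)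
    _ = _ := by simp; ring

theorem Matrix.PosDef.exists_le_dotProduct_mulVec {M : Matrix (Fin n) (Fin n) ℝ} (hM : M.PosDef) :
    ∃ c, 0 < c ∧ ∀ x : Fin n → ℝ, c * ‖x‖ ^ 2 ≤ x ⬝ᵥ M *ᵥ x := by
  have hcont : Continuous fun x : Fin n → ℝ => x ⬝ᵥ M *ᵥ x := by fun_prop
  -- The sphere is empty if `n = 0`. Otherwise the constant is the minimum of the form on it.
  rcases (Metric.sphere (0 : Fin n → ℝ) 1).eq_empty_or_nonempty with he | hne
  · refine ⟨1, one_pos, fun x => ?_⟩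
    have hx : x = 0 := by
      by_contra hx
      have : ‖x‖⁻¹ • x ∈ Metric.sphere (0 : Fin n → ℝ) 1 := by
        simp [norm_smul, inv_mul_cancel₀ (norm_ne_zero_iff.2 hx)]
      simp [he] at this
    simp [hx]
  · obtain ⟨z, hz, hmin⟩ := (isCompact_sphere (0 : Fin n → ℝ) 1).exists_isMinOn hne hcont.continuousOn
    have hz0 : z ≠ 0 := by
      rintro rfl
      simp at hz
    refine ⟨z ⬝ᵥ M *ᵥ z, by simpa using hM.dotProduct_mulVec_pos hz0, fun x => ?_⟩
    rcases eq_or_ne x 0 with rfl | hx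
    · simp
    have hx' := norm_pos_iff.2 hx
    have h1 : z ⬝ᵥ M *ᵥ z ≤ (‖x‖⁻¹ • x) ⬝ᵥ M *ᵥ (‖x‖⁻¹ • x) := hmin (by
      simp [norm_smul, inv_mul_cancel₀ hx'.ne'])
    rw [Matrix.mulVec_smul, dotProduct_smul, smul_dotProduct, smul_eq_mul, smul_eq_mul] at h1
    calc z ⬝ᵥ M *ᵥ z * ‖x‖ ^ 2 ≤ ‖x‖⁻¹ * (‖x‖⁻¹ * x ⬝ᵥ M *ᵥ x) * ‖x‖ ^ 2 := by gcongr
      _ = _ := by field_simp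

open scoped MatrixOrder Matrix.Norms.L2Operator in
theorem Matrix.PosSemidef.exists_eq_conjTranspose_mul_self {M : Matrix (Fin n) (Fin n) ℝ}
    (hM : M.PosSemidef) : ∃ C : Matrix (Fin n) (Fin n) ℝ, M = Cᴴ * C :=
  CStarAlgebra.nonneg_iff_eq_star_mul_self.1 hM.nonneg

/-- With M = CᵀC the seminorm is the Euclidean norm of Cx. It supplies the triangle inequality in
the perturbation estimates. -/
theorem Matrix.PosSemidef.exists_seminorm {M : Matrix (Fin n) (Fin n) ℝ} (hM : M.PosSemidef) :
    ∃ N : Seminorm ℝ (Fin n → ℝ), ∀ x, N x ^ 2 = x ⬝ᵥ M *ᵥ x := by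
  obtain ⟨C, hC⟩ := hM.exists_eq_conjTranspose_mul_self
  refine ⟨(normSeminorm ℝ (EuclideanSpace ℝ (Fin n))).comp
    ((WithLp.linearEquiv 2 ℝ (Fin n → ℝ)).symm.toLinearMap.comp C.mulVecLin), fun x => ?_⟩
  rw [hC, Matrix.conjTranspose_eq_transpose_of_trivial, ← Matrix.mulVec_mulVec,
    Matrix.dotProduct_mulVec, Matrix.vecMul_transpose, Seminorm.comp_apply, coe_normSeminorm,
    EuclideanSpace.real_norm_sq_eq]
  simp [dotProduct, sq]

theorem Matrix.IsSymm.dotProduct_mulVec_comm {M : Matrix (Fin n) (Fin n) ℝ} (hM : M.IsSymm)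
    (x y : Fin n → ℝ) : x ⬝ᵥ M *ᵥ y = y ⬝ᵥ M *ᵥ x := by
  rw [Matrix.dotProduct_mulVec, ← Matrix.mulVec_transpose, hM.eq, dotProduct_comm]

theorem Matrix.IsSymm.apply_eq_polar {M : Matrix (Fin n) (Fin n) ℝ} (hM : M.IsSymm) (i j : Fin n) :
    M i j = ((Pi.single i 1 + Pi.single j 1) ⬝ᵥ M *ᵥ (Pi.single i 1 + Pi.single j 1) -
      Pi.single i 1 ⬝ᵥ M *ᵥ Pi.single i 1 - Pi.single j 1 ⬝ᵥ M *ᵥ Pi.single j 1) / 2 := by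
  have := hM.apply i j
  simp [Matrix.mulVec_add]
  linarith

end QuadraticForms

/-! ### The Riccati operator and the completed Bellman equation. -/

namespace LQR

variable {n m : ℕ} (S : LQR n m)

/-- The weight of the action in the square completion of the Bellman operator. -/
noncomputable def actionWeight (γ : ℝ) (P : Matrix (Fin n) (Fin n) ℝ) : Matrix (Fin m) (Fin m) ℝ :=
  S.R + γ • (S.Bᵀ * P * S.B)

/-- The gain that is greedy with respect to the value `P`. -/
noncomputable def gain (γ : ℝ) (P : Matrix (Fin n) (Fin n) ℝ) : Matrix (Fin m) (Fin n) ℝ :=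
  -(γ • ((S.R + γ • (S.Bᵀ * P * S.B))⁻¹ * (S.Bᵀ * P * S.A)))

/-- The discounted Riccati operator. -/
noncomputable def riccati (γ : ℝ) (P : Matrix (Fin n) (Fin n) ℝ) : Matrix (Fin n) (Fin n) ℝ :=
  γ • (S.Aᵀ * P * S.A)
    - γ ^ 2 • (S.Aᵀ * P * S.B * (S.R + γ • (S.Bᵀ * P * S.B))⁻¹ * (S.Bᵀ * P * S.A)) + S.Q

/-- The successor state. -/
def next (x : Fin n → ℝ) (u : Fin m → ℝ) : Fin n → ℝ := S.A *ᵥ x + S.B *ᵥ u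

variable {S} {γ : ℝ} {P : Matrix (Fin n) (Fin n) ℝ}

theorem posDef_actionWeight (hR : S.R.PosDef) (hγ : 0 ≤ γ) (hP : P.PosSemidef) :
    (S.actionWeight γ P).PosDef := by
  have h : (S.Bᵀ * P * S.B).PosSemidef := by
    simpa using hP.conjTranspose_mul_mul_same S.B
  exact hR.add_posSemidef (h.smul hγ)

/-- The one-step cost is quadratic in `u` with Hessian twice the action weight, and `gain` locates
its minimum. What remains after completing the square is the Riccati operator. All later cost
comparisons rest on this identity. -/
theorem bellman (hR : S.R.PosDef) (hγ : 0 ≤ γ) (hP : P.PosSemidef)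
    (x : Fin n → ℝ) (u : Fin m → ℝ) :
    S.stageCost x u + γ * (S.next x u ⬝ᵥ P *ᵥ S.next x u) =
      x ⬝ᵥ S.riccati γ P *ᵥ x +
        (u - S.gain γ P *ᵥ x) ⬝ᵥ S.actionWeight γ P *ᵥ (u - S.gain γ P *ᵥ x) := by
  have hM := posDef_actionWeight (S := S) hR hγ hP
  have hPs : P.IsSymm := by simpa using hP.1
  have hMs : (S.actionWeight γ P).IsSymm := by simpa using hM.1
  -- The greedy action is `-γ • w`. Since the action weight maps `w` to BᵀPAx, the inverse
  -- disappears from all later computations.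
  set w := (S.actionWeight γ P)⁻¹ *ᵥ ((S.Bᵀ * P * S.A) *ᵥ x) with hw
  have hMw : S.actionWeight γ P *ᵥ w = (S.Bᵀ * P * S.A) *ᵥ x := by
    rw [hw, Matrix.mulVec_mulVec, Matrix.mul_nonsing_inv _ ((Matrix.isUnit_iff_isUnit_det _).1 hM.isUnit),
      Matrix.one_mulVec]
  have hK : u - S.gain γ P *ᵥ x = u + γ • w := by
    simp only [gain, Matrix.neg_mulVec, Matrix.smul_mulVec, sub_neg_eq_add, hw,
      ← Matrix.mulVec_mulVec, actionWeight]
  have hric : x ⬝ᵥ S.riccati γ P *ᵥ x = γ * ((S.A *ᵥ x) ⬝ᵥ P *ᵥ (S.A *ᵥ x)) -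
      γ ^ 2 * ((S.B *ᵥ w) ⬝ᵥ P *ᵥ (S.A *ᵥ x)) + x ⬝ᵥ S.Q *ᵥ x := by
    simp only [riccati, Matrix.add_mulVec, Matrix.sub_mulVec, Matrix.smul_mulVec, dotProduct_add,
      dotProduct_sub, dotProduct_smul, smul_eq_mul]
    have e1 : x ⬝ᵥ (S.Aᵀ * P * S.A) *ᵥ x = (S.A *ᵥ x) ⬝ᵥ P *ᵥ (S.A *ᵥ x) := by
      rw [← Matrix.mulVec_mulVec, ← Matrix.mulVec_mulVec, Matrix.dotProduct_mulVec x,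
        Matrix.vecMul_transpose]
    have e2 : x ⬝ᵥ (S.Aᵀ * P * S.B * (S.R + γ • (S.Bᵀ * P * S.B))⁻¹ * (S.Bᵀ * P * S.A)) *ᵥ x =
        (S.B *ᵥ w) ⬝ᵥ P *ᵥ (S.A *ᵥ x) := by
      rw [← Matrix.mulVec_mulVec, ← Matrix.mulVec_mulVec, ← Matrix.mulVec_mulVec,
        ← Matrix.mulVec_mulVec, Matrix.dotProduct_mulVec x, Matrix.vecMul_transpose]
      exact hPs.dotProduct_mulVec_comm _ _
    rw [e1, e2]
  have h1 : ∀ v, v ⬝ᵥ (S.Bᵀ * P * S.A) *ᵥ x = (S.B *ᵥ v) ⬝ᵥ P *ᵥ (S.A *ᵥ x) := fun v => by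
    rw [← Matrix.mulVec_mulVec, ← Matrix.mulVec_mulVec, Matrix.dotProduct_mulVec,
      Matrix.vecMul_transpose]
  have h2 : u ⬝ᵥ S.actionWeight γ P *ᵥ u = u ⬝ᵥ S.R *ᵥ u + γ * ((S.B *ᵥ u) ⬝ᵥ P *ᵥ (S.B *ᵥ u)) := by
    simp only [actionWeight, Matrix.add_mulVec, Matrix.smul_mulVec, dotProduct_add, dotProduct_smul,
      smul_eq_mul, ← Matrix.mulVec_mulVec]
    rw [Matrix.dotProduct_mulVec u S.Bᵀ, Matrix.vecMul_transpose]
  rw [hK, hric, Matrix.mulVec_add, Matrix.mulVec_smul, hMw, dotProduct_add, add_dotProduct,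
    add_dotProduct, h2]
  simp only [smul_dotProduct, dotProduct_smul, smul_eq_mul, h1, Matrix.mulVec_smul]
  rw [hMs.dotProduct_mulVec_comm w u, hMw, h1]
  simp only [stageCost, next, Matrix.mulVec_add, dotProduct_add, add_dotProduct]
  rw [hPs.dotProduct_mulVec_comm (S.A *ᵥ x) (S.B *ᵥ u)]
  ring

end LQR

/-! ### Value iteration, controllability and the Riccati solution. -/

namespace LQR

variable {n m : ℕ} {S : LQR n m} {γ γ' : ℝ} {P P' : Matrix (Fin n) (Fin n) ℝ}

section ValueIteration

theorem stageCost_nonneg (hQ : S.Q.PosDef) (hR : S.R.PosDef) (x : Fin n → ℝ) (u : Fin m → ℝ) :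
    0 ≤ S.stageCost x u :=
  add_nonneg (by simpa using hQ.posSemidef.dotProduct_mulVec_nonneg x)
    (by simpa using hR.posSemidef.dotProduct_mulVec_nonneg u)

/-- Together with `riccati_eq` this makes the Riccati operator a minimum over actions, from which
positivity and monotonicity follow without handling its formula. -/
theorem riccati_le (hR : S.R.PosDef) (hγ : 0 ≤ γ) (hP : P.PosSemidef)
    (x : Fin n → ℝ) (u : Fin m → ℝ) :
    x ⬝ᵥ S.riccati γ P *ᵥ x ≤ S.stageCost x u + γ * (S.next x u ⬝ᵥ P *ᵥ S.next x u) := by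
  rw [bellman hR hγ hP]
  have := (posDef_actionWeight (S := S) hR hγ hP).posSemidef.dotProduct_mulVec_nonneg
    (u - S.gain γ P *ᵥ x)
  simp only [star_trivial] at this
  linarith

theorem riccati_eq (hR : S.R.PosDef) (hγ : 0 ≤ γ) (hP : P.PosSemidef) (x : Fin n → ℝ) :
    x ⬝ᵥ S.riccati γ P *ᵥ x = S.stageCost x (S.gain γ P *ᵥ x) +
      γ * (S.next x (S.gain γ P *ᵥ x) ⬝ᵥ P *ᵥ S.next x (S.gain γ P *ᵥ x)) := by
  rw [bellman hR hγ hP]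
  simp

theorem posSemidef_riccati (hQ : S.Q.PosDef) (hR : S.R.PosDef) (hγ : 0 ≤ γ) (hP : P.PosSemidef) :
    (S.riccati γ P).PosSemidef := by
  have hPs : Pᵀ = P := by simpa using hP.1.eq
  have hQs : S.Qᵀ = S.Q := by simpa using hQ.1.eq
  have hRs : S.Rᵀ = S.R := by simpa using hR.1.eq
  refine Matrix.PosSemidef.of_dotProduct_mulVec_nonneg ?_ fun x => ?_
  · rw [Matrix.IsHermitian, Matrix.conjTranspose_eq_transpose_of_trivial, riccati]
    simp [Matrix.transpose_mul, Matrix.transpose_nonsing_inv, hPs, hQs, hRs, Matrix.mul_assoc]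
  · rw [star_trivial, riccati_eq hR hγ hP]
    have := hP.dotProduct_mulVec_nonneg (S.next x (S.gain γ P *ᵥ x))
    exact add_nonneg (stageCost_nonneg hQ hR _ _) (mul_nonneg hγ (by simpa using this))

/-- The greedy action for the larger data is a competitor for the smaller ones. -/
theorem riccati_mono (hR : S.R.PosDef) (hγ : 0 ≤ γ) (hγγ' : γ ≤ γ') (hP : P.PosSemidef)
    (hP' : P'.PosSemidef) (h : ∀ x, x ⬝ᵥ P *ᵥ x ≤ x ⬝ᵥ P' *ᵥ x) (x : Fin n → ℝ) :
    x ⬝ᵥ S.riccati γ P *ᵥ x ≤ x ⬝ᵥ S.riccati γ' P' *ᵥ x := by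
  rw [riccati_eq hR (hγ.trans hγγ') hP']
  refine (riccati_le hR hγ hP x (S.gain γ' P' *ᵥ x)).trans ?_
  have := hP.dotProduct_mulVec_nonneg (S.next x (S.gain γ' P' *ᵥ x))
  rw [star_trivial] at this
  have := h (S.next x (S.gain γ' P' *ᵥ x))
  have := hγ.trans hγγ'
  gcongr

variable (S) in
/-- Value iteration started at zero. -/
noncomputable def valueIter (γ : ℝ) : ℕ → Matrix (Fin n) (Fin n) ℝ
  | 0 => 0
  | k + 1 => S.riccati γ (valueIter γ k)

theorem posSemidef_valueIter (hQ : S.Q.PosDef) (hR : S.R.PosDef) (hγ : 0 ≤ γ) (k : ℕ) :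
    (S.valueIter γ k).PosSemidef := by
  induction k with
  | zero => exact Matrix.PosSemidef.zero
  | succ k ih => exact posSemidef_riccati hQ hR hγ ih

theorem valueIter_mono_discount (hQ : S.Q.PosDef) (hR : S.R.PosDef) (hγ : 0 ≤ γ) (hγγ' : γ ≤ γ')
    (k : ℕ) (x : Fin n → ℝ) :
    x ⬝ᵥ S.valueIter γ k *ᵥ x ≤ x ⬝ᵥ S.valueIter γ' k *ᵥ x := by
  induction k generalizing x with
  | zero => exact le_rfl
  | succ k ih =>
    exact riccati_mono hR hγ hγγ' (posSemidef_valueIter hQ hR hγ k)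
      (posSemidef_valueIter hQ hR (hγ.trans hγγ') k) ih x

theorem valueIter_le_succ (hQ : S.Q.PosDef) (hR : S.R.PosDef) (hγ : 0 ≤ γ) (k : ℕ)
    (x : Fin n → ℝ) : x ⬝ᵥ S.valueIter γ k *ᵥ x ≤ x ⬝ᵥ S.valueIter γ (k + 1) *ᵥ x := by
  induction k generalizing x with
  | zero =>
    simpa [valueIter] using (posSemidef_valueIter hQ hR hγ 1).dotProduct_mulVec_nonneg x
  | succ k ih =>
    exact riccati_mono hR hγ le_rfl (posSemidef_valueIter hQ hR hγ k)
      (posSemidef_valueIter hQ hR hγ (k + 1)) ih x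

end ValueIteration

section Controllability

variable (S) in
/-- The trajectory of the open-loop control `u`. -/
def openTraj (x : Fin n → ℝ) (u : ℕ → Fin m → ℝ) : ℕ → Fin n → ℝ
  | 0 => x
  | t + 1 => S.next (openTraj x u t) (u t)

theorem openTraj_succ (x : Fin n → ℝ) (u : ℕ → Fin m → ℝ) (t : ℕ) :
    S.openTraj x u (t + 1) = S.openTraj (S.next x (u 0)) (fun i => u (i + 1)) t := by
  induction t with
  | zero => rfl
  | succ t ih => rw [openTraj, ih]; rfl

/-- The `k`-th iterate is the optimal cost over `k` stages, so any open-loop control bounds it. -/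
theorem valueIter_one_le (hQ : S.Q.PosDef) (hR : S.R.PosDef) (k : ℕ) (x : Fin n → ℝ)
    (u : ℕ → Fin m → ℝ) : x ⬝ᵥ S.valueIter 1 k *ᵥ x ≤
      ∑ t ∈ Finset.range k, S.stageCost (S.openTraj x u t) (u t) := by
  induction k generalizing x u with
  | zero => simp [valueIter]
  | succ k ih =>
    rw [Finset.sum_range_succ']
    refine (riccati_le hR zero_le_one (posSemidef_valueIter hQ hR zero_le_one k) x (u 0)).trans ?_
    rw [add_comm, one_mul]
    refine add_le_add ((ih (S.next x (u 0)) fun i => u (i + 1)).trans_eq ?_) le_rfl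
    exact Finset.sum_congr rfl fun t _ => by rw [openTraj_succ]

theorem openTraj_eq (x : Fin n → ℝ) (u : ℕ → Fin m → ℝ) (k : ℕ) :
    S.openTraj x u k = S.A ^ k *ᵥ x +
      ∑ i ∈ Finset.range k, (S.A ^ (k - 1 - i) * S.B) *ᵥ u i := by
  induction k with
  | zero => simp [openTraj]
  | succ k ih =>
    rw [openTraj, next, ih, Finset.sum_range_succ, Matrix.mulVec_add, Matrix.mulVec_mulVec,
      ← pow_succ', Matrix.mulVec_sum, add_assoc]
    congr 2
    · refine Finset.sum_congr rfl fun i hi => ?_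
      have : k + 1 - 1 - i = (k - 1 - i) + 1 := by
        have := Finset.mem_range.1 hi
        omega
      rw [this, Matrix.mulVec_mulVec, ← Matrix.mul_assoc, ← pow_succ']
    · simp

theorem Controllable.exists_control (h : S.Controllable) (x : Fin n → ℝ) :
    ∃ u : ℕ → Fin m → ℝ, ∀ t, n ≤ t → S.openTraj x u t = 0 ∧ u t = 0 := by
  have hreach : ∀ v : Fin n → ℝ, ∃ w : ℕ → Fin m → ℝ,
      v = ∑ k ∈ Finset.range n, (S.A ^ k * S.B) *ᵥ w k := fun v => by
    have hv : v ∈ Submodule.span ℝ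
        {x : Fin n → ℝ | ∃ k < n, ∃ u : Fin m → ℝ, x = (S.A ^ k * S.B) *ᵥ u} := by
      rw [show Submodule.span ℝ _ = ⊤ from h]
      trivial
    induction hv using Submodule.span_induction with
    | mem v hv =>
      obtain ⟨k, hk, u, rfl⟩ := hv
      refine ⟨Pi.single k u, ?_⟩
      rw [Finset.sum_eq_single k]
      · simp
      · intro j _ hj
        simp [Pi.single_eq_of_ne hj]
      · intro hk'
        exact absurd (Finset.mem_range.2 hk) hk'
    | zero => exact ⟨0, by simp⟩
    | add v w _ _ hv hw =>
      obtain ⟨a, ha⟩ := hv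
      obtain ⟨b, hb⟩ := hw
      refine ⟨a + b, ?_⟩
      simp only [Pi.add_apply, Matrix.mulVec_add, Finset.sum_add_distrib]
      rw [← ha, ← hb]
    | smul c v _ hv =>
      obtain ⟨a, ha⟩ := hv
      refine ⟨c • a, ?_⟩
      simp only [Pi.smul_apply, Matrix.mulVec_smul, ← Finset.smul_sum]
      rw [← ha]
  -- A control whose contribution cancels the free motion Aⁿx brings the state to 0 at time `n`;
  -- with zero input it stays there. The inputs are used in reverse order.
  obtain ⟨w, hw⟩ := hreach (-(S.A ^ n *ᵥ x))
  set u : ℕ → Fin m → ℝ := fun t => if t < n then w (n - 1 - t) else 0 with hu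
  refine ⟨u, fun t ht => ⟨?_, by simp [hu, not_lt.2 ht]⟩⟩
  induction t, ht using Nat.le_induction with
  | base =>
    rw [openTraj_eq, ← Finset.sum_range_reflect]
    have : ∑ j ∈ Finset.range n, (S.A ^ (n - 1 - (n - 1 - j)) * S.B) *ᵥ u (n - 1 - j) =
        ∑ k ∈ Finset.range n, (S.A ^ k * S.B) *ᵥ w k := by
      refine Finset.sum_congr rfl fun j hj => ?_
      have hj := Finset.mem_range.1 hj
      have h1 : n - 1 - (n - 1 - j) = j := by omega
      have h2 : n - 1 - j < n := by omega
      simp only [hu, h1, h2, if_true]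
    rw [this, ← hw]
    simp
  | succ t ht ih =>
    rw [openTraj, ih]
    simp [next, hu, not_lt.2 ht]

theorem Controllable.exists_valueIter_le (h : S.Controllable) (hQ : S.Q.PosDef) (hR : S.R.PosDef)
    (x : Fin n → ℝ) : ∃ c, ∀ k, x ⬝ᵥ S.valueIter 1 k *ᵥ x ≤ c := by
  obtain ⟨u, hu⟩ := h.exists_control x
  refine ⟨∑ t ∈ Finset.range n, S.stageCost (S.openTraj x u t) (u t), fun k =>
    (valueIter_one_le hQ hR k x u).trans ?_⟩
  rcases le_total k n with hk | hk
  · exact Finset.sum_le_sum_of_subset_of_nonneg (Finset.range_mono hk)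
      fun _ _ _ => stageCost_nonneg hQ hR _ _
  · refine (Finset.sum_subset (Finset.range_mono hk) fun t _ ht => ?_).ge
    rw [Finset.mem_range, not_lt] at ht
    rw [(hu t ht).1, (hu t ht).2]
    simp [stageCost]

end Controllability

section Value

variable (S) in
/-- The limit of value iteration. -/
noncomputable def value (γ : ℝ) : Matrix (Fin n) (Fin n) ℝ :=
  Matrix.of fun i j => limUnder atTop fun k => S.valueIter γ k i j

variable (hQ : S.Q.PosDef) (hR : S.R.PosDef) (hAB : S.Controllable)

include hQ hR hAB

/-- The quadratic forms increase in `k` and are bounded by the cost of steering to 0 at γ = 1.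
Polarization passes from forms to matrix entries. -/
theorem tendsto_valueIter (hγ : γ ∈ Icc (0 : ℝ) 1) :
    Tendsto (S.valueIter γ) atTop (𝓝 (S.value γ)) := by
  have hquad : ∀ x : Fin n → ℝ, ∃ l, Tendsto (fun k => x ⬝ᵥ S.valueIter γ k *ᵥ x) atTop (𝓝 l) := by
    intro x
    obtain ⟨c, hc⟩ := hAB.exists_valueIter_le hQ hR x
    exact ⟨_, tendsto_atTop_ciSup (monotone_nat_of_le_succ fun k => valueIter_le_succ hQ hR hγ.1 k x)
      ⟨c, by
        rintro _ ⟨k, rfl⟩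
        exact (valueIter_mono_discount hQ hR hγ.1 hγ.2 k x).trans (hc k)⟩⟩
  refine tendsto_pi_nhds.2 fun i => tendsto_pi_nhds.2 fun j => ?_
  obtain ⟨a, ha⟩ := hquad (Pi.single i 1 + Pi.single j 1)
  obtain ⟨b, hb⟩ := hquad (Pi.single i 1)
  obtain ⟨c, hc⟩ := hquad (Pi.single j 1)
  refine tendsto_nhds_limUnder ⟨(a - b - c) / 2, (((ha.sub hb).sub hc).div_const 2).congr fun k => ?_⟩
  have hs : (S.valueIter γ k).IsSymm := by simpa using (posSemidef_valueIter hQ hR hγ.1 k).1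
  exact (hs.apply_eq_polar i j).symm

theorem tendsto_valueIter_form (hγ : γ ∈ Icc (0 : ℝ) 1) (x : Fin n → ℝ) :
    Tendsto (fun k => x ⬝ᵥ S.valueIter γ k *ᵥ x) atTop (𝓝 (x ⬝ᵥ S.value γ *ᵥ x)) := by
  have : Continuous fun M : Matrix (Fin n) (Fin n) ℝ => x ⬝ᵥ M *ᵥ x := by fun_prop
  exact (this.tendsto _).comp (tendsto_valueIter hQ hR hAB hγ)

theorem posSemidef_value (hγ : γ ∈ Icc (0 : ℝ) 1) : (S.value γ).PosSemidef := by
  refine Matrix.PosSemidef.of_dotProduct_mulVec_nonneg ?_ fun x => ?_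
  · rw [Matrix.IsHermitian, Matrix.conjTranspose_eq_transpose_of_trivial]
    have h := tendsto_valueIter hQ hR hAB hγ
    have hT : Tendsto (fun k => (S.valueIter γ k)ᵀ) atTop (𝓝 (S.value γ)ᵀ) :=
      ((continuous_id.matrix_transpose).tendsto _).comp h
    refine tendsto_nhds_unique (hT.congr fun k => ?_) h
    simpa using (posSemidef_valueIter hQ hR hγ.1 k).1.eq
  · rw [star_trivial]
    exact ge_of_tendsto' (tendsto_valueIter_form hQ hR hAB hγ x) fun k => by
      simpa using (posSemidef_valueIter hQ hR hγ.1 k).dotProduct_mulVec_nonneg x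

theorem value_mono (hγ : 0 ≤ γ) (hγγ' : γ ≤ γ') (hγ' : γ' ≤ 1) (x : Fin n → ℝ) :
    x ⬝ᵥ S.value γ *ᵥ x ≤ x ⬝ᵥ S.value γ' *ᵥ x :=
  le_of_tendsto_of_tendsto' (tendsto_valueIter_form hQ hR hAB ⟨hγ, hγγ'.trans hγ'⟩ x)
    (tendsto_valueIter_form hQ hR hAB ⟨hγ.trans hγγ', hγ'⟩ x)
    fun k => valueIter_mono_discount hQ hR hγ hγγ' k x

/-- The fixed point equation passes to the limit: the Riccati operator is continuous at `S.value γ`,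
where the action weight is positive definite and hence invertible. -/
theorem value_eq_riccati (hγ : γ ∈ Icc (0 : ℝ) 1) : S.value γ = S.riccati γ (S.value γ) := by
  have h := tendsto_valueIter hQ hR hAB hγ
  have hM := posDef_actionWeight (S := S) hR hγ.1 (posSemidef_value hQ hR hAB hγ)
  have hdet : (S.actionWeight γ (S.value γ)).det ≠ 0 := hM.det_pos.ne'
  have hinv : ContinuousAt (fun P => (S.R + γ • (S.Bᵀ * P * S.B))⁻¹) (S.value γ) := by
    have h1 : ContinuousAt Inv.inv (S.actionWeight γ (S.value γ)) := by
      refine continuousAt_matrix_inv _ ?_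
      rw [Ring.inverse_eq_inv']
      exact continuousAt_inv₀ hdet
    have h2 : Continuous fun P : Matrix (Fin n) (Fin n) ℝ => S.R + γ • (S.Bᵀ * P * S.B) := by
      fun_prop
    exact ContinuousAt.comp (g := Inv.inv) h1 h2.continuousAt
  have hcont : ContinuousAt (S.riccati γ) (S.value γ) := by
    unfold riccati
    refine ContinuousAt.add (ContinuousAt.sub (by fun_prop) (ContinuousAt.fun_const_smul ?_ _))
      continuousAt_const
    have h1 : ContinuousAt (fun P => S.Aᵀ * P * S.B) (S.value γ) := by fun_prop
    have h2 : ContinuousAt (fun P => S.Bᵀ * P * S.A) (S.value γ) := by fun_prop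
    exact ((continuous_fst.matrix_mul continuous_snd).continuousAt).comp₂
      (((continuous_fst.matrix_mul continuous_snd).continuousAt).comp₂ h1 hinv) h2
  exact tendsto_nhds_unique ((tendsto_add_atTop_iff_nat 1).2 h) (hcont.tendsto.comp h)

theorem le_value (hγ : γ ∈ Icc (0 : ℝ) 1) (x : Fin n → ℝ) :
    x ⬝ᵥ S.Q *ᵥ x ≤ x ⬝ᵥ S.value γ *ᵥ x := by
  have hP := posSemidef_value hQ hR hAB hγ
  rw [value_eq_riccati hQ hR hAB hγ, riccati_eq hR hγ.1 hP]
  have h1 := hR.posSemidef.dotProduct_mulVec_nonneg (S.gain γ (S.value γ) *ᵥ x)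
  have h2 := mul_nonneg hγ.1
    (hP.dotProduct_mulVec_nonneg (S.next x (S.gain γ (S.value γ) *ᵥ x)))
  simp only [star_trivial] at h1 h2
  unfold stageCost
  linarith

theorem isRiccatiSolution_value (hγ : γ ∈ Icc (0 : ℝ) 1) : S.IsRiccatiSolution γ (S.value γ) := by
  refine ⟨Matrix.PosDef.of_dotProduct_mulVec_pos (posSemidef_value hQ hR hAB hγ).1 fun x hx => ?_,
    value_eq_riccati hQ hR hAB hγ⟩
  rw [star_trivial]
  have := hQ.dotProduct_mulVec_pos hx
  rw [star_trivial] at this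
  exact this.trans_le (le_value hQ hR hAB hγ x)

theorem isOptimalGain_value (hγ : γ ∈ Icc (0 : ℝ) 1) :
    S.IsOptimalGain γ (S.gain γ (S.value γ)) :=
  ⟨_, isRiccatiSolution_value hQ hR hAB hγ, rfl⟩

theorem bellman_value (hγ : γ ∈ Icc (0 : ℝ) 1) (x : Fin n → ℝ) (u : Fin m → ℝ) :
    S.stageCost x u + γ * (S.next x u ⬝ᵥ S.value γ *ᵥ S.next x u) = x ⬝ᵥ S.value γ *ᵥ x +
      (u - S.gain γ (S.value γ) *ᵥ x) ⬝ᵥ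
        S.actionWeight γ (S.value γ) *ᵥ (u - S.gain γ (S.value γ) *ᵥ x) := by
  rw [bellman hR hγ.1 (posSemidef_value hQ hR hAB hγ), ← value_eq_riccati hQ hR hAB hγ]

end Value

end LQR

/-! ### Bounds uniform in the discount factor and continuity of the optimal gain. -/

namespace LQR

variable {n m : ℕ} {S : LQR n m} {γ γ' : ℝ}

/-- Bounds for the value matrix and the action weight that are uniform in the discount factor,
and contraction of the optimal closed loop. -/
structure UniformBounds (S : LQR n m) (a b ρ c q : ℝ) : Prop where
  pos_a : 0 < a
  pos_b : 0 < b
  pos_ρ : 0 < ρ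
  nonneg_c : 0 ≤ c
  nonneg_q : 0 ≤ q
  q_lt_one : q < 1
  le_value : ∀ γ ∈ Icc (0 : ℝ) 1, ∀ x, a * ‖x‖ ^ 2 ≤ x ⬝ᵥ S.value γ *ᵥ x
  value_le : ∀ γ ∈ Icc (0 : ℝ) 1, ∀ x, x ⬝ᵥ S.value γ *ᵥ x ≤ b * ‖x‖ ^ 2
  le_weight : ∀ γ ∈ Icc (0 : ℝ) 1, ∀ u, ρ * ‖u‖ ^ 2 ≤ u ⬝ᵥ S.actionWeight γ (S.value γ) *ᵥ u
  weight_le : ∀ γ ∈ Icc (0 : ℝ) 1, ∀ u, u ⬝ᵥ S.actionWeight γ (S.value γ) *ᵥ u ≤ c * ‖u‖ ^ 2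
  contraction : ∀ γ ∈ Icc (0 : ℝ) 1, ∀ x,
    γ * (S.next x (S.gain γ (S.value γ) *ᵥ x) ⬝ᵥ S.value γ *ᵥ S.next x (S.gain γ (S.value γ) *ᵥ x))
      ≤ q * (x ⬝ᵥ S.value γ *ᵥ x)

variable (hQ : S.Q.PosDef) (hR : S.R.PosDef) (hAB : S.Controllable)

include hQ hR hAB

theorem stageCost_gain (hγ : γ ∈ Icc (0 : ℝ) 1) (x : Fin n → ℝ) :
    S.stageCost x (S.gain γ (S.value γ) *ᵥ x) + γ *
      (S.next x (S.gain γ (S.value γ) *ᵥ x) ⬝ᵥ S.value γ *ᵥ S.next x (S.gain γ (S.value γ) *ᵥ x)) =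
      x ⬝ᵥ S.value γ *ᵥ x := by
  rw [bellman_value hQ hR hAB hγ]
  simp

theorem weight_eq (hγ : γ ∈ Icc (0 : ℝ) 1) (u : Fin m → ℝ) :
    u ⬝ᵥ S.actionWeight γ (S.value γ) *ᵥ u =
      u ⬝ᵥ S.R *ᵥ u + γ * ((S.B *ᵥ u) ⬝ᵥ S.value γ *ᵥ (S.B *ᵥ u)) := by
  -- At state 0 only the action weight is left in the completed square.
  have := bellman_value hQ hR hAB hγ 0 u
  simpa [stageCost, next] using this.symm

/-- The value lies between `Q` and the undiscounted value for every γ. The optimal stage cost, at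
least a|x|², is therefore at least the fraction a/b of the value, which leaves the factor q = 1 -
a/b for the discounted value of the successor. -/
theorem exists_uniformBounds : ∃ a b ρ c q, S.UniformBounds a b ρ c q := by
  obtain ⟨a, ha, hQa⟩ := hQ.exists_le_dotProduct_mulVec
  obtain ⟨ρ, hρ, hRρ⟩ := hR.exists_le_dotProduct_mulVec
  obtain ⟨b₀, hb₀, hVb⟩ := (S.value 1).exists_dotProduct_mulVec_le
  obtain ⟨c₀, hc₀, hRc⟩ := S.R.exists_dotProduct_mulVec_le
  obtain ⟨β, hβ, hB⟩ := S.B.exists_norm_mulVec_le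
  -- Adding `a` ensures `0 < b` and `a ≤ b`, hence `0 ≤ q`, even when the state space is trivial.
  set b := a + b₀ with hb
  have hbpos : 0 < b := by positivity
  have hva : ∀ γ ∈ Icc (0 : ℝ) 1, ∀ x, a * ‖x‖ ^ 2 ≤ x ⬝ᵥ S.value γ *ᵥ x := fun γ hγ x =>
    (hQa x).trans (LQR.le_value hQ hR hAB hγ x)
  have hvb : ∀ γ ∈ Icc (0 : ℝ) 1, ∀ x, x ⬝ᵥ S.value γ *ᵥ x ≤ b * ‖x‖ ^ 2 := fun γ hγ x =>
    (value_mono hQ hR hAB hγ.1 hγ.2 le_rfl x).trans ((hVb x).trans (by gcongr; linarith))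
  refine ⟨a, b, ρ, c₀ + b * β ^ 2, 1 - a / b, ha, hbpos, hρ, by positivity, ?_, ?_, hva, hvb,
    fun γ hγ u => ?_, fun γ hγ u => ?_, fun γ hγ x => ?_⟩
  · rw [sub_nonneg, div_le_one hbpos]
    linarith
  · have : 0 < a / b := by positivity
    linarith
  · rw [weight_eq hQ hR hAB hγ]
    have := mul_nonneg hγ.1 ((posSemidef_value hQ hR hAB hγ).dotProduct_mulVec_nonneg (S.B *ᵥ u))
    rw [star_trivial] at this
    linarith [hRρ u]
  · rw [weight_eq hQ hR hAB hγ, add_mul]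
    refine add_le_add (hRc u) ?_
    have h0 := (posSemidef_value hQ hR hAB hγ).dotProduct_mulVec_nonneg (S.B *ᵥ u)
    rw [star_trivial] at h0
    calc γ * ((S.B *ᵥ u) ⬝ᵥ S.value γ *ᵥ (S.B *ᵥ u))
        ≤ 1 * ((S.B *ᵥ u) ⬝ᵥ S.value γ *ᵥ (S.B *ᵥ u)) := by gcongr; exact hγ.2
      _ ≤ b * ‖S.B *ᵥ u‖ ^ 2 := by rw [one_mul]; exact hvb γ hγ _
      _ ≤ b * (β * ‖u‖) ^ 2 := by gcongr; exact hB u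
      _ = _ := by ring
  · have h1 := stageCost_gain hQ hR hAB hγ x
    have h2 := hR.posSemidef.dotProduct_mulVec_nonneg (S.gain γ (S.value γ) *ᵥ x)
    rw [star_trivial] at h2
    have h3 : a / b * (x ⬝ᵥ S.value γ *ᵥ x) ≤ x ⬝ᵥ S.Q *ᵥ x := by
      calc a / b * (x ⬝ᵥ S.value γ *ᵥ x) ≤ a / b * (b * ‖x‖ ^ 2) := by gcongr; exact hvb γ hγ x
        _ = a * ‖x‖ ^ 2 := by field_simp
        _ ≤ _ := hQa x
    unfold stageCost at h1
    linarith

/-- The contraction bounds the successor's value only after multiplication by γ, which says nothing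
near γ = 0. Here the successor is bounded without that factor, since the value controls the state
and, through `R`, the optimal action. -/
theorem UniformBounds.exists_gain_bound {a b ρ c q : ℝ} (hS : S.UniformBounds a b ρ c q) :
    ∃ C, 0 ≤ C ∧ ∀ γ ∈ Icc (0 : ℝ) 1, ∀ x,
      S.next x (S.gain γ (S.value γ) *ᵥ x) ⬝ᵥ S.value 1 *ᵥ S.next x (S.gain γ (S.value γ) *ᵥ x) ≤
        C * (x ⬝ᵥ S.value γ *ᵥ x) := by
  obtain ⟨ρ₀, hρ₀, hRρ⟩ := hR.exists_le_dotProduct_mulVec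
  obtain ⟨α, hα, hA⟩ := S.A.exists_norm_mulVec_le
  obtain ⟨β, hβ, hB⟩ := S.B.exists_norm_mulVec_le
  have ha := hS.pos_a
  have hb := hS.pos_b
  refine ⟨b * (2 * (α ^ 2 / a + β ^ 2 / ρ₀)), by positivity, fun γ hγ x => ?_⟩
  set V := x ⬝ᵥ S.value γ *ᵥ x
  set u := S.gain γ (S.value γ) *ᵥ x with hu
  have hx : ‖x‖ ^ 2 ≤ V / a := by
    rw [le_div_iff₀ ha, mul_comm]
    exact hS.le_value γ hγ x
  have huV : ‖u‖ ^ 2 ≤ V / ρ₀ := by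
    rw [le_div_iff₀ hρ₀, mul_comm]
    have h1 := stageCost_gain hQ hR hAB hγ x
    have h2 := hQ.posSemidef.dotProduct_mulVec_nonneg x
    have h3 := mul_nonneg hγ.1
      ((posSemidef_value hQ hR hAB hγ).dotProduct_mulVec_nonneg (S.next x u))
    rw [star_trivial] at h2 h3
    unfold stageCost at h1
    linarith [hRρ u]
  have hnext : ‖S.next x u‖ ^ 2 ≤ 2 * ((α * ‖x‖) ^ 2 + (β * ‖u‖) ^ 2) := by
    calc ‖S.next x u‖ ^ 2 ≤ (α * ‖x‖ + β * ‖u‖) ^ 2 := by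
          gcongr
          exact (norm_add_le _ _).trans (add_le_add (hA x) (hB u))
      _ ≤ _ := add_sq_le
  calc S.next x u ⬝ᵥ S.value 1 *ᵥ S.next x u ≤ b * ‖S.next x u‖ ^ 2 :=
        hS.value_le 1 ⟨zero_le_one, le_rfl⟩ _
    _ ≤ b * (2 * ((α * ‖x‖) ^ 2 + (β * ‖u‖) ^ 2)) := by gcongr
    _ = b * (2 * (α ^ 2 * ‖x‖ ^ 2 + β ^ 2 * ‖u‖ ^ 2)) := by ring
    _ ≤ b * (2 * (α ^ 2 * (V / a) + β ^ 2 * (V / ρ₀))) := by gcongr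
    _ = _ := by ring

/-- The optimal gain is Hölder continuous in the discount factor. -/
theorem UniformBounds.exists_gain_holder {a b ρ c q : ℝ} (hS : S.UniformBounds a b ρ c q) :
    ∃ C, 0 ≤ C ∧ ∀ γ γ', 0 ≤ γ → γ ≤ γ' → γ' ≤ 1 → ∀ x,
      ‖S.gain γ (S.value γ) *ᵥ x - S.gain γ' (S.value γ') *ᵥ x‖ ^ 2 ≤ C * (γ' - γ) * ‖x‖ ^ 2 := by
  obtain ⟨C, hC, hnext⟩ := hS.exists_gain_bound hQ hR hAB
  have ha := hS.pos_a
  have hb := hS.pos_b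
  have hρ := hS.pos_ρ
  have hq0 := hS.nonneg_q
  have hq1 : 0 < 1 - q := sub_pos.2 hS.q_lt_one
  refine ⟨(C / (1 - q) + C) * b / ρ, by positivity, fun γ γ' hγ0 hγγ' hγ1 x => ?_⟩
  have hγ : γ ∈ Icc (0 : ℝ) 1 := ⟨hγ0, hγγ'.trans hγ1⟩
  have hγ' : γ' ∈ Icc (0 : ℝ) 1 := ⟨hγ0.trans hγγ', hγ1⟩
  set Δ := γ' - γ with hΔ
  have hΔ0 : 0 ≤ Δ := sub_nonneg.2 hγγ'
  set V := fun x : Fin n → ℝ => x ⬝ᵥ S.value γ *ᵥ x with hV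
  set V' := fun x : Fin n → ℝ => x ⬝ᵥ S.value γ' *ᵥ x with hV'
  set y := fun x : Fin n → ℝ => S.next x (S.gain γ (S.value γ) *ᵥ x) with hy
  set w := fun x : Fin n → ℝ => S.gain γ (S.value γ) *ᵥ x - S.gain γ' (S.value γ') *ᵥ x with hw
  have hV0 : ∀ x, 0 ≤ V x := fun x => (by positivity : 0 ≤ a * ‖x‖ ^ 2).trans (hS.le_value γ hγ x)
  have hVV' : ∀ x, V x ≤ V' x := fun x => value_mono hQ hR hAB hγ0 hγγ' hγ1 x
  -- Both Bellman identities are evaluated at the `γ`-optimal action, which is off by `w x` for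
  -- `γ'`. Their difference bounds the value gap and `w` together.
  have hgap : ∀ x, V' x - V x + ρ * ‖w x‖ ^ 2 ≤ γ * (V' (y x) - V (y x)) + C * Δ * V x := fun x => by
    have h1 := stageCost_gain hQ hR hAB hγ x
    have h2 := bellman_value hQ hR hAB hγ' x (S.gain γ (S.value γ) *ᵥ x)
    have h3 := hS.le_weight γ' hγ' (w x)
    have h4 : Δ * V' (y x) ≤ Δ * (C * V x) :=
      mul_le_mul_of_nonneg_left ((value_mono hQ hR hAB hγ'.1 hγ'.2 le_rfl (y x)).trans
        (hnext γ hγ x)) hΔ0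
    simp only [hV, hV', hy, hw, hΔ] at *
    linarith
  have hcontr : ∀ x, γ * V (y x) ≤ q * V x := fun x => hS.contraction γ hγ x
  have hw0 : ∀ x, 0 ≤ ρ * ‖w x‖ ^ 2 := fun x => by positivity
  -- Each use of `hgap` multiplies the crude bound `b / a` by `q` and adds `C * Δ`; the second term
  -- is the sum of the resulting geometric series.
  have hiter : ∀ k : ℕ, ∀ x, V' x - V x ≤ (q ^ k * (b / a) + C * Δ / (1 - q)) * V x := by
    intro k
    induction k with
    | zero =>
      intro x
      have h1 : V' x ≤ b / a * V x := by
        calc V' x ≤ b * ‖x‖ ^ 2 := hS.value_le γ' hγ' x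
          _ = b / a * (a * ‖x‖ ^ 2) := by field_simp
          _ ≤ b / a * V x := by gcongr; exact hS.le_value γ hγ x
      have h2 : 0 ≤ C * Δ / (1 - q) * V x := mul_nonneg (by positivity) (hV0 x)
      have := hV0 x
      simp only [pow_zero, one_mul, add_mul]
      linarith
    | succ k ih =>
      intro x
      have h1 : γ * (V' (y x) - V (y x)) ≤
          γ * ((q ^ k * (b / a) + C * Δ / (1 - q)) * V (y x)) :=
        mul_le_mul_of_nonneg_left (ih (y x)) hγ0
      have h2 : (q ^ k * (b / a) + C * Δ / (1 - q)) * (γ * V (y x)) ≤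
          (q ^ k * (b / a) + C * Δ / (1 - q)) * (q * V x) :=
        mul_le_mul_of_nonneg_left (hcontr x) (by positivity)
      have h3 : (q ^ (k + 1) * (b / a) + C * Δ / (1 - q)) * V x =
          (q ^ k * (b / a) + C * Δ / (1 - q)) * (q * V x) + C * Δ * V x := by
        field_simp
        ring
      rw [h3]
      linarith [hgap x, hw0 x]
  have hdiff : ∀ x, V' x - V x ≤ C * Δ / (1 - q) * V x := fun x => by
    have hlim : Tendsto (fun k : ℕ => (q ^ k * (b / a) + C * Δ / (1 - q)) * V x) atTop
        (𝓝 ((0 * (b / a) + C * Δ / (1 - q)) * V x)) :=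
      (((tendsto_pow_atTop_nhds_zero_of_lt_one hq0 hS.q_lt_one).mul_const _).add_const _).mul_const _
    rw [zero_mul, zero_add] at hlim
    exact ge_of_tendsto' hlim fun k => hiter k x
  have h1 : ρ * ‖w x‖ ^ 2 ≤ (C * Δ / (1 - q) + C * Δ) * V x := by
    have e1 := hgap x
    have e2 : γ * (V' (y x) - V (y x)) ≤ C * Δ / (1 - q) * V x := by
      calc γ * (V' (y x) - V (y x)) ≤ γ * (C * Δ / (1 - q) * V (y x)) :=
            mul_le_mul_of_nonneg_left (hdiff _) hγ0
        _ = C * Δ / (1 - q) * (γ * V (y x)) := by ring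
        _ ≤ C * Δ / (1 - q) * (q * V x) :=
            mul_le_mul_of_nonneg_left (hcontr x) (by positivity)
        _ ≤ C * Δ / (1 - q) * V x := by
            refine mul_le_mul_of_nonneg_left ?_ (by positivity)
            nlinarith [hV0 x, hS.q_lt_one]
    have := hVV' x
    rw [add_mul]
    linarith
  calc ‖w x‖ ^ 2 = (ρ * ‖w x‖ ^ 2) / ρ := by field_simp
    _ ≤ (C * Δ / (1 - q) + C * Δ) * (b * ‖x‖ ^ 2) / ρ := by
      refine div_le_div_of_nonneg_right ?_ hρ.le
      exact h1.trans (mul_le_mul_of_nonneg_left (hS.value_le γ hγ x) (by positivity))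
    _ = _ := by ring

end LQR

/-! ### Perturbations of a contraction and the accumulated squared output. -/

section Perturbation

variable {D X U : Type*} [NormedAddCommGroup D] [NormedSpace ℝ D] [AddCommGroup X] [Module ℝ X]
  [AddCommGroup U] [Module ℝ U]

/-- A family of maps `φ δ`, contracting up to the factor `s` when `δ` is small, together with
outputs `g δ` that are linear in `δ`. -/
structure PerturbationBounds (φ : D → X → X) (g : D → X → U) (N : Seminorm ℝ X)
    (NU : Seminorm ℝ U) (s b q c₁ c₂ : ℝ) : Prop where
  nonneg_s : 0 ≤ s
  nonneg_b : 0 ≤ b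
  nonneg_q : 0 ≤ q
  nonneg_c₁ : 0 ≤ c₁
  nonneg_c₂ : 0 ≤ c₂
  offset_le : s * b ≤ q * b
  step_le : ∀ δ x, s * N (φ δ x) ≤ q * N x + c₁ * ‖δ‖ * (N x + b)
  step_sub_le : ∀ δ δ' x y, s * N (φ δ x - φ δ' y) ≤
    q * N (x - y) + c₁ * ‖δ‖ * N (x - y) + c₁ * ‖δ - δ'‖ * (N y + b)
  output_le : ∀ δ x, NU (g δ x) ≤ c₂ * ‖δ‖ * (N x + b)
  output_sub_le : ∀ δ δ' x y, NU (g δ x - g δ' y) ≤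
    c₂ * ‖δ‖ * N (x - y) + c₂ * ‖δ - δ'‖ * (N y + b)
  output_smul : ∀ (σ : ℝ) δ x, g (σ • δ) x = σ • g δ x

/-- The accumulated squared output along the orbit of `x`. -/
noncomputable def excessCost (φ : D → X → X) (g : D → X → U) (NU : Seminorm ℝ U) (s : ℝ) (δ : D)
    (x : X) : ℝ :=
  ∑' t : ℕ, (s ^ t * NU (g δ ((φ δ)^[t] x))) ^ 2

namespace PerturbationBounds

variable {φ : D → X → X} {g : D → X → U} {N : Seminorm ℝ X} {NU : Seminorm ℝ U}
  {s b q c₁ c₂ r κ κ' : ℝ} {δ δ' : D}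

section

variable (h : PerturbationBounds φ g N NU s b q c₁ c₂) (hκ : q + c₁ * r ≤ κ)

include h hκ

/-- `N x + b` acts as the norm of the state extended by a constant coordinate. The factor `s` must
contract that coordinate too, which is `offset_le`. -/
theorem orbit_le (hδ : ‖δ‖ ≤ r) (x : X) (t : ℕ) :
    s ^ t * (N ((φ δ)^[t] x) + b) ≤ κ ^ t * (N x + b) := by
  have hs := h.nonneg_s
  have hb := h.nonneg_b
  have hc := h.nonneg_c₁
  have hκ0 : 0 ≤ κ := (add_nonneg h.nonneg_q (mul_nonneg hc ((norm_nonneg δ).trans hδ))).trans hκ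
  induction t with
  | zero => simp
  | succ t ih =>
    set z := (φ δ)^[t] x with hz
    have hz0 : 0 ≤ N z + b := add_nonneg (apply_nonneg _ _) hb
    rw [Function.iterate_succ_apply', ← hz]
    calc s ^ (t + 1) * (N (φ δ z) + b) = s ^ t * (s * N (φ δ z) + s * b) := by ring
      _ ≤ s ^ t * (q * N z + c₁ * ‖δ‖ * (N z + b) + q * b) := by
        refine mul_le_mul_of_nonneg_left (add_le_add (h.step_le δ z) h.offset_le) (by positivity)
      _ = s ^ t * ((q + c₁ * ‖δ‖) * (N z + b)) := by ring
      _ ≤ s ^ t * (κ * (N z + b)) := by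
        gcongr
        exact (by gcongr : q + c₁ * ‖δ‖ ≤ q + c₁ * r).trans hκ
      _ = κ * (s ^ t * (N z + b)) := by ring
      _ ≤ κ * (κ ^ t * (N x + b)) := by gcongr
      _ = _ := by ring

/-- A discrete Grönwall argument would produce tκᵗ⁻¹. Passing to the slightly larger rate `κ'`
absorbs the factor t at the price of 1/(κ' - κ). -/
theorem orbit_sub_le (hκκ' : κ < κ') (hδ : ‖δ‖ ≤ r) (hδ' : ‖δ'‖ ≤ r) (x : X) (t : ℕ) :
    s ^ t * N ((φ δ)^[t] x - (φ δ')^[t] x) ≤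
      c₁ / (κ' - κ) * ‖δ - δ'‖ * κ' ^ t * (N x + b) := by
  have hs := h.nonneg_s
  have hb := h.nonneg_b
  have hc := h.nonneg_c₁
  have hκ0 : 0 ≤ κ := (add_nonneg h.nonneg_q (mul_nonneg hc ((norm_nonneg δ).trans hδ))).trans hκ
  have hκ'0 : 0 < κ' := hκ0.trans_lt hκκ'
  have hd : 0 < κ' - κ := sub_pos.2 hκκ'
  have hx0 : 0 ≤ N x + b := add_nonneg (apply_nonneg _ _) hb
  induction t with
  | zero =>
    simp only [pow_zero, Function.iterate_zero, id, sub_self, map_zero, mul_zero]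
    positivity
  | succ t ih =>
    have hy := h.orbit_le hκ hδ' x t
    set z := (φ δ)^[t] x with hz
    set y := (φ δ')^[t] x with hy'
    rw [Function.iterate_succ_apply', Function.iterate_succ_apply', ← hz, ← hy']
    have hzy : 0 ≤ N (z - y) := apply_nonneg _ _
    have hy2 : s ^ t * (N y + b) ≤ κ' ^ t * (N x + b) := hy.trans (by gcongr)
    calc s ^ (t + 1) * N (φ δ z - φ δ' y) = s ^ t * (s * N (φ δ z - φ δ' y)) := by ring
      _ ≤ s ^ t * (q * N (z - y) + c₁ * ‖δ‖ * N (z - y) + c₁ * ‖δ - δ'‖ * (N y + b)) := by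
        gcongr
        exact h.step_sub_le δ δ' z y
      _ = (q + c₁ * ‖δ‖) * (s ^ t * N (z - y)) + c₁ * ‖δ - δ'‖ * (s ^ t * (N y + b)) := by ring
      _ ≤ κ * (c₁ / (κ' - κ) * ‖δ - δ'‖ * κ' ^ t * (N x + b)) +
          c₁ * ‖δ - δ'‖ * (κ' ^ t * (N x + b)) := by
        gcongr
        exact (by gcongr : q + c₁ * ‖δ‖ ≤ q + c₁ * r).trans hκ
      _ = _ := by field_simp; ring

theorem output_orbit_le (hδ : ‖δ‖ ≤ r) (x : X) (t : ℕ) :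
    s ^ t * NU (g δ ((φ δ)^[t] x)) ≤ c₂ * ‖δ‖ * κ ^ t * (N x + b) := by
  have hs := h.nonneg_s
  have hc := h.nonneg_c₂
  calc s ^ t * NU (g δ ((φ δ)^[t] x)) ≤ s ^ t * (c₂ * ‖δ‖ * (N ((φ δ)^[t] x) + b)) := by
        gcongr
        exact h.output_le _ _
    _ = c₂ * ‖δ‖ * (s ^ t * (N ((φ δ)^[t] x) + b)) := by ring
    _ ≤ c₂ * ‖δ‖ * (κ ^ t * (N x + b)) :=
        mul_le_mul_of_nonneg_left (h.orbit_le hκ hδ x t) (by positivity)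
    _ = _ := by ring

theorem output_orbit_le' (hκκ' : κ < κ') (hδ : ‖δ‖ ≤ r) (x : X) (t : ℕ) :
    s ^ t * NU (g δ ((φ δ)^[t] x)) ≤ c₂ * ‖δ‖ * κ' ^ t * (N x + b) := by
  have hb := h.nonneg_b
  have hc := h.nonneg_c₂
  have hκ0 : 0 ≤ κ := (add_nonneg h.nonneg_q (mul_nonneg h.nonneg_c₁
    ((norm_nonneg δ).trans hδ))).trans hκ
  have hx0 : 0 ≤ N x + b := add_nonneg (apply_nonneg _ _) hb
  exact (h.output_orbit_le hκ hδ x t).trans (by gcongr)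

theorem output_orbit_sub_le (hκκ' : κ < κ') (hδ : ‖δ‖ ≤ r) (hδ' : ‖δ'‖ ≤ r) (x : X) (t : ℕ) :
    s ^ t * NU (g δ ((φ δ)^[t] x) - g δ' ((φ δ')^[t] x)) ≤
      c₂ * (r * (c₁ / (κ' - κ)) + 1) * ‖δ - δ'‖ * κ' ^ t * (N x + b) := by
  have hs := h.nonneg_s
  have hc := h.nonneg_c₂
  have hc₁ := h.nonneg_c₁
  have hb := h.nonneg_b
  have hr : 0 ≤ r := (norm_nonneg δ).trans hδ
  have hd : 0 < κ' - κ := sub_pos.2 hκκ'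
  have hκ0 : 0 ≤ κ := (add_nonneg h.nonneg_q (mul_nonneg hc₁ hr)).trans hκ
  have hx0 : 0 ≤ N x + b := add_nonneg (apply_nonneg _ _) hb
  have h1 := h.orbit_sub_le hκ hκκ' hδ hδ' x t
  have h2 : s ^ t * (N ((φ δ')^[t] x) + b) ≤ κ' ^ t * (N x + b) :=
    (h.orbit_le hκ hδ' x t).trans (by gcongr)
  have h3 : 0 ≤ s ^ t * N ((φ δ)^[t] x - (φ δ')^[t] x) :=
    mul_nonneg (by positivity) (apply_nonneg _ _)
  calc s ^ t * NU (g δ ((φ δ)^[t] x) - g δ' ((φ δ')^[t] x))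
      ≤ s ^ t * (c₂ * ‖δ‖ * N ((φ δ)^[t] x - (φ δ')^[t] x) +
          c₂ * ‖δ - δ'‖ * (N ((φ δ')^[t] x) + b)) := by
        gcongr
        exact h.output_sub_le _ _ _ _
    _ = c₂ * ‖δ‖ * (s ^ t * N ((φ δ)^[t] x - (φ δ')^[t] x)) +
          c₂ * ‖δ - δ'‖ * (s ^ t * (N ((φ δ')^[t] x) + b)) := by ring
    _ ≤ c₂ * r * (c₁ / (κ' - κ) * ‖δ - δ'‖ * κ' ^ t * (N x + b)) +
          c₂ * ‖δ - δ'‖ * (κ' ^ t * (N x + b)) :=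
        add_le_add (mul_le_mul (by gcongr) h1 h3 (by positivity))
          (mul_le_mul_of_nonneg_left h2 (by positivity))
    _ = _ := by ring

variable (hκκ' : κ < κ') (hκ' : κ' < 1)

include hκκ' hκ'

theorem hasSum_sq_geometric (hr : 0 ≤ r) (a : ℝ) :
    HasSum (fun t : ℕ => a * (κ' ^ t) ^ 2) (a / (1 - κ' ^ 2)) := by
  have hκ0 : 0 ≤ κ := (add_nonneg h.nonneg_q (mul_nonneg h.nonneg_c₁ hr)).trans hκ
  have h1 : κ' ^ 2 < 1 := by
    have : 0 < κ' := hκ0.trans_lt hκκ'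
    nlinarith
  have := (hasSum_geometric_of_lt_one (sq_nonneg κ') h1).mul_left a
  simpa only [← pow_mul, mul_comm 2, div_eq_mul_inv] using this

theorem summable_excess (hδ : ‖δ‖ ≤ r) (x : X) :
    Summable fun t : ℕ => (s ^ t * NU (g δ ((φ δ)^[t] x))) ^ 2 := by
  have hs := h.nonneg_s
  refine Summable.of_nonneg_of_le (fun t => sq_nonneg _) (fun t => ?_)
    (h.hasSum_sq_geometric hκ hκκ' hκ' ((norm_nonneg δ).trans hδ)
      ((c₂ * ‖δ‖ * (N x + b)) ^ 2)).summable
  calc (s ^ t * NU (g δ ((φ δ)^[t] x))) ^ 2 ≤ (c₂ * ‖δ‖ * κ' ^ t * (N x + b)) ^ 2 :=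
        pow_le_pow_left₀ (mul_nonneg (by positivity) (apply_nonneg _ _))
          (h.output_orbit_le' hκ hκκ' hδ x t) 2
    _ = _ := by ring

theorem excessCost_le (hδ : ‖δ‖ ≤ r) (x : X) :
    excessCost φ g NU s δ x ≤ (c₂ * ‖δ‖) ^ 2 / (1 - κ' ^ 2) * (N x + b) ^ 2 := by
  have hs := h.nonneg_s
  have hsum := h.hasSum_sq_geometric hκ hκκ' hκ' ((norm_nonneg δ).trans hδ)
    ((c₂ * ‖δ‖ * (N x + b)) ^ 2)
  refine ((h.summable_excess hκ hκκ' hκ' hδ x).tsum_le_tsum (fun t => ?_) hsum.summable).trans_eq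
    (hsum.tsum_eq.trans (by ring))
  calc (s ^ t * NU (g δ ((φ δ)^[t] x))) ^ 2 ≤ (c₂ * ‖δ‖ * κ' ^ t * (N x + b)) ^ 2 :=
        pow_le_pow_left₀ (mul_nonneg (by positivity) (apply_nonneg _ _))
          (h.output_orbit_le' hκ hκκ' hδ x t) 2
    _ = _ := by ring

/-- The term at time 0 alone does not feel the dynamics and already gives quadratic growth in δ. -/
theorem sq_output_le_excessCost (hδ : ‖δ‖ ≤ r) (x : X) :
    NU (g δ x) ^ 2 ≤ excessCost φ g NU s δ x := by
  have := (h.summable_excess hκ hκκ' hκ' hδ x).le_tsum 0 fun t _ => sq_nonneg _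
  simpa [excessCost] using this

theorem abs_excessCost_sub_le (hδ : ‖δ‖ ≤ r) (hδ' : ‖δ'‖ ≤ r) (x : X) :
    |excessCost φ g NU s δ x - excessCost φ g NU s δ' x| ≤
      c₂ * (r * (c₁ / (κ' - κ)) + 1) * (2 * c₂ * r) / (1 - κ' ^ 2) * ‖δ - δ'‖ * (N x + b) ^ 2 := by
  have hs := h.nonneg_s
  have hc := h.nonneg_c₂
  have hc₁ := h.nonneg_c₁
  have hb := h.nonneg_b
  have hr : 0 ≤ r := (norm_nonneg δ).trans hδ
  have hd : 0 < κ' - κ := sub_pos.2 hκκ'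
  have hκ0 : 0 ≤ κ := (add_nonneg h.nonneg_q (mul_nonneg hc₁ hr)).trans hκ
  have hκ'0 : 0 < κ' := hκ0.trans_lt hκκ'
  have hx0 : 0 ≤ N x + b := add_nonneg (apply_nonneg _ _) hb
  have hsum := h.hasSum_sq_geometric hκ hκκ' hκ' hr
    (c₂ * (r * (c₁ / (κ' - κ)) + 1) * (2 * c₂ * r) * ‖δ - δ'‖ * (N x + b) ^ 2)
  have hS := (h.summable_excess hκ hκκ' hκ' hδ x).hasSum.sub
    (h.summable_excess hκ hκκ' hκ' hδ' x).hasSum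
  unfold excessCost
  rw [← hS.tsum_eq, ← Real.norm_eq_abs]
  refine (tsum_of_norm_bounded hsum fun t => ?_).trans_eq (by ring)
  have h1 := h.output_orbit_sub_le hκ hκκ' hδ hδ' x t
  have h2 := h.output_orbit_le' hκ hκκ' hδ x t
  have h3 := h.output_orbit_le' hκ hκκ' hδ' x t
  set u := g δ ((φ δ)^[t] x)
  set v := g δ' ((φ δ')^[t] x)
  have h4 : |NU u - NU v| ≤ NU (u - v) := abs_sub_map_le_sub NU u v
  have hu : 0 ≤ NU u := apply_nonneg _ _
  have hv : 0 ≤ NU v := apply_nonneg _ _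
  rw [Real.norm_eq_abs, sq_sub_sq, abs_mul, abs_of_nonneg (by positivity), ← mul_sub, abs_mul,
    abs_of_nonneg (by positivity : (0 : ℝ) ≤ s ^ t)]
  calc (s ^ t * NU u + s ^ t * NU v) * (s ^ t * |NU u - NU v|)
      ≤ (c₂ * r * κ' ^ t * (N x + b) + c₂ * r * κ' ^ t * (N x + b)) *
        (c₂ * (r * (c₁ / (κ' - κ)) + 1) * ‖δ - δ'‖ * κ' ^ t * (N x + b)) := by
        refine mul_le_mul (add_le_add (h2.trans (by gcongr)) (h3.trans (by gcongr)))
          (le_trans (by gcongr) h1) (by positivity) (by positivity)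
    _ = _ := by ring

/-- On a fixed orbit the factor (1-σ)² would be exact, because outputs are linear in δ. The orbit
moves by O(σ|δ|), which changes an output by O(σ|δ|²). Against outputs of size O(|δ|) the linear
error in σ is thus cubic in |δ|. -/
theorem excessCost_ray_le (hδ : ‖δ‖ ≤ r) {σ : ℝ} (hσ0 : 0 ≤ σ) (hσ1 : σ ≤ 1) (x : X) :
    excessCost φ g NU s (δ - σ • δ) x ≤ (1 - σ) ^ 2 * excessCost φ g NU s δ x +
      (σ * (2 * c₂ ^ 2 * (c₁ / (κ' - κ)) * ‖δ‖ ^ 3 / (1 - κ' ^ 2)) +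
        σ ^ 2 * ((c₂ * (c₁ / (κ' - κ)) * ‖δ‖ ^ 2) ^ 2 / (1 - κ' ^ 2))) * (N x + b) ^ 2 := by
  have hs := h.nonneg_s
  have hc := h.nonneg_c₂
  have hc₁ := h.nonneg_c₁
  have hb := h.nonneg_b
  have hr : 0 ≤ r := (norm_nonneg δ).trans hδ
  have hd : 0 < κ' - κ := sub_pos.2 hκκ'
  have hκ0 : 0 ≤ κ := (add_nonneg h.nonneg_q (mul_nonneg hc₁ hr)).trans hκ
  have hκ'0 : 0 < κ' := hκ0.trans_lt hκκ'
  have hx0 : 0 ≤ N x + b := add_nonneg (apply_nonneg _ _) hb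
  have hσ' : 0 ≤ 1 - σ := sub_nonneg.2 hσ1
  have hray : δ - σ • δ = (1 - σ) • δ := by rw [sub_smul, one_smul]
  have hδ' : ‖δ - σ • δ‖ ≤ r := by
    rw [hray, norm_smul, Real.norm_of_nonneg hσ']
    exact (mul_le_of_le_one_left (norm_nonneg _) (by linarith)).trans hδ
  have hdiff : ‖δ - (δ - σ • δ)‖ = σ * ‖δ‖ := by
    rw [sub_sub_cancel, norm_smul, Real.norm_of_nonneg hσ0]
  set C := c₁ / (κ' - κ) with hC
  have hC0 : 0 ≤ C := by positivity
  set Y := N x + b with hY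
  have hsumW := (h.summable_excess hκ hκκ' hκ' hδ x).hasSum.mul_left ((1 - σ) ^ 2)
  have hsumE := h.hasSum_sq_geometric hκ hκκ' hκ' hr
    ((σ * (2 * c₂ ^ 2 * C * ‖δ‖ ^ 3) + σ ^ 2 * (c₂ * C * ‖δ‖ ^ 2) ^ 2) * Y ^ 2)
  refine (hasSum_le (fun t => ?_) (h.summable_excess hκ hκκ' hκ' hδ' x).hasSum
    (hsumW.add hsumE)).trans_eq (by rw [excessCost]; ring)
  have h1 := h.output_orbit_le' hκ hκκ' hδ x t
  have h2 := h.orbit_sub_le hκ hκκ' hδ hδ' x t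
  rw [hdiff] at h2
  set z := (φ δ)^[t] x
  set y := (φ (δ - σ • δ))^[t] x
  have h3 : NU (g (δ - σ • δ) y) ≤ (1 - σ) * (NU (g δ z) + c₂ * ‖δ‖ * N (z - y)) := by
    rw [hray, h.output_smul, map_smul_eq_mul, Real.norm_of_nonneg hσ']
    refine mul_le_mul_of_nonneg_left ?_ hσ'
    have h4 := h.output_sub_le δ δ z y
    rw [sub_self, norm_zero, mul_zero, zero_mul, add_zero] at h4
    have h5 : NU (g δ y) ≤ NU (g δ z) + NU (g δ z - g δ y) := by
      have := map_sub_le_add NU (g δ z) (g δ z - g δ y)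
      simpa using this
    linarith
  have hz0 : 0 ≤ NU (g δ z) := apply_nonneg _ _
  set β := c₂ * ‖δ‖ * (C * (σ * ‖δ‖) * κ' ^ t * Y) with hβ
  have hβ0 : 0 ≤ β := by positivity
  have h6 : s ^ t * NU (g (δ - σ • δ) y) ≤ (1 - σ) * (s ^ t * NU (g δ z) + β) := by
    calc s ^ t * NU (g (δ - σ • δ) y)
        ≤ s ^ t * ((1 - σ) * (NU (g δ z) + c₂ * ‖δ‖ * N (z - y))) := by gcongr
      _ = (1 - σ) * (s ^ t * NU (g δ z) + c₂ * ‖δ‖ * (s ^ t * N (z - y))) := by ring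
      _ ≤ _ := by rw [hβ]; gcongr
  calc (s ^ t * NU (g (δ - σ • δ) y)) ^ 2 ≤ ((1 - σ) * (s ^ t * NU (g δ z) + β)) ^ 2 := by gcongr
    _ = (1 - σ) ^ 2 * (s ^ t * NU (g δ z)) ^ 2 +
        (1 - σ) ^ 2 * (2 * (s ^ t * NU (g δ z)) * β + β ^ 2) := by ring
    _ ≤ (1 - σ) ^ 2 * (s ^ t * NU (g δ z)) ^ 2 +
        1 * (2 * (c₂ * ‖δ‖ * κ' ^ t * Y) * β + β ^ 2) := by
      gcongr
      exact pow_le_one₀ hσ' (by linarith)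
    _ = _ := by rw [hβ]; ring

end

end PerturbationBounds

end Perturbation

/-! ### Pathwise cost formula and estimates for linearly parametrized policies. -/

namespace LQR

variable {n m d : ℕ} {S : LQR n m} {γ : ℝ}

section PathwiseCost

variable (hQ : S.Q.PosDef) (hR : S.R.PosDef) (hAB : S.Controllable)

include hQ hR hAB

theorem sum_stageCost_add (hγ : γ ∈ Icc (0 : ℝ) 1) (π : (Fin n → ℝ) → (Fin m → ℝ))
    (x : Fin n → ℝ) (T : ℕ) :
    ∑ t ∈ Finset.range T, γ ^ t * S.stageCost (S.traj π x t) (π (S.traj π x t)) +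
      γ ^ T * (S.traj π x T ⬝ᵥ S.value γ *ᵥ S.traj π x T) =
    x ⬝ᵥ S.value γ *ᵥ x + ∑ t ∈ Finset.range T, γ ^ t *
      ((π (S.traj π x t) - S.gain γ (S.value γ) *ᵥ S.traj π x t) ⬝ᵥ
        S.actionWeight γ (S.value γ) *ᵥ
          (π (S.traj π x t) - S.gain γ (S.value γ) *ᵥ S.traj π x t)) := by
  induction T with
  | zero => simp [traj]
  | succ T ih =>
    have h := bellman_value hQ hR hAB hγ (S.traj π x T) (π (S.traj π x T))
    have hnext : S.next (S.traj π x T) (π (S.traj π x T)) = S.traj π x (T + 1) := rfl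
    rw [hnext] at h
    rw [Finset.sum_range_succ, Finset.sum_range_succ, ← add_assoc, ← ih, pow_succ]
    linear_combination γ ^ T * h

theorem tsum_stageCost_eq (hγ : γ ∈ Icc (0 : ℝ) 1) (π : (Fin n → ℝ) → (Fin m → ℝ))
    (x : Fin n → ℝ) {w : ℝ}
    (hw : HasSum (fun t => γ ^ t *
      ((π (S.traj π x t) - S.gain γ (S.value γ) *ᵥ S.traj π x t) ⬝ᵥ
        S.actionWeight γ (S.value γ) *ᵥ
          (π (S.traj π x t) - S.gain γ (S.value γ) *ᵥ S.traj π x t))) w)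
    (h0 : Tendsto (fun T => γ ^ T * (S.traj π x T ⬝ᵥ S.value γ *ᵥ S.traj π x T)) atTop (𝓝 0)) :
    ∑' t : ℕ, ENNReal.ofReal (γ ^ t * S.stageCost (S.traj π x t) (π (S.traj π x t))) =
      ENNReal.ofReal (x ⬝ᵥ S.value γ *ᵥ x + w) := by
  have hnn : ∀ t, 0 ≤ γ ^ t * S.stageCost (S.traj π x t) (π (S.traj π x t)) := fun t =>
    mul_nonneg (pow_nonneg hγ.1 t) (stageCost_nonneg hQ hR _ _)
  have hsum : HasSum (fun t => γ ^ t * S.stageCost (S.traj π x t) (π (S.traj π x t)))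
      (x ⬝ᵥ S.value γ *ᵥ x + w) := by
    rw [hasSum_iff_tendsto_nat_of_nonneg hnn]
    have h1 := (hw.tendsto_sum_nat.const_add (x ⬝ᵥ S.value γ *ᵥ x)).sub h0
    rw [sub_zero] at h1
    refine h1.congr fun T => ?_
    rw [← sum_stageCost_add hQ hR hAB hγ, add_sub_cancel_right]
  rw [← hsum.tsum_eq, ENNReal.ofReal_tsum_of_nonneg hnn hsum.summable]

/-- Without discount the boundary term of the telescoped identity need not vanish by itself. Finite
cost forces stage costs to 0, however, and these dominate the value because `Q` is positive
definite. -/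
theorem value_one_le_tsum_stageCost (π : (Fin n → ℝ) → (Fin m → ℝ)) (x : Fin n → ℝ) :
    ENNReal.ofReal (x ⬝ᵥ S.value 1 *ᵥ x) ≤
      ∑' t : ℕ, ENNReal.ofReal (1 ^ t * S.stageCost (S.traj π x t) (π (S.traj π x t))) := by
  have h1 : (1 : ℝ) ∈ Icc (0 : ℝ) 1 := ⟨zero_le_one, le_rfl⟩
  by_cases htop : ∑' t : ℕ, ENNReal.ofReal
      (1 ^ t * S.stageCost (S.traj π x t) (π (S.traj π x t))) = ∞
  · rw [htop]
    exact le_top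
  set z := S.traj π x
  have hnn : ∀ t, 0 ≤ 1 ^ t * S.stageCost (z t) (π (z t)) := fun t =>
    mul_nonneg (by simp) (stageCost_nonneg hQ hR _ _)
  have hsummable : Summable fun t => 1 ^ t * S.stageCost (z t) (π (z t)) := by
    refine (ENNReal.summable_toReal htop).congr fun t => ENNReal.toReal_ofReal (hnn t)
  rw [← ENNReal.ofReal_tsum_of_nonneg hnn hsummable]
  refine ENNReal.ofReal_le_ofReal ?_
  obtain ⟨a, ha, hQa⟩ := hQ.exists_le_dotProduct_mulVec
  obtain ⟨b, hb, hVb⟩ := (S.value 1).exists_dotProduct_mulVec_le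
  have hV0 : ∀ y : Fin n → ℝ, 0 ≤ y ⬝ᵥ S.value 1 *ᵥ y := fun y => by
    simpa using (posSemidef_value hQ hR hAB h1).dotProduct_mulVec_nonneg y
  have hlim : Tendsto (fun T => 1 ^ T * (z T ⬝ᵥ S.value 1 *ᵥ z T)) atTop (𝓝 0) := by
    refine squeeze_zero (fun T => mul_nonneg (by simp) (hV0 _))
      (g := fun T => b / a * (1 ^ T * S.stageCost (z T) (π (z T)))) (fun T => ?_) ?_
    · have h2 : a * ‖z T‖ ^ 2 ≤ S.stageCost (z T) (π (z T)) := by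
        have := hR.posSemidef.dotProduct_mulVec_nonneg (π (z T))
        rw [star_trivial] at this
        unfold stageCost
        linarith [hQa (z T)]
      simp only [one_pow, one_mul]
      calc z T ⬝ᵥ S.value 1 *ᵥ z T ≤ b * ‖z T‖ ^ 2 := hVb _
        _ = b / a * (a * ‖z T‖ ^ 2) := by field_simp
        _ ≤ _ := by gcongr
    · simpa using hsummable.tendsto_atTop_zero.const_mul (b / a)
  have hpart := hsummable.hasSum.tendsto_sum_nat.add hlim
  rw [add_zero] at hpart
  refine ge_of_tendsto' hpart fun T => ?_
  rw [sum_stageCost_add hQ hR hAB h1 π x T]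
  refine le_add_of_nonneg_right (Finset.sum_nonneg fun t _ => mul_nonneg (by simp) ?_)
  have := (posDef_actionWeight (S := S) hR h1.1
    (posSemidef_value hQ hR hAB h1)).posSemidef.dotProduct_mulVec_nonneg
    (π (z t) - S.gain 1 (S.value 1) *ᵥ z t)
  rwa [star_trivial] at this

end PathwiseCost

section LinearParametrization

variable {f : Fin d → (Fin n → ℝ) → (Fin m → ℝ)}

theorem _root_.linPolicy_sub (θ δ : EuclideanSpace ℝ (Fin d)) (x : Fin n → ℝ) :
    linPolicy f (θ - δ) x = linPolicy f θ x - linPolicy f δ x := by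
  simp [linPolicy, sub_smul, Finset.sum_sub_distrib]

theorem _root_.linPolicy_smul (σ : ℝ) (θ : EuclideanSpace ℝ (Fin d)) (x : Fin n → ℝ) :
    linPolicy f (σ • θ) x = σ • linPolicy f θ x := by
  simp [linPolicy, mul_smul, Finset.smul_sum]

theorem _root_.continuous_linPolicy (hf : ∀ k, Continuous (f k)) (θ : EuclideanSpace ℝ (Fin d)) :
    Continuous (linPolicy f θ) := by
  unfold linPolicy
  fun_prop

/-- A Lipschitz family of features grows linearly; the offset `b` may be zero if all features
vanish at the origin. -/
theorem _root_.exists_linPolicy_bound (hLip : ∀ k, ∃ L : ℝ≥0, LipschitzWith L (f k)) {b : ℝ}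
    (hb : b = 1 ∨ b = 0 ∧ ∀ k, f k 0 = 0) : ∃ c, 0 ≤ c ∧
      (∀ δ x, ‖linPolicy f δ x‖ ≤ c * ‖δ‖ * (‖x‖ + b)) ∧
      ∀ δ x y, ‖linPolicy f δ x - linPolicy f δ y‖ ≤ c * ‖δ‖ * ‖x - y‖ := by
  choose L hL using hLip
  have hsub : ∀ k x y, ‖f k x - f k y‖ ≤ L k * ‖x - y‖ := fun k x y => by
    simpa [dist_eq_norm] using (hL k).dist_le_mul x y
  have hδ : ∀ (δ : EuclideanSpace ℝ (Fin d)) k, |δ k| ≤ ‖δ‖ := fun δ k => by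
    simpa using PiLp.norm_apply_le δ k
  refine ⟨∑ k, (L k + ‖f k 0‖), by positivity, fun δ x => ?_, fun δ x y => ?_⟩
  · rw [Finset.sum_mul, Finset.sum_mul]
    refine norm_sum_le_of_le _ fun k _ => ?_
    rw [norm_smul, Real.norm_eq_abs, mul_comm _ ‖δ‖, mul_assoc]
    refine mul_le_mul (hδ δ k) ?_ (norm_nonneg _) (norm_nonneg _)
    have h1 : ‖f k x‖ ≤ L k * ‖x‖ + ‖f k 0‖ := by
      have := hsub k x 0
      rw [sub_zero] at this
      linarith [norm_sub_norm_le (f k x) (f k 0)]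
    have h2 : 0 ≤ L k * ‖x‖ := by positivity
    have h3 : 0 ≤ ‖f k 0‖ * ‖x‖ := by positivity
    rcases hb with rfl | ⟨rfl, h0⟩
    · nlinarith [norm_nonneg (f k 0), (L k).2]
    · rw [h0 k, norm_zero] at h1 ⊢
      linarith
  · have : linPolicy f δ x - linPolicy f δ y = ∑ k, δ k • (f k x - f k y) := by
      simp [linPolicy, smul_sub, Finset.sum_sub_distrib]
    rw [this, Finset.sum_mul, Finset.sum_mul]
    refine norm_sum_le_of_le _ fun k _ => ?_
    rw [norm_smul, Real.norm_eq_abs, mul_comm _ ‖δ‖, mul_assoc]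
    refine mul_le_mul (hδ δ k) ((hsub k x y).trans ?_) (norm_nonneg _) (norm_nonneg _)
    gcongr
    exact le_add_of_nonneg_right (norm_nonneg _)

variable (S f) in
/-- The closed loop of the optimal gain perturbed by `linPolicy f δ`. -/
noncomputable def perturbedStep (γ : ℝ) (δ : EuclideanSpace ℝ (Fin d)) (x : Fin n → ℝ) :
    Fin n → ℝ :=
  S.next x (S.gain γ (S.value γ) *ᵥ x + linPolicy f δ x)

theorem traj_eq_iterate {θ p : EuclideanSpace ℝ (Fin d)}
    (hp : ∀ x, linPolicy f p x = S.gain γ (S.value γ) *ᵥ x) (x : Fin n → ℝ) (t : ℕ) :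
    S.traj (linPolicy f θ) x t = (S.perturbedStep f γ (θ - p))^[t] x := by
  induction t with
  | zero => rfl
  | succ t ih =>
    rw [Function.iterate_succ_apply', ← ih, traj, perturbedStep, next, linPolicy_sub, hp,
      add_sub_cancel]

theorem continuous_perturbedStep (hf : ∀ k, Continuous (f k)) (δ : EuclideanSpace ℝ (Fin d)) :
    Continuous (S.perturbedStep f γ δ) := by
  have := continuous_linPolicy hf δ
  unfold perturbedStep next
  fun_prop

/-- Seminorms of the value matrix and of the action weight. -/
structure IsValueSeminorm (S : LQR n m) (γ : ℝ) (N : Seminorm ℝ (Fin n → ℝ))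
    (NU : Seminorm ℝ (Fin m → ℝ)) : Prop where
  sq_state : ∀ x, N x ^ 2 = x ⬝ᵥ S.value γ *ᵥ x
  sq_action : ∀ u, NU u ^ 2 = u ⬝ᵥ S.actionWeight γ (S.value γ) *ᵥ u

theorem exists_isValueSeminorm (hQ : S.Q.PosDef) (hR : S.R.PosDef) (hAB : S.Controllable)
    (hγ : γ ∈ Icc (0 : ℝ) 1) : ∃ N NU, S.IsValueSeminorm γ N NU := by
  have hV := posSemidef_value hQ hR hAB hγ
  obtain ⟨N, hN⟩ := hV.exists_seminorm
  obtain ⟨NU, hNU⟩ := (posDef_actionWeight (S := S) hR hγ.1 hV).posSemidef.exists_seminorm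
  exact ⟨N, NU, hN, hNU⟩

theorem _root_.le_sqrt_mul_of_sq_le {a b y : ℝ} (hy : 0 ≤ y) (hb : 0 ≤ b) (h : a ^ 2 ≤ b * y ^ 2) :
    a ≤ √b * y := by
  refine le_of_sq_le_sq ?_ (by positivity)
  rwa [mul_pow, Real.sq_sqrt hb]

variable {N : Seminorm ℝ (Fin n → ℝ)} {NU : Seminorm ℝ (Fin m → ℝ)} {a b ρ c q : ℝ}

theorem IsValueSeminorm.le_state (hN : S.IsValueSeminorm γ N NU) (hS : S.UniformBounds a b ρ c q)
    (hγ : γ ∈ Icc (0 : ℝ) 1) (x : Fin n → ℝ) : ‖x‖ ≤ (√a)⁻¹ * N x := by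
  have ha := hS.pos_a
  have h := hS.le_value γ hγ x
  rw [← hN.sq_state] at h
  rw [← Real.sqrt_inv]
  refine le_sqrt_mul_of_sq_le (apply_nonneg _ _) (by positivity) ?_
  rw [inv_mul_eq_div, le_div_iff₀ ha]
  linarith

theorem IsValueSeminorm.state_le (hN : S.IsValueSeminorm γ N NU) (hS : S.UniformBounds a b ρ c q)
    (hγ : γ ∈ Icc (0 : ℝ) 1) (x : Fin n → ℝ) : N x ≤ √b * ‖x‖ :=
  le_sqrt_mul_of_sq_le (norm_nonneg _) hS.pos_b.le ((hN.sq_state x).trans_le (hS.value_le γ hγ x))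

theorem IsValueSeminorm.action_le (hN : S.IsValueSeminorm γ N NU) (hS : S.UniformBounds a b ρ c q)
    (hγ : γ ∈ Icc (0 : ℝ) 1) (u : Fin m → ℝ) : NU u ≤ √c * ‖u‖ :=
  le_sqrt_mul_of_sq_le (norm_nonneg _) hS.nonneg_c ((hN.sq_action u).trans_le (hS.weight_le γ hγ u))

theorem IsValueSeminorm.contraction (hN : S.IsValueSeminorm γ N NU)
    (hS : S.UniformBounds a b ρ c q) (hγ : γ ∈ Icc (0 : ℝ) 1) (x : Fin n → ℝ) :
    √γ * N (S.next x (S.gain γ (S.value γ) *ᵥ x)) ≤ √q * N x := by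
  refine le_sqrt_mul_of_sq_le (apply_nonneg _ _) hS.nonneg_q ?_
  rw [mul_pow, Real.sq_sqrt hγ.1, hN.sq_state, hN.sq_state]
  exact hS.contraction γ hγ x

/-- The action enters the next state, which is weighted by √γ; hence the factor √γ in the first
constant. It is what removes the restriction on the radius at γ = 0. -/
theorem IsValueSeminorm.perturbationBounds (hN : S.IsValueSeminorm γ N NU)
    (hS : S.UniformBounds a b ρ c q) (hγ : γ ∈ Icc (0 : ℝ) 1) {o q₀ cf β : ℝ} (ho : 0 ≤ o)
    (hqq₀ : √q ≤ q₀) (ho' : √γ * o ≤ q₀ * o) (hcf : 0 ≤ cf)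
    (hf : ∀ δ x, ‖linPolicy f δ x‖ ≤ cf * ‖δ‖ * (‖x‖ + o))
    (hf' : ∀ δ x y, ‖linPolicy f δ x - linPolicy f δ y‖ ≤ cf * ‖δ‖ * ‖x - y‖)
    (hβ : 0 ≤ β) (hB : ∀ u, ‖S.B *ᵥ u‖ ≤ β * ‖u‖) :
    PerturbationBounds (S.perturbedStep f γ) (linPolicy f) N NU √γ o q₀
      (√γ * (√b * β * (cf * ((√a)⁻¹ + 1)))) (√c * (cf * ((√a)⁻¹ + 1))) := by
  set e := (√a)⁻¹ + 1 with he
  have ha0 : 0 ≤ (√a)⁻¹ := by positivity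
  have he0 : 0 ≤ e := by positivity
  have hg : ∀ δ x, ‖linPolicy f δ x‖ ≤ cf * e * ‖δ‖ * (N x + o) := fun δ x => by
    have h0 : 0 ≤ N x := apply_nonneg _ _
    have h1 : ‖x‖ + o ≤ e * (N x + o) := by
      have := hN.le_state hS hγ x
      nlinarith
    calc ‖linPolicy f δ x‖ ≤ cf * ‖δ‖ * (‖x‖ + o) := hf δ x
      _ ≤ cf * ‖δ‖ * (e * (N x + o)) := by gcongr
      _ = _ := by ring
  have hg' : ∀ δ x y, ‖linPolicy f δ x - linPolicy f δ y‖ ≤ cf * e * ‖δ‖ * N (x - y) :=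
    fun δ x y => by
      have h0 : 0 ≤ N (x - y) := apply_nonneg _ _
      have h1 : ‖x - y‖ ≤ e * N (x - y) := by
        have := hN.le_state hS hγ (x - y)
        nlinarith
      calc ‖linPolicy f δ x - linPolicy f δ y‖ ≤ cf * ‖δ‖ * ‖x - y‖ := hf' δ x y
        _ ≤ cf * ‖δ‖ * (e * N (x - y)) := by gcongr
        _ = _ := by ring
  have hg'' : ∀ δ δ' x y, ‖linPolicy f δ x - linPolicy f δ' y‖ ≤
      cf * e * ‖δ‖ * N (x - y) + cf * e * ‖δ - δ'‖ * (N y + o) := fun δ δ' x y => by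
    have : linPolicy f δ x - linPolicy f δ' y =
        (linPolicy f δ x - linPolicy f δ y) + linPolicy f (δ - δ') y := by
      rw [linPolicy_sub]
      abel
    rw [this]
    exact norm_add_le_of_le (hg' δ x y) (hg _ y)
  have hNB : ∀ u, N (S.B *ᵥ u) ≤ √b * β * ‖u‖ := fun u => by
    calc N (S.B *ᵥ u) ≤ √b * ‖S.B *ᵥ u‖ := hN.state_le hS hγ _
      _ ≤ √b * (β * ‖u‖) := by gcongr; exact hB u
      _ = _ := by ring
  refine ⟨Real.sqrt_nonneg _, ho, (Real.sqrt_nonneg _).trans hqq₀, by positivity, by positivity, ho',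
    fun δ x => ?_, fun δ δ' x y => ?_, fun δ x => ?_, fun δ δ' x y => ?_, linPolicy_smul⟩
  · have h1 : S.perturbedStep f γ δ x =
        S.next x (S.gain γ (S.value γ) *ᵥ x) + S.B *ᵥ linPolicy f δ x := by
      simp [perturbedStep, next, Matrix.mulVec_add, add_assoc]
    have h2 := hN.contraction hS hγ x
    have h3 : 0 ≤ N x := apply_nonneg _ _
    rw [h1]
    calc √γ * N (S.next x (S.gain γ (S.value γ) *ᵥ x) + S.B *ᵥ linPolicy f δ x)
        ≤ √γ * (N (S.next x (S.gain γ (S.value γ) *ᵥ x)) + N (S.B *ᵥ linPolicy f δ x)) := by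
          gcongr
          exact map_add_le_add N _ _
      _ = √γ * N (S.next x (S.gain γ (S.value γ) *ᵥ x)) + √γ * N (S.B *ᵥ linPolicy f δ x) := by
          ring
      _ ≤ q₀ * N x + √γ * (√b * β * (cf * e * ‖δ‖ * (N x + o))) := by
          refine add_le_add (h2.trans (by gcongr)) ?_
          refine mul_le_mul_of_nonneg_left ((hNB _).trans ?_) (Real.sqrt_nonneg _)
          exact mul_le_mul_of_nonneg_left (hg δ x) (by positivity)
      _ = _ := by ring
  · have h1 : S.perturbedStep f γ δ x - S.perturbedStep f γ δ' y =
        S.next (x - y) (S.gain γ (S.value γ) *ᵥ (x - y)) +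
          S.B *ᵥ (linPolicy f δ x - linPolicy f δ' y) := by
      simp only [perturbedStep, next, Matrix.mulVec_add, Matrix.mulVec_sub]
      abel
    have h2 := hN.contraction hS hγ (x - y)
    have h3 : 0 ≤ N (x - y) := apply_nonneg _ _
    rw [h1]
    calc √γ * N (S.next (x - y) (S.gain γ (S.value γ) *ᵥ (x - y)) +
          S.B *ᵥ (linPolicy f δ x - linPolicy f δ' y))
        ≤ √γ * (N (S.next (x - y) (S.gain γ (S.value γ) *ᵥ (x - y))) +
          N (S.B *ᵥ (linPolicy f δ x - linPolicy f δ' y))) := by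
          gcongr
          exact map_add_le_add N _ _
      _ = √γ * N (S.next (x - y) (S.gain γ (S.value γ) *ᵥ (x - y))) +
          √γ * N (S.B *ᵥ (linPolicy f δ x - linPolicy f δ' y)) := by ring
      _ ≤ q₀ * N (x - y) + √γ * (√b * β *
          (cf * e * ‖δ‖ * N (x - y) + cf * e * ‖δ - δ'‖ * (N y + o))) := by
          refine add_le_add (h2.trans (by gcongr)) ?_
          refine mul_le_mul_of_nonneg_left ((hNB _).trans ?_) (Real.sqrt_nonneg _)
          exact mul_le_mul_of_nonneg_left (hg'' δ δ' x y) (by positivity)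
      _ = _ := by ring
  · calc NU (linPolicy f δ x) ≤ √c * ‖linPolicy f δ x‖ := hN.action_le hS hγ _
      _ ≤ √c * (cf * e * ‖δ‖ * (N x + o)) :=
          mul_le_mul_of_nonneg_left (hg δ x) (Real.sqrt_nonneg _)
      _ = _ := by ring
  · calc NU (linPolicy f δ x - linPolicy f δ' y) ≤ √c * ‖linPolicy f δ x - linPolicy f δ' y‖ :=
          hN.action_le hS hγ _
      _ ≤ √c * (cf * e * ‖δ‖ * N (x - y) + cf * e * ‖δ - δ'‖ * (N y + o)) :=
          mul_le_mul_of_nonneg_left (hg'' δ δ' x y) (Real.sqrt_nonneg _)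
      _ = _ := by ring

end LinearParametrization

end LQR

/-! ### Square integrability and coercivity in L²(ρ₀). -/

section SecondMoment

variable {n m d : ℕ} {ρ₀ : Measure (Fin n → ℝ)} {f : Fin d → (Fin n → ℝ) → (Fin m → ℝ)}

theorem integrable_sq_norm_of_dotProduct (hρ₀ : Integrable (fun x => x ⬝ᵥ x) ρ₀) :
    Integrable (fun x => ‖x‖ ^ 2) ρ₀ := by
  refine hρ₀.mono' (by fun_prop) (Eventually.of_forall fun x => ?_)
  have h0 : 0 ≤ x ⬝ᵥ x := Finset.sum_nonneg fun i _ => mul_self_nonneg _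
  rw [Real.norm_of_nonneg (by positivity)]
  refine (Real.le_sqrt (norm_nonneg _) h0).1 ?_
  refine (pi_norm_le_iff_of_nonneg (Real.sqrt_nonneg _)).2 fun i => ?_
  refine Real.le_sqrt_of_sq_le ?_
  rw [Real.norm_eq_abs, sq_abs, sq]
  exact Finset.single_le_sum (f := fun i => x i * x i) (fun j _ => mul_self_nonneg _)
    (Finset.mem_univ i)

variable [IsProbabilityMeasure ρ₀]

theorem memLp_two_of_lipschitz (h2 : Integrable (fun x => ‖x‖ ^ 2) ρ₀)
    {F : (Fin n → ℝ) → (Fin m → ℝ)} {L : ℝ≥0} (hF : LipschitzWith L F) : MemLp F 2 ρ₀ := by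
  have hid : MemLp (fun x : Fin n → ℝ => x) 2 ρ₀ :=
    (memLp_two_iff_integrable_sq_norm continuous_id.aestronglyMeasurable).2 h2
  refine ((hid.norm.const_mul (L : ℝ)).add (memLp_const ‖F 0‖)).of_le
    hF.continuous.aestronglyMeasurable (Eventually.of_forall fun x => ?_)
  refine le_trans ?_ (le_abs_self _)
  have h1 := hF.dist_le_mul x 0
  rw [dist_eq_norm, dist_zero_right] at h1
  have h2 := norm_sub_norm_le (F x) (F 0)
  simp only [Pi.add_apply]
  linarith

/-- Linearly independent continuous features are linearly independent in `L²(ρ₀)`. -/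
theorem exists_le_integral_linPolicy_sq [ρ₀.IsOpenPosMeasure]
    (h2 : Integrable (fun x => ‖x‖ ^ 2) ρ₀)
    (hLip : ∀ k, ∃ L : ℝ≥0, LipschitzWith L (f k)) (hind : LinearIndependent ℝ f) :
    ∃ h, 0 < h ∧ ∀ δ : EuclideanSpace ℝ (Fin d),
      h * ‖δ‖ ^ 2 ≤ ∫ x, ‖linPolicy f δ x‖ ^ 2 ∂ρ₀ := by
  choose L hL using hLip
  have hcont : ∀ k, Continuous (f k) := fun k => (hL k).continuous
  have hmem : ∀ k, MemLp (f k) 2 ρ₀ := fun k => memLp_two_of_lipschitz h2 (hL k)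
  let T : EuclideanSpace ℝ (Fin d) →ₗ[ℝ] Lp (Fin m → ℝ) 2 ρ₀ :=
    ∑ k, (LinearMap.toSpanSingleton ℝ _ ((hmem k).toLp (f k))).comp
      (EuclideanSpace.proj (𝕜 := ℝ) k).toLinearMap
  have hT : ∀ δ, T δ =ᵐ[ρ₀] linPolicy f δ := fun δ => by
    have h1 : T δ = ∑ k, δ k • (hmem k).toLp (f k) := by
      simp [T, LinearMap.sum_apply]
    have h3 : ∀ s : Finset (Fin d), ⇑(∑ k ∈ s, δ k • (hmem k).toLp (f k)) =ᵐ[ρ₀]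
        fun x => ∑ k ∈ s, δ k • f k x := fun s => by
      classical
      induction s using Finset.induction_on with
      | empty =>
        simp only [Finset.sum_empty]
        exact Lp.coeFn_zero _ _ _
      | insert k s hk ih =>
        simp only [Finset.sum_insert hk]
        filter_upwards [Lp.coeFn_add (δ k • (hmem k).toLp (f k))
          (∑ k ∈ s, δ k • (hmem k).toLp (f k)), ih, Lp.coeFn_smul (δ k) ((hmem k).toLp (f k)),
          (hmem k).coeFn_toLp] with x h4 h5 h6 h7
        rw [h4, Pi.add_apply, h5, h6, Pi.smul_apply, h7]
    rw [h1]
    exact h3 Finset.univ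
  -- A continuous function that vanishes almost everywhere for a measure of full support vanishes
  -- identically, so linear independence applies. In finite dimension injectivity then gives a lower
  -- bound.
  have hker : LinearMap.ker T = ⊥ := by
    rw [LinearMap.ker_eq_bot']
    intro δ hδ
    have h0 : linPolicy f δ =ᵐ[ρ₀] 0 := by
      have := hT δ
      rw [hδ] at this
      exact this.symm.trans (Lp.coeFn_zero _ _ _)
    have h1 : linPolicy f δ = 0 :=
      ((continuous_linPolicy hcont δ).ae_eq_iff_eq ρ₀ continuous_const).1 h0
    have h2 : ∑ k, δ k • f k = 0 := by
      ext1 x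
      have := congrFun h1 x
      simpa [linPolicy] using this
    ext k
    exact Fintype.linearIndependent_iff.1 hind _ h2 k
  obtain ⟨K, hK, hanti⟩ := T.exists_antilipschitzWith hker
  refine ⟨((K : ℝ) ^ 2)⁻¹, by positivity, fun δ => ?_⟩
  have h1 : ‖δ‖ ≤ K * ‖T δ‖ := by
    simpa using hanti.le_mul_dist δ 0
  have h3 : ‖T δ‖ ^ 2 = ∫ x, ‖linPolicy f δ x‖ ^ 2 ∂ρ₀ := by
    have h4 := (Lp.memLp (T δ)).eLpNorm_eq_integral_rpow_norm two_ne_zero ENNReal.ofNat_ne_top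
    have h5 : 0 ≤ ∫ x, ‖T δ x‖ ^ 2 ∂ρ₀ := integral_nonneg fun x => by positivity
    rw [Lp.norm_def, h4, ENNReal.toReal_ofReal (by positivity)]
    simp only [ENNReal.toReal_ofNat, Real.rpow_ofNat]
    rw [← Real.rpow_natCast, ← Real.rpow_mul h5]
    norm_num
    exact integral_congr_ae ((hT δ).mono fun x hx => by simp only [hx])
  rw [← h3, inv_mul_le_iff₀ (by positivity), ← mul_pow]
  gcongr

end SecondMoment

/-! ### The expected cost near the optimal parameter. -/

namespace LQR

variable {n m d : ℕ} {S : LQR n m} {γ : ℝ} {ρ₀ : Measure (Fin n → ℝ)}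
  {f : Fin d → (Fin n → ℝ) → (Fin m → ℝ)} {N : Seminorm ℝ (Fin n → ℝ)}
  {NU : Seminorm ℝ (Fin m → ℝ)} {o q₀ c₁ c₂ κ κ' r : ℝ} {θ p : EuclideanSpace ℝ (Fin d)}

section CostFormula

variable (hQ : S.Q.PosDef) (hR : S.R.PosDef) (hAB : S.Controllable) (hγ : γ ∈ Icc (0 : ℝ) 1)
  (hN : S.IsValueSeminorm γ N NU)
  (hpb : PerturbationBounds (S.perturbedStep f γ) (linPolicy f) N NU √γ o q₀ c₁ c₂)
  (hκ : q₀ + c₁ * r ≤ κ) (hκκ' : κ < κ') (hκ' : κ' < 1)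

include hQ hR hAB hγ hN hpb hκ hκκ' hκ'

theorem tsum_stageCost_linPolicy (hp : ∀ x, linPolicy f p x = S.gain γ (S.value γ) *ᵥ x)
    (hθ : ‖θ - p‖ ≤ r) (x : Fin n → ℝ) :
    ∑' t : ℕ, ENNReal.ofReal (γ ^ t * S.stageCost (S.traj (linPolicy f θ) x t)
        (linPolicy f θ (S.traj (linPolicy f θ) x t))) =
      ENNReal.ofReal (x ⬝ᵥ S.value γ *ᵥ x +
        excessCost (S.perturbedStep f γ) (linPolicy f) NU √γ (θ - p) x) := by
  refine tsum_stageCost_eq hQ hR hAB hγ _ x ?_ ?_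
  · unfold excessCost
    convert (hpb.summable_excess hκ hκκ' hκ' hθ x).hasSum using 2 with t
    rw [← traj_eq_iterate hp, mul_pow, ← pow_mul, mul_comm t 2, pow_mul, Real.sq_sqrt hγ.1,
      hN.sq_action, linPolicy_sub, hp]
  · have hb := hpb.nonneg_b
    have hκ0 : 0 ≤ κ := (add_nonneg hpb.nonneg_q (mul_nonneg hpb.nonneg_c₁
      ((norm_nonneg _).trans hθ))).trans hκ
    have hlim : Tendsto (fun T : ℕ => (κ ^ T * (N x + o)) ^ 2) atTop (𝓝 0) := by
      have := ((tendsto_pow_atTop_nhds_zero_of_lt_one hκ0 (hκκ'.trans hκ')).mul_const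
        (N x + o)).pow 2
      simpa using this
    refine squeeze_zero (fun T => mul_nonneg (pow_nonneg hγ.1 T) ?_) (fun T => ?_) hlim
    · rw [← hN.sq_state]
      positivity
    · rw [← hN.sq_state, traj_eq_iterate hp]
      have h1 := hpb.orbit_le hκ hθ x T
      have h2 : 0 ≤ N ((S.perturbedStep f γ (θ - p))^[T] x) := apply_nonneg _ _
      calc γ ^ T * N ((S.perturbedStep f γ (θ - p))^[T] x) ^ 2
          = (√γ ^ T * N ((S.perturbedStep f γ (θ - p))^[T] x)) ^ 2 := by
            rw [mul_pow, ← pow_mul, mul_comm T 2, pow_mul, Real.sq_sqrt hγ.1]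
        _ ≤ (√γ ^ T * (N ((S.perturbedStep f γ (θ - p))^[T] x) + o)) ^ 2 := by
            gcongr
            linarith
        _ ≤ _ := by gcongr

omit hQ hR hAB hγ hN hpb hκ hκκ' hκ' in
theorem IsValueSeminorm.continuous_state (hN : S.IsValueSeminorm γ N NU) : Continuous N := by
  have : (N : (Fin n → ℝ) → ℝ) = fun x => √(x ⬝ᵥ S.value γ *ᵥ x) := by
    ext x
    rw [← hN.sq_state, Real.sqrt_sq (apply_nonneg _ _)]
  rw [this]
  fun_prop

omit hQ hR hAB hγ hN hpb hκ hκκ' hκ' in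
theorem IsValueSeminorm.continuous_action (hN : S.IsValueSeminorm γ N NU) : Continuous NU := by
  have : (NU : (Fin m → ℝ) → ℝ) = fun x => √(x ⬝ᵥ S.actionWeight γ (S.value γ) *ᵥ x) := by
    ext x
    rw [← hN.sq_action, Real.sqrt_sq (apply_nonneg _ _)]
  rw [this]
  fun_prop

omit hQ hR hAB hγ in
theorem measurable_excessCost (hf : ∀ k, Continuous (f k)) {δ : EuclideanSpace ℝ (Fin d)}
    (hδ : ‖δ‖ ≤ r) :
    Measurable (excessCost (S.perturbedStep f γ) (linPolicy f) NU √γ δ) := by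
  refine measurable_of_tendsto_metrizable (f := fun T x => ∑ t ∈ Finset.range T,
    (√γ ^ t * NU (linPolicy f δ ((S.perturbedStep f γ δ)^[t] x))) ^ 2) (fun T => ?_)
    (tendsto_pi_nhds.2 fun x => (hpb.summable_excess hκ hκκ' hκ' hδ x).hasSum.tendsto_sum_nat)
  have h1 := hN.continuous_action
  have h2 := continuous_linPolicy hf δ
  have h3 : ∀ t, Continuous (S.perturbedStep f γ δ)^[t] := fun t =>
    (continuous_perturbedStep hf δ).iterate t
  exact (continuous_finsetSum _ fun t _ =>
    (continuous_const.mul (h1.comp (h2.comp (h3 t)))).pow 2).measurable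

omit hQ hR hAB hγ in
theorem integrable_excessCost (hf : ∀ k, Continuous (f k))
    (hY : Integrable (fun x => (N x + o) ^ 2) ρ₀) {δ : EuclideanSpace ℝ (Fin d)} (hδ : ‖δ‖ ≤ r) :
    Integrable (excessCost (S.perturbedStep f γ) (linPolicy f) NU √γ δ) ρ₀ := by
  refine (hY.const_mul ((c₂ * ‖δ‖) ^ 2 / (1 - κ' ^ 2))).mono'
    (measurable_excessCost hN hpb hκ hκκ' hκ' hf hδ).aestronglyMeasurable
    (Eventually.of_forall fun x => ?_)
  rw [Real.norm_of_nonneg ((sq_nonneg _).trans (hpb.sq_output_le_excessCost hκ hκκ' hκ' hδ x))]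
  exact hpb.excessCost_le hκ hκκ' hκ' hδ x

theorem cost_linPolicy (hf : ∀ k, Continuous (f k))
    (hp : ∀ x, linPolicy f p x = S.gain γ (S.value γ) *ᵥ x)
    (hV : Integrable (fun x => x ⬝ᵥ S.value γ *ᵥ x) ρ₀)
    (hY : Integrable (fun x => (N x + o) ^ 2) ρ₀) (hθ : ‖θ - p‖ ≤ r) :
    S.cost ρ₀ γ (linPolicy f θ) = ENNReal.ofReal (∫ x, x ⬝ᵥ S.value γ *ᵥ x ∂ρ₀ +
      ∫ x, excessCost (S.perturbedStep f γ) (linPolicy f) NU √γ (θ - p) x ∂ρ₀) := by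
  have hW := integrable_excessCost hN hpb hκ hκκ' hκ' hf hY hθ
  rw [← integral_add hV hW, ofReal_integral_eq_lintegral_ofReal (f := fun x =>
    x ⬝ᵥ S.value γ *ᵥ x + excessCost (S.perturbedStep f γ) (linPolicy f) NU √γ (θ - p) x)
    (hV.add hW)]
  · unfold cost
    exact lintegral_congr fun x =>
      tsum_stageCost_linPolicy hQ hR hAB hγ hN hpb hκ hκκ' hκ' hp hθ x
  · refine Eventually.of_forall fun x => add_nonneg ?_
      ((sq_nonneg _).trans (hpb.sq_output_le_excessCost hκ hκκ' hκ' hθ x))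
    rw [← hN.sq_state]
    positivity

/-- The comparison along rays bounds ⟨g, y - p⟩ from below by twice the excess minus a cubic error.
The excess is at least h|y - p|², and `hsmall` keeps the error below h|y - p|², so h|y - p|²
remains. -/
theorem isPolicyGradientLimit_of_small [IsProbabilityMeasure ρ₀]
    (hf : ∀ k, Continuous (f k))
    (hp : ∀ x, linPolicy f p x = S.gain γ (S.value γ) *ᵥ x)
    (hV : Integrable (fun x => x ⬝ᵥ S.value γ *ᵥ x) ρ₀)
    (hY : Integrable (fun x => (N x + o) ^ 2) ρ₀) {h : ℝ} (hh : 0 < h)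
    (hlow : ∀ δ, ‖δ‖ ≤ r →
      h * ‖δ‖ ^ 2 ≤ ∫ x, excessCost (S.perturbedStep f γ) (linPolicy f) NU √γ δ x ∂ρ₀)
    (hsmall : 2 * c₂ ^ 2 * (c₁ / (κ' - κ)) * r / (1 - κ' ^ 2) * ∫ x, (N x + o) ^ 2 ∂ρ₀ ≤ h)
    {θ₀ : EuclideanSpace ℝ (Fin d)} (hθ₀ : θ₀ ∈ Metric.ball p r) :
    IsPolicyGradientLimit (fun θ => S.cost ρ₀ γ (linPolicy f θ)) θ₀ p := by
  set W := excessCost (S.perturbedStep f γ) (linPolicy f) NU √γ with hW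
  set Y := fun x => (N x + o) ^ 2 with hYdef
  set m₂ := ∫ x, Y x ∂ρ₀ with hm₂
  set v := ∫ x, x ⬝ᵥ S.value γ *ᵥ x ∂ρ₀ with hv
  have hr : 0 < r := dist_nonneg.trans_lt (Metric.mem_ball.1 hθ₀)
  have hm₂0 : 0 ≤ m₂ := integral_nonneg fun x => by positivity
  have hv0 : 0 ≤ v := integral_nonneg fun x => by
    rw [← hN.sq_state]
    positivity
  have hint : ∀ δ, ‖δ‖ ≤ r → Integrable (W δ) ρ₀ := fun δ hδ =>
    integrable_excessCost hN hpb hκ hκκ' hκ' hf hY hδ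
  have hWnn : ∀ δ, ‖δ‖ ≤ r → 0 ≤ ∫ x, W δ x ∂ρ₀ := fun δ hδ =>
    (by positivity : 0 ≤ h * ‖δ‖ ^ 2).trans (hlow δ hδ)
  have hcost : ∀ θ, ‖θ - p‖ ≤ r → S.cost ρ₀ γ (linPolicy f θ) =
      ENNReal.ofReal (v + ∫ x, W (θ - p) x ∂ρ₀) := fun θ hθ =>
    cost_linPolicy hQ hR hAB hγ hN hpb hκ hκκ' hκ' hf hp hV hY hθ
  have hreal : ∀ θ, ‖θ - p‖ ≤ r → (S.cost ρ₀ γ (linPolicy f θ)).toReal =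
      v + ∫ x, W (θ - p) x ∂ρ₀ := fun θ hθ => by
    rw [hcost θ hθ, ENNReal.toReal_ofReal (add_nonneg hv0 (hWnn _ hθ))]
  have hball : ∀ y ∈ Metric.ball p r, ‖y - p‖ ≤ r := fun y hy => (mem_ball_iff_norm.1 hy).le
  have hW0 : ∫ x, W 0 x ∂ρ₀ = 0 := by
    have h0 : ‖(0 : EuclideanSpace ℝ (Fin d))‖ ≤ r := by simpa using hr.le
    have : W 0 = 0 := by
      ext x
      refine le_antisymm ?_
        ((sq_nonneg _).trans (hpb.sq_output_le_excessCost hκ hκκ' hκ' h0 x))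
      simpa using hpb.excessCost_le hκ hκκ' hκ' h0 x
    simp [this]
  set Λ := c₂ * (r * (c₁ / (κ' - κ)) + 1) * (2 * c₂ * r) / (1 - κ' ^ 2) with hΛ
  refine isPolicyGradientLimit_of_ball (r := r) (c := h) (L := (Λ * m₂).toNNReal)
    (fun y hy => ?_) ?_ hh (fun y hy G hG => ?_) hθ₀
  · simp only [hcost y (hball y hy)]
    exact ENNReal.ofReal_ne_top
  · refine LipschitzOnWith.of_dist_le_mul fun y hy z hz => ?_
    simp only [hreal y (hball y hy), hreal z (hball z hz)]
    rw [dist_add_left, Real.dist_eq, ← integral_sub (hint _ (hball y hy)) (hint _ (hball z hz))]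
    have hb : ∀ x, ‖W (y - p) x - W (z - p) x‖ ≤ Λ * ‖y - z‖ * Y x := fun x => by
      have := hpb.abs_excessCost_sub_le hκ hκκ' hκ' (hball y hy) (hball z hz) x
      rwa [sub_sub_sub_cancel_right] at this
    have h1 : |∫ x, W (y - p) x - W (z - p) x ∂ρ₀| ≤ ∫ x, Λ * ‖y - z‖ * Y x ∂ρ₀ :=
      norm_integral_le_of_norm_le (hY.const_mul _) (Eventually.of_forall hb)
    rw [integral_const_mul] at h1
    refine h1.trans ?_
    calc Λ * ‖y - z‖ * m₂ = Λ * m₂ * dist y z := by rw [dist_eq_norm]; ring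
      _ ≤ _ := by
        gcongr
        exact Real.le_coe_toNNReal _
  · have hyr := hball y hy
    have hpr : ‖p - p‖ ≤ r := by simpa using hr.le
    set D := 1 - κ' ^ 2 with hD
    set C := c₁ / (κ' - κ) with hC
    have hray : ∀ σ, 0 ≤ σ → σ ≤ 1 →
        (S.cost ρ₀ γ (linPolicy f (y - σ • (y - p)))).toReal -
          (S.cost ρ₀ γ (linPolicy f p)).toReal ≤
        (1 - σ) ^ 2 * ((S.cost ρ₀ γ (linPolicy f y)).toReal -
          (S.cost ρ₀ γ (linPolicy f p)).toReal) +
        σ * (2 * c₂ ^ 2 * C * ‖y - p‖ ^ 3 / D * m₂) +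
        σ ^ 2 * ((c₂ * C * ‖y - p‖ ^ 2) ^ 2 / D * m₂) := by
      intro σ hσ0 hσ1
      have e : y - σ • (y - p) - p = (y - p) - σ • (y - p) := by abel
      have hσr : ‖(y - p) - σ • (y - p)‖ ≤ r := by
        have : (y - p) - σ • (y - p) = (1 - σ) • (y - p) := by rw [sub_smul, one_smul]
        rw [this, norm_smul, Real.norm_of_nonneg (by linarith)]
        exact (mul_le_of_le_one_left (norm_nonneg _) (by linarith)).trans hyr
      rw [hreal _ (e ▸ hσr), hreal y hyr, hreal p hpr, e, sub_self, hW0]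
      have h1 : ∫ x, W ((y - p) - σ • (y - p)) x ∂ρ₀ ≤ ∫ x, ((1 - σ) ^ 2 * W (y - p) x +
          (σ * (2 * c₂ ^ 2 * C * ‖y - p‖ ^ 3 / D) +
            σ ^ 2 * ((c₂ * C * ‖y - p‖ ^ 2) ^ 2 / D)) * Y x) ∂ρ₀ :=
        integral_mono (hint _ hσr) (((hint _ hyr).const_mul _).add (hY.const_mul _)) fun x =>
          hpb.excessCost_ray_le hκ hκκ' hκ' hyr hσ0 hσ1 x
      rw [integral_add ((hint _ hyr).const_mul _) (hY.const_mul _), integral_const_mul,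
        integral_const_mul] at h1
      linarith
    have h2 := hG.le_inner_of_ray hray
    refine le_trans ?_ h2
    rw [hreal y hyr, hreal p hpr, sub_self, hW0]
    have h3 := hlow _ hyr
    have h4 : 2 * c₂ ^ 2 * C * ‖y - p‖ ^ 3 / D * m₂ ≤ h * ‖y - p‖ ^ 2 := by
      have hκ0 : 0 ≤ κ := (add_nonneg hpb.nonneg_q (mul_nonneg hpb.nonneg_c₁ hr.le)).trans hκ
      have hD0 : 0 < D := by
        rw [hD]
        nlinarith
      have hC0 : 0 ≤ C := div_nonneg hpb.nonneg_c₁ (by linarith)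
      calc 2 * c₂ ^ 2 * C * ‖y - p‖ ^ 3 / D * m₂
          = 2 * c₂ ^ 2 * C * ‖y - p‖ / D * m₂ * ‖y - p‖ ^ 2 := by ring
        _ ≤ 2 * c₂ ^ 2 * C * r / D * m₂ * ‖y - p‖ ^ 2 := by gcongr
        _ ≤ _ := by gcongr
    linarith

end CostFormula

end LQR

/-! ### Chaining short steps of the discount factor. -/

/-- A relation that holds for short steps, uniformly away from `1`, can be chained along a
sequence from `0` to `1`. -/
theorem exists_strictMono_seq_of_short_steps {G : ℝ → ℝ → Prop}
    (h : ∀ c, 0 ≤ c → c < 1 → ∃ η > 0, ∀ a b, 0 ≤ a → a ≤ b → b ≤ c → b - a ≤ η → G a b) :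
    ∃ γ : ℕ → ℝ, StrictMono γ ∧ γ 0 = 0 ∧ (∀ j, γ j ∈ Ico (0 : ℝ) 1) ∧ Tendsto γ atTop (𝓝 1) ∧
      ∀ j, G (γ j) (γ (j + 1)) := by
  let V : ℝ → Set ℝ := fun c =>
    {η | 0 < η ∧ η ≤ 1 ∧ ∀ a b, 0 ≤ a → a ≤ b → b ≤ c → b - a ≤ η → G a b}
  have hVne : ∀ c, 0 ≤ c → c < 1 → (V c).Nonempty := fun c h0 h1 => by
    obtain ⟨η, hη, hG⟩ := h c h0 h1
    exact ⟨min η 1, by positivity, min_le_right _ _, fun a b ha hab hb hle =>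
      hG a b ha hab hb (hle.trans (min_le_left _ _))⟩
  have hVbdd : ∀ c, BddAbove (V c) := fun c => ⟨1, fun η hη => hη.2.1⟩
  let ψ : ℝ → ℝ := fun c => sSup (V c) / 2
  have hψpos : ∀ c, 0 ≤ c → c < 1 → 0 < ψ c := fun c h0 h1 => by
    obtain ⟨η, hη⟩ := hVne c h0 h1
    have := hη.1.trans_le (le_csSup (hVbdd c) hη)
    exact half_pos this
  have hψanti : ∀ c c', 0 ≤ c' → c ≤ c' → c' < 1 → ψ c' ≤ ψ c := fun c c' h0 hcc' h1 => by
    have : sSup (V c') ≤ sSup (V c) := csSup_le_csSup (hVbdd c) (hVne c' h0 h1)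
      fun η hη => ⟨hη.1, hη.2.1, fun a b ha hab hb hle => hη.2.2 a b ha hab (hb.trans hcc') hle⟩
    simp only [ψ]
    linarith
  have hψG : ∀ c, 0 ≤ c → c < 1 → ∀ a b, 0 ≤ a → a ≤ b → b ≤ c → b - a ≤ ψ c → G a b := by
    intro c h0 h1 a b ha hab hb hle
    have hlt : ψ c < sSup (V c) := by
      have := hψpos c h0 h1
      simp only [ψ] at *
      linarith
    obtain ⟨η, hη, hlt'⟩ := exists_lt_of_lt_csSup (hVne c h0 h1) hlt
    exact hη.2.2 a b ha hab hb (hle.trans hlt'.le)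
  -- Going at most half way to 1 keeps the new point below `(1 + x) / 2`, the level for which the
  -- step length is admissible.
  let step : ℝ → ℝ := fun x => x + min ((1 - x) / 2) (ψ ((1 + x) / 2))
  let γ : ℕ → ℝ := fun j => step^[j] 0
  have hsucc : ∀ j, γ (j + 1) = γ j + min ((1 - γ j) / 2) (ψ ((1 + γ j) / 2)) := fun j =>
    Function.iterate_succ_apply' step j 0
  have hstep : ∀ x, 0 ≤ x → x < 1 → 0 < min ((1 - x) / 2) (ψ ((1 + x) / 2)) := fun x h0 h1 =>
    lt_min (by linarith) (hψpos _ (by linarith) (by linarith))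
  have hmem : ∀ j, γ j ∈ Ico (0 : ℝ) 1 := fun j => by
    induction j with
    | zero => simp [γ]
    | succ j ih =>
      have h1 := hstep _ ih.1 ih.2
      have h2 := min_le_left ((1 - γ j) / 2) (ψ ((1 + γ j) / 2))
      have h3 := ih.1
      have h4 := ih.2
      rw [hsucc]
      exact ⟨by linarith, by linarith⟩
  have hmono : StrictMono γ := strictMono_nat_of_lt_succ fun j => by
    rw [hsucc]
    linarith [hstep _ (hmem j).1 (hmem j).2]
  refine ⟨γ, hmono, rfl, hmem, ?_, fun j => ?_⟩
  · have hbdd : BddAbove (range γ) := ⟨1, by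
      rintro _ ⟨j, rfl⟩
      exact (hmem j).2.le⟩
    have hlim := tendsto_atTop_ciSup hmono.monotone hbdd
    set l := ⨆ j, γ j
    have hγl : ∀ j, γ j ≤ l := le_ciSup hbdd
    have hl1 : l ≤ 1 := ciSup_le fun j => (hmem j).2.le
    rcases hl1.eq_or_lt with hl | hl
    · rwa [hl] at hlim
    · exfalso
      have hl0 : 0 ≤ l := (hmem 0).1.trans (hγl 0)
      have hε := hstep l hl0 hl
      set ε := min ((1 - l) / 2) (ψ ((1 + l) / 2)) with hεdef
      -- The increments are antitone in the point, so a limit `l < 1` would bound all of them below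
      -- by the increment at `l`.
      have hge : ∀ j : ℕ, j * ε ≤ γ j := fun j => by
        induction j with
        | zero => simp [γ]
        | succ j ih =>
          have h1 := hγl j
          have h0 := (hmem j).1
          have h2 : ε ≤ min ((1 - γ j) / 2) (ψ ((1 + γ j) / 2)) := by
            refine min_le_min (by linarith) ?_
            exact hψanti _ _ (by linarith) (by linarith) (by linarith)
          rw [hsucc]
          push_cast
          linarith
      obtain ⟨j, hj⟩ := exists_nat_gt (1 / ε)
      rw [div_lt_iff₀ hε] at hj
      linarith [hge j, (hmem j).2]
  · have h0 := hmem j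
    have h1 := hmem (j + 1)
    refine hψG ((1 + γ j) / 2) (by linarith [h0.1]) (by linarith [h0.2]) _ _ h0.1
      (hmono.monotone j.le_succ) ?_ ?_
    · rw [hsucc]
      linarith [min_le_left ((1 - γ j) / 2) (ψ ((1 + γ j) / 2))]
    · rw [hsucc, add_sub_cancel_left]
      exact min_le_right _ _

/-! ### Optimality, uniform radius of attraction and the homotopy. -/

namespace LQR

variable {n m d : ℕ} {S : LQR n m} {γ : ℝ} {ρ₀ : Measure (Fin n → ℝ)}
  {f : Fin d → (Fin n → ℝ) → (Fin m → ℝ)} {p : EuclideanSpace ℝ (Fin d)}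

variable (hQ : S.Q.PosDef) (hR : S.R.PosDef) (hAB : S.Controllable)

include hQ hR hAB

theorem integrable_value {a b ρ c q : ℝ} (hS : S.UniformBounds a b ρ c q)
    (h2 : Integrable (fun x => ‖x‖ ^ 2) ρ₀) (hγ : γ ∈ Icc (0 : ℝ) 1) :
    Integrable (fun x => x ⬝ᵥ S.value γ *ᵥ x) ρ₀ := by
  refine (h2.const_mul b).mono' (by fun_prop) (Eventually.of_forall fun x => ?_)
  have := (posSemidef_value hQ hR hAB hγ).dotProduct_mulVec_nonneg x
  rw [star_trivial] at this
  rw [Real.norm_of_nonneg this]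
  exact hS.value_le γ hγ x

/-- Under the optimal gain the excess is zero and the value decays geometrically along the orbit, so
the cost equals the integrated value, the lower bound for every policy. -/
theorem isUndiscountedOptimum (h2 : Integrable (fun x => ‖x‖ ^ 2) ρ₀)
    (hp : ∀ x, linPolicy f p x = S.gain 1 (S.value 1) *ᵥ x) :
    IsUndiscountedOptimum S ρ₀ f p := by
  obtain ⟨a, b, ρ, c, q, hS⟩ := exists_uniformBounds hQ hR hAB
  have h1 : (1 : ℝ) ∈ Icc (0 : ℝ) 1 := ⟨zero_le_one, le_rfl⟩
  have hV0 : ∀ x : Fin n → ℝ, 0 ≤ x ⬝ᵥ S.value 1 *ᵥ x := fun x => by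
    simpa using (posSemidef_value hQ hR hAB h1).dotProduct_mulVec_nonneg x
  have hcost : S.cost ρ₀ 1 (linPolicy f p) = ∫⁻ x, ENNReal.ofReal (x ⬝ᵥ S.value 1 *ᵥ x) ∂ρ₀ := by
    refine lintegral_congr fun x => ?_
    have hgeo : ∀ T, S.traj (linPolicy f p) x T ⬝ᵥ S.value 1 *ᵥ S.traj (linPolicy f p) x T ≤
        q ^ T * (x ⬝ᵥ S.value 1 *ᵥ x) := fun T => by
      induction T with
      | zero => simp [traj]
      | succ T ih =>
        have h3 := hS.contraction 1 h1 (S.traj (linPolicy f p) x T)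
        rw [one_mul, ← hp] at h3
        refine h3.trans ?_
        rw [pow_succ', mul_assoc]
        exact mul_le_mul_of_nonneg_left ih hS.nonneg_q
    have := tsum_stageCost_eq hQ hR hAB h1 (linPolicy f p) x (w := 0) ?_ ?_
    · rw [this, add_zero]
    · simp [hp, hasSum_zero]
    · refine squeeze_zero (fun T => mul_nonneg (by simp) (hV0 _)) (fun T => ?_)
        (g := fun T => q ^ T * (x ⬝ᵥ S.value 1 *ᵥ x)) ?_
      · simpa using hgeo T
      · simpa using (tendsto_pow_atTop_nhds_zero_of_lt_one hS.nonneg_q hS.q_lt_one).mul_const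
          (x ⬝ᵥ S.value 1 *ᵥ x)
  refine ⟨⟨_, isOptimalGain_value hQ hR hAB h1, hp⟩, ?_, fun π => ?_⟩
  · rw [hcost, ← ofReal_integral_eq_lintegral_ofReal (integrable_value hQ hR hAB hS h2 h1)
      (Eventually.of_forall hV0)]
    exact ENNReal.ofReal_ne_top
  · rw [hcost]
    exact lintegral_mono fun x => value_one_le_tsum_stageCost hQ hR hAB π x

variable [IsProbabilityMeasure ρ₀] [ρ₀.IsOpenPosMeasure]

/-- Policy gradient converges to the optimal gain from a ball around it, uniformly as long as the
offset `o` of the features is discounted; at `γ = 0` the ball is arbitrarily large. -/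
theorem exists_radius (h2 : Integrable (fun x => ‖x‖ ^ 2) ρ₀)
    (hLip : ∀ k, ∃ L : ℝ≥0, LipschitzWith L (f k)) (hind : LinearIndependent ℝ f)
    {o q₁ : ℝ} (ho : o = 1 ∨ o = 0 ∧ ∀ k, f k 0 = 0) (hq₁ : q₁ < 1) :
    ∃ r₀ > 0, ∀ γ ∈ Icc (0 : ℝ) 1, √γ * o ≤ q₁ * o → ∀ r, √γ * r ≤ r₀ → ∀ p,
      (∀ x, linPolicy f p x = S.gain γ (S.value γ) *ᵥ x) → ∀ θ₀ ∈ Metric.ball p r,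
        IsPolicyGradientLimit (fun θ => S.cost ρ₀ γ (linPolicy f θ)) θ₀ p := by
  obtain ⟨a, b, ρ, c, q, hS⟩ := exists_uniformBounds hQ hR hAB
  obtain ⟨β, hβ, hB⟩ := S.B.exists_norm_mulVec_le
  obtain ⟨cf, hcf, hf1, hf2⟩ := exists_linPolicy_bound hLip ho
  obtain ⟨h, hh, hlow⟩ := exists_le_integral_linPolicy_sq h2 hLip hind
  have hcont : ∀ k, Continuous (f k) := fun k => (hLip k).choose_spec.continuous
  have ho0 : 0 ≤ o := by rcases ho with rfl | ⟨rfl, _⟩ <;> simp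
  set q₀ := max (√q) q₁ with hq₀
  have hq₀0 : 0 ≤ q₀ := (Real.sqrt_nonneg q).trans (le_max_left _ _)
  have hq₀1 : q₀ < 1 := by
    refine max_lt ?_ hq₁
    rw [Real.sqrt_lt' one_pos, one_pow]
    exact hS.q_lt_one
  -- `κ` and `κ'` divide the gap between `q₀` and 1 into thirds, leaving room for the perturbation,
  -- the Grönwall loss and summability.
  set κ := q₀ + (1 - q₀) / 3 with hκ
  set κ' := q₀ + 2 * ((1 - q₀) / 3) with hκ'
  have hκκ' : κ < κ' := by linarith
  have hκ'1 : κ' < 1 := by linarith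
  have hκ'0 : 0 ≤ κ' := by linarith
  have hd : 0 < κ' - κ := sub_pos.2 hκκ'
  have hD : 0 < 1 - κ' ^ 2 := by nlinarith
  set c₁ := √b * β * (cf * ((√a)⁻¹ + 1)) with hc₁
  set c₂ := √c * (cf * ((√a)⁻¹ + 1)) with hc₂
  have hc₁0 : 0 ≤ c₁ := by positivity
  have hYint : Integrable (fun x : Fin n → ℝ => (√b * ‖x‖ + o) ^ 2) ρ₀ := by
    refine ((h2.const_mul (2 * √b ^ 2)).add (integrable_const (2 * o ^ 2))).mono'
      (by fun_prop) (Eventually.of_forall fun x => ?_)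
    rw [Real.norm_of_nonneg (sq_nonneg _)]
    simp only [Pi.add_apply]
    nlinarith [sq_nonneg (√b * ‖x‖ - o)]
  set M := ∫ x, (√b * ‖x‖ + o) ^ 2 ∂ρ₀ with hM
  have hM0 : 0 ≤ M := integral_nonneg fun x => sq_nonneg _
  set Γ := 2 * c₂ ^ 2 * (c₁ / (κ' - κ)) / (1 - κ' ^ 2) with hΓ
  have hΓ0 : 0 ≤ Γ := by positivity
  have hρ := hS.pos_ρ
  -- The first entry keeps perturbed orbits within rate `κ`, the second keeps the cubic error below
  -- the quadratic growth `ρ * h`. Both constrain only √γ·r. The summands 1 avoid division by zero.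
  refine ⟨min ((1 - q₀) / 3 / (c₁ + 1)) (ρ * h / (Γ * M + 1)), ?_, ?_⟩
  · have : 0 < 1 - q₀ := sub_pos.2 hq₀1
    positivity
  intro γ hγ hγo r hr p hp θ₀ hθ₀
  have hr0 : 0 < r := dist_nonneg.trans_lt (Metric.mem_ball.1 hθ₀)
  have hr1 : c₁ * (√γ * r) ≤ (1 - q₀) / 3 := by
    have h3 := hr.trans (min_le_left _ _)
    rw [le_div_iff₀ (by positivity)] at h3
    have : 0 ≤ √γ * r := by positivity
    linarith
  have hr2 : Γ * M * (√γ * r) ≤ ρ * h := by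
    have h3 := hr.trans (min_le_right _ _)
    rw [le_div_iff₀ (by positivity)] at h3
    have : 0 ≤ √γ * r := by positivity
    linarith
  obtain ⟨N, NU, hN⟩ := exists_isValueSeminorm hQ hR hAB hγ
  have hpb := hN.perturbationBounds hS hγ (q₀ := q₀) ho0 (le_max_left _ _)
    (hγo.trans (mul_le_mul_of_nonneg_right (le_max_right _ _) ho0)) hcf hf1 hf2 hβ hB
  have hκr : q₀ + √γ * c₁ * r ≤ κ := by
    rw [hκ]
    linarith
  have hNY : ∀ x, (N x + o) ^ 2 ≤ (√b * ‖x‖ + o) ^ 2 := fun x => by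
    have h3 : 0 ≤ N x := apply_nonneg _ _
    have h4 := hN.state_le hS hγ x
    gcongr
  have hY : Integrable (fun x => (N x + o) ^ 2) ρ₀ := by
    have := hN.continuous_state
    refine hYint.mono' (by fun_prop) (Eventually.of_forall fun x => ?_)
    rw [Real.norm_of_nonneg (sq_nonneg _)]
    exact hNY x
  refine isPolicyGradientLimit_of_small hQ hR hAB hγ hN hpb hκr hκκ' hκ'1 hcont hp
    (integrable_value hQ hR hAB hS h2 hγ) hY (mul_pos hρ hh) (fun δ hδ => ?_) ?_ hθ₀
  · have hW := integrable_excessCost hN hpb hκr hκκ' hκ'1 hcont hY hδ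
    calc ρ * h * ‖δ‖ ^ 2 = ρ * (h * ‖δ‖ ^ 2) := by ring
      _ ≤ ρ * ∫ x, ‖linPolicy f δ x‖ ^ 2 ∂ρ₀ := by gcongr; exact hlow δ
      _ = ∫ x, ρ * ‖linPolicy f δ x‖ ^ 2 ∂ρ₀ := (integral_const_mul _ _).symm
      _ ≤ _ := by
        refine integral_mono_of_nonneg (Eventually.of_forall fun x => by positivity) hW
          (Eventually.of_forall fun x => ?_)
        refine le_trans ?_ (hpb.sq_output_le_excessCost hκr hκκ' hκ'1 hδ x)
        rw [hN.sq_action]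
        exact hS.le_weight γ hγ _
  · have h3 : ∫ x, (N x + o) ^ 2 ∂ρ₀ ≤ M := integral_mono hY hYint hNY
    calc 2 * c₂ ^ 2 * (√γ * c₁ / (κ' - κ)) * r / (1 - κ' ^ 2) * ∫ x, (N x + o) ^ 2 ∂ρ₀
        = Γ * (√γ * r) * ∫ x, (N x + o) ^ 2 ∂ρ₀ := by rw [hΓ]; ring
      _ ≤ Γ * (√γ * r) * M := by gcongr
      _ = Γ * M * (√γ * r) := by ring
      _ ≤ _ := hr2

/-- The optimal parameter is Hölder continuous in the discount factor. -/
theorem exists_parameter_holder (h2 : Integrable (fun x => ‖x‖ ^ 2) ρ₀)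
    (hLip : ∀ k, ∃ L : ℝ≥0, LipschitzWith L (f k)) (hind : LinearIndependent ℝ f) :
    ∃ C, 0 ≤ C ∧ ∀ γ γ' p p', 0 ≤ γ → γ ≤ γ' → γ' ≤ 1 →
      (∀ x, linPolicy f p x = S.gain γ (S.value γ) *ᵥ x) →
      (∀ x, linPolicy f p' x = S.gain γ' (S.value γ') *ᵥ x) → ‖p - p'‖ ^ 2 ≤ C * (γ' - γ) := by
  obtain ⟨a, b, ρ, c, q, hS⟩ := exists_uniformBounds hQ hR hAB
  obtain ⟨C, hC, hK⟩ := hS.exists_gain_holder hQ hR hAB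
  obtain ⟨h, hh, hlow⟩ := exists_le_integral_linPolicy_sq h2 hLip hind
  have hM0 : 0 ≤ ∫ x, ‖x‖ ^ 2 ∂ρ₀ := integral_nonneg fun x => by positivity
  refine ⟨C * (∫ x, ‖x‖ ^ 2 ∂ρ₀) / h, by positivity, fun γ γ' p p' h0 hγγ' h1 hp hp' => ?_⟩
  have h3 : ∫ x, ‖linPolicy f (p - p') x‖ ^ 2 ∂ρ₀ ≤ ∫ x, C * (γ' - γ) * ‖x‖ ^ 2 ∂ρ₀ := by
    refine integral_mono_of_nonneg (Eventually.of_forall fun x => by positivity)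
      (h2.const_mul _) (Eventually.of_forall fun x => ?_)
    simp only [linPolicy_sub, hp, hp']
    exact hK γ γ' h0 hγγ' h1 x
  rw [integral_const_mul] at h3
  have h4 := (hlow (p - p')).trans h3
  rw [div_mul_eq_mul_div, le_div_iff₀ hh]
  linarith

end LQR

theorem corollary4 {n m d : ℕ} (S : LQR n m)
    (hQ : S.Q.PosDef) (hR : S.R.PosDef) (hAB : S.Controllable)
    (ρ₀ : Measure (Fin n → ℝ)) [IsProbabilityMeasure ρ₀] [ρ₀.IsOpenPosMeasure]
    (hρ₀ : Integrable (fun x => x ⬝ᵥ x) ρ₀)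
    (f : Fin d → (Fin n → ℝ) → (Fin m → ℝ))
    (hLip : ∀ k, ∃ L : ℝ≥0, LipschitzWith L (f k))
    (hind : LinearIndependent ℝ f)
    (hspan : ∀ γ ∈ Set.Icc (0 : ℝ) 1, ∀ K, S.IsOptimalGain γ K →
      (fun x => K *ᵥ x) ∈ Submodule.span ℝ (Set.range f)) :
    ∃ θstar : EuclideanSpace ℝ (Fin d), IsUndiscountedOptimum S ρ₀ f θstar ∧
      (∃ γ : ℕ → ℝ, StrictMono γ ∧ (∀ j, γ j ∈ Set.Icc (0 : ℝ) 1) ∧ Tendsto γ atTop (𝓝 1) ∧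
        ∀ θ₀ : EuclideanSpace ℝ (Fin d), ∃ η : ℕ → EuclideanSpace ℝ (Fin d),
          η 0 = θ₀ ∧ IsHomotopyRun S ρ₀ f γ ⊤ η ∧ Tendsto η atTop (𝓝 θstar)) ∧
      ((∀ k, f k 0 = 0) →
        ∃ (N : ℕ) (γ : ℕ → ℝ), StrictMonoOn γ (Set.Iic N) ∧
          (∀ j ≤ N, γ j ∈ Set.Icc (0 : ℝ) 1) ∧ γ N = 1 ∧
          ∀ θ₀ : EuclideanSpace ℝ (Fin d), ∃ η : ℕ → EuclideanSpace ℝ (Fin d),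
            η 0 = θ₀ ∧ IsHomotopyRun S ρ₀ f γ ((N + 1 : ℕ) : ℕ∞) η ∧ η (N + 1) = θstar) := by
  have h2 := integrable_sq_norm_of_dotProduct hρ₀
  have hex : ∀ γ, ∃ p : EuclideanSpace ℝ (Fin d), γ ∈ Set.Icc (0 : ℝ) 1 →
      ∀ x, linPolicy f p x = S.gain γ (S.value γ) *ᵥ x := fun γ => by
    by_cases hγ : γ ∈ Set.Icc (0 : ℝ) 1
    · obtain ⟨c, hc⟩ := (Submodule.mem_span_range_iff_exists_fun ℝ).1
        (hspan γ hγ _ (LQR.isOptimalGain_value hQ hR hAB hγ))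
      refine ⟨WithLp.toLp 2 c, fun _ x => ?_⟩
      rw [← congrFun hc x]
      simp [linPolicy]
    · exact ⟨0, fun h => absurd h hγ⟩
  choose p hp using hex
  have h1 : (1 : ℝ) ∈ Set.Icc (0 : ℝ) 1 := ⟨zero_le_one, le_rfl⟩
  obtain ⟨C, hC, hHolder⟩ := LQR.exists_parameter_holder hQ hR hAB h2 hLip hind
  have hstep : ∀ o q₁ : ℝ, (o = 1 ∨ o = 0 ∧ ∀ k, f k 0 = 0) → q₁ < 1 → ∃ η > 0, ∀ γ₀ γ, 0 ≤ γ₀ →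
      γ₀ ≤ γ → γ ≤ 1 → √γ * o ≤ q₁ * o → γ - γ₀ ≤ η →
      IsPolicyGradientLimit (fun θ => S.cost ρ₀ γ (linPolicy f θ)) (p γ₀) (p γ) := by
    intro o q₁ ho hq₁
    obtain ⟨r₀, hr₀, hPG⟩ := LQR.exists_radius hQ hR hAB h2 hLip hind ho hq₁
    -- By the Hölder bound |p γ₀ - p γ|² ≤ C(γ - γ₀), steps of this length keep `p γ₀` inside the
    -- ball of radius `r₀` around `p γ`.
    refine ⟨r₀ ^ 2 / (C + 1), by positivity, fun γ₀ γ h0 hle hγ1 hγo hη => ?_⟩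
    have hγ : γ ∈ Set.Icc (0 : ℝ) 1 := ⟨h0.trans hle, hγ1⟩
    have hγ₀ : γ₀ ∈ Set.Icc (0 : ℝ) 1 := ⟨h0, hle.trans hγ1⟩
    refine hPG γ hγ hγo r₀ ?_ (p γ) (hp γ hγ) _ ?_
    · exact mul_le_of_le_one_left hr₀.le (Real.sqrt_le_one.2 hγ1)
    · rw [mem_ball_iff_norm]
      refine lt_of_pow_lt_pow_left₀ 2 hr₀.le ?_
      rw [le_div_iff₀ (by positivity)] at hη
      rcases (sub_nonneg.2 hle).eq_or_lt with hz | hz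
      · have := hHolder γ₀ γ _ _ h0 hle hγ1 (hp γ₀ hγ₀) (hp γ hγ)
        rw [← hz, mul_zero] at this
        exact this.trans_lt (by positivity)
      · have := hHolder γ₀ γ _ _ h0 hle hγ1 (hp γ₀ hγ₀) (hp γ hγ)
        linarith
  -- At γ = 0 the radius is unconstrained, so a ball containing the given starting point is
  -- available.
  have hstart : ∀ θ₀, IsPolicyGradientLimit (fun θ => S.cost ρ₀ 0 (linPolicy f θ)) θ₀ (p 0) := by
    intro θ₀
    obtain ⟨r₀, hr₀, hPG⟩ := LQR.exists_radius hQ hR hAB h2 hLip hind (o := 1) (q₁ := 0)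
      (Or.inl rfl) zero_lt_one
    have h0 : (0 : ℝ) ∈ Set.Icc (0 : ℝ) 1 := ⟨le_rfl, zero_le_one⟩
    exact hPG 0 h0 (by simp) (dist θ₀ (p 0) + 1) (by simpa using hr₀.le) (p 0) (hp 0 h0) θ₀
      (Metric.mem_ball.2 (lt_add_one _))
  refine ⟨p 1, LQR.isUndiscountedOptimum hQ hR hAB h2 (hp 1 h1), ?_, fun hf0 => ?_⟩
  · obtain ⟨γ, hmono, hγ0, hmem, hlim, hG⟩ := exists_strictMono_seq_of_short_steps
      (G := fun γ₀ γ => IsPolicyGradientLimit (fun θ => S.cost ρ₀ γ (linPolicy f θ)) (p γ₀) (p γ))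
      (fun c _ hc1 => by
        -- With offset 1 the constant part of the features decays at rate √γ ≤ √c < 1, so the step
        -- length depends on `c`.
        obtain ⟨η, hη, hG⟩ := hstep 1 (√c) (Or.inl rfl) (by
          rwa [Real.sqrt_lt' one_pos, one_pow])
        exact ⟨η, hη, fun a b ha hab hb hle => hG a b ha hab (hb.trans hc1.le)
          (by simpa using Real.sqrt_le_sqrt hb) hle⟩)
    have hmem' : ∀ j, γ j ∈ Set.Icc (0 : ℝ) 1 := fun j => ⟨(hmem j).1, (hmem j).2.le⟩
    refine ⟨γ, hmono, hmem', hlim, fun θ₀ =>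
      ⟨fun j => Nat.casesOn j θ₀ fun i => p (γ i), rfl, fun j _ => ?_, ?_⟩⟩
    · cases j with
      | zero =>
        simp only [hγ0]
        exact hstart θ₀
      | succ j => exact hG j
    · refine (tendsto_add_atTop_iff_nat 1).1 ?_
      change Tendsto (fun j => p (γ j)) atTop (𝓝 (p 1))
      rw [tendsto_iff_norm_sub_tendsto_zero]
      have hsq : Tendsto (fun j => √(C * (1 - γ j))) atTop (𝓝 0) := by
        simpa using ((hlim.const_sub 1).const_mul C).sqrt
      refine squeeze_zero (fun j => norm_nonneg _) (fun j => ?_) hsq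
      exact Real.le_sqrt_of_sq_le (hHolder _ _ _ _ (hmem' j).1 (hmem' j).2 le_rfl
        (hp _ (hmem' j)) (hp 1 h1))
  -- With offset 0 the discount condition is void, and a single step length works up to γ = 1.
  · obtain ⟨η, hη, hG⟩ := hstep 0 0 (Or.inr ⟨rfl, hf0⟩) zero_lt_one
    obtain ⟨N, hN⟩ := exists_nat_gt (1 / η)
    have hNpos : (0 : ℝ) < N := (by positivity : 0 < 1 / η).trans hN
    have hNη : 1 / (N : ℝ) ≤ η := by
      rw [div_lt_iff₀ hη] at hN
      rw [div_le_iff₀ hNpos]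
      linarith
    have hmem : ∀ j ≤ N, ((j : ℝ) / N) ∈ Set.Icc (0 : ℝ) 1 := fun j hj =>
      ⟨by positivity, (div_le_one hNpos).2 (by exact_mod_cast hj)⟩
    -- The `N + 1` factors are 0, 1/N, …, 1. Iterates are shifted by one: the run with factor j/N
    -- produces `η (j + 1) = p (j / N)`.
    refine ⟨N, fun j => j / N, fun i _ j _ hij => ?_, hmem, div_self hNpos.ne', fun θ₀ =>
      ⟨fun j => Nat.casesOn j θ₀ fun i => p (i / N), rfl, fun j hj => ?_, ?_⟩⟩
    · have : (i : ℝ) < j := by exact_mod_cast hij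
      simp only
      gcongr
    · cases j with
      | zero =>
        simp only [Nat.cast_zero, zero_div]
        exact hstart θ₀
      | succ j =>
        have hjN : j + 1 ≤ N := Nat.lt_succ_iff.1 (by exact_mod_cast hj)
        refine hG _ _ (hmem j (by omega)).1 ?_ (hmem (j + 1) hjN).2 (by simp) ?_
        · exact div_le_div_of_nonneg_right (by exact_mod_cast j.le_succ) hNpos.le
        · rw [← sub_div]
          push_cast
          rwa [add_sub_cancel_left]
    · change p (N / N) = p 1
      rw [div_self hNpos.ne']
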